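/- Let $f,g\in\mathbb{C}\{x,y\}$ be nonzero with $f(0,0)=g(0,0)=0$. Write $f=u\,y^{E_1}\prod_{i=1}^p[x-\alpha_i(y)]$, $g=u'\,y^{E_2}\prod_{j=1}^q[x-\beta_j(y)]$ with $u,u'$ units and $\alpha_i,\beta_j$ fractional power series ("arcs") of positive order in $y$. Let $\lambda_1,\dots,\lambda_N$ ($N=p+q$) be all the $\alpha_i$ and $\beta_j$, and assume that they are pairwise distinct. Let $J=f_yg_x-f_xg_y$; if $N=0$, assume in addition that $J\not\equiv0$. A polar root is an arc $\gamma$ with $O_y(\gamma)>0$, $J(\gamma(y),y)=0$ and $f(\gamma(y),y)\,g(\gamma(y),y)\neq0$, and it is counted with its multiplicity as a root of $J$. *The tree.* A bar $B$ (of finite height) is given by a series $\lambda_B(y)$ and a height $h(B)\in\mathbb{Q}_{\ge0}$. An arc $\xi$ climbs over $B$ at $a\in\mathbb{C}$ if $\xi=\lambda_B+a\,y^{h(B)}+{}$(higher order terms), and is bounded by $B$ if $O_y(\xi-\lambda_B)<h(B)$. The bars are obtained recursively. The ground bar $B_*$ has $\lambda_{B_*}=0$, $h(B_*)=0$. If $B$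 is a bar and $c\in\mathbb{C}$ is such that at least two of the $\lambda_k$ climb over $B$ at $c$, then the postbar of $B$ supported at $c$ is the bar whose height $h$ is the least contact order $O_y(\lambda_s-\lambda_t)$ of two of these roots, and whose series is any one of these roots with all terms $y^e$, $e\ge h$, omitted. A bar lies above $B$ if it is reached from $B$ by a nonempty sequence of postbars. An arc leaves the tree on $B$ if it climbs over $B$ at a point at which no $\lambda_k$ climbs over $B$. *Collinearity.* Let $\nu_f(B)$, $\nu_g(B)$ be the orders in $y$ of $f(\lambda_B(y)+zy^{h(B)},y)$, $g(\lambda_B(y)+zy^{h(B)},y)$ for generic $z$ (so $\nu_f(B_*)=E_1$, $\nu_g(B_*)=E_2$). For a point $c$ at which $s\ge0$ of the $\alpha_i$ and $t\ge0$ of the $\beta_j$ climb over $B$, $s+t\ge1$, put $\Delta_B(c)=\nu_f(B)\,t-\nu_g(B)\,s$. Such a point $c$ is collinear if $\Delta_B(c)=0$; $C(B)$ is the set of collinear points of $B$. The bar $B$ is collinear if $\Delta_B(c)=0$ for all such points $c$, and non-collinear otherwise. The cover of $c\in C(B)$ is the set of non-collinear bars $\bar B$ that are reached from $B$ by a sequence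 of postbars, the first of them supported at $c$, such that all bars strictly between $B$ and $\bar B$ are collinear; every $\lambda_k$ that climbs over $B$ at $c$ climbs over exactly one bar of the cover. *Conjugacy.* Bars $B,\bar B$ are conjugate if $h(B)=h(\bar B)$ and some irreducible $p\in\mathbb{C}\{x,y\}$ has a Newton-Puiseux root of positive order that climbs over $B$ and one that climbs over $\bar B$. Let $N(\mathfrak{B})$ be the set of conjugacy classes of non-collinear bars of positive height. *The factors.* For $\mathbb{B}\in N(\mathfrak{B})$ let $P_{\mathbb{B}}(x,y)=\prod[x-\gamma(y)]$ over the polar roots $\gamma$ that leave the tree on some $B\in\mathbb{B}$. Let $Q_{\mathbb{B}}(x,y)=\prod[x-\gamma(y)]$ over the polar roots $\gamma$ that climb over some $B\in\mathbb{B}$ at some $c\in C(B)$ and are bounded by every bar of the cover of $c$. Let $Q_{B_*}(x,y)=\prod[x-\gamma(y)]$ over the polar roots $\gamma$ that are bounded by every minimal non-collinear bar, that is, every non-collinear bar such that all bars below it are collinear. An empty product is $1$. **Theorem.** There are finitely many polar roots, $N(\mathfrak{B})$ is finite, the products $Q_{B_*}$ and $P_{\mathbb{B}}$, $Q_{\mathbb{B}}$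 ($\mathbb{B}\in N(\mathfrak{B})$) belong to $\mathbb{C}\{x,y\}$, and there are a unit $w\in\mathbb{C}\{x,y\}$ and an integer $E\ge0$ with $$J=w\cdot y^{E}\cdot Q_{B_*}\cdot\prod_{\mathbb{B}\in N(\mathfrak{B})}P_{\mathbb{B}}\,Q_{\mathbb{B}}\qquad\text{in }\mathbb{C}\{x,y\}.$$ -/

import Mathlib

open scoped Polynomial

noncomputable section

namespace PolarTree

/-! ### The ring of convergent power series in two variables -/

/-- A power series `∑ aₙ x^{n 0} y^{n 1}` converges near the origin iff `|aₙ| ≤ M R^{|n|}` for some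
real `M`, `R`. -/
def IsConvergent (F : MvPowerSeries (Fin 2) ℂ) : Prop :=
  ∃ M R : ℝ, ∀ n : Fin 2 →₀ ℕ, ‖MvPowerSeries.coeff n F‖ ≤ M * R ^ (n 0 + n 1)

theorem IsConvergent.exists_one_le {F : MvPowerSeries (Fin 2) ℂ} (hF : IsConvergent F) :
    ∃ M : ℝ, 1 ≤ M ∧ ∀ R₀ : ℝ, ∃ R : ℝ, R₀ ≤ R ∧ 1 ≤ R ∧
      ∀ n : Fin 2 →₀ ℕ, ‖MvPowerSeries.coeff n F‖ ≤ M * R ^ (n 0 + n 1) := by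
  obtain ⟨M, R, h⟩ := hF
  refine ⟨max 1 |M|, le_max_left _ _, fun R₀ => ⟨max R₀ (max 1 |R|), le_max_left _ _,
    (le_max_left _ _).trans (le_max_right _ _), fun n => ?_⟩⟩
  calc ‖MvPowerSeries.coeff n F‖ ≤ M * R ^ (n 0 + n 1) := h n
    _ ≤ |M * R ^ (n 0 + n 1)| := le_abs_self _
    _ = |M| * |R| ^ (n 0 + n 1) := by rw [abs_mul, abs_pow]
    _ ≤ max 1 |M| * max R₀ (max 1 |R|) ^ (n 0 + n 1) := by
      have h1 : |M| ≤ max 1 |M| := le_max_right _ _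
      have h2 : |R| ≤ max R₀ (max 1 |R|) := (le_max_right _ _).trans (le_max_right _ _)
      gcongr

theorem IsConvergent.mul {F G : MvPowerSeries (Fin 2) ℂ} (hF : IsConvergent F)
    (hG : IsConvergent G) : IsConvergent (F * G) := by
  obtain ⟨M, hM, hF⟩ := hF.exists_one_le
  obtain ⟨M', hM', hG⟩ := hG.exists_one_le
  obtain ⟨R₁, -, -, h₁⟩ := hF 0
  obtain ⟨R, hR, hR1, hG⟩ := hG R₁
  obtain ⟨R', hR', hR1', hF⟩ := hF R
  refine ⟨M * M', 2 * R', fun n => ?_⟩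
  rw [MvPowerSeries.coeff_mul]
  have key : ∀ p ∈ Finset.HasAntidiagonal.antidiagonal n,
      ‖MvPowerSeries.coeff p.1 F * MvPowerSeries.coeff p.2 G‖ ≤ M * M' * R' ^ (n 0 + n 1) := by
    intro p hp
    rw [Finset.HasAntidiagonal.mem_antidiagonal] at hp
    have e : n 0 + n 1 = (p.1 0 + p.1 1) + (p.2 0 + p.2 1) := by
      rw [← hp]; simp only [Finsupp.add_apply]; ring
    have hb : ‖MvPowerSeries.coeff p.2 G‖ ≤ M' * R' ^ (p.2 0 + p.2 1) :=
      (hG p.2).trans (by gcongr)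
    rw [norm_mul, e, pow_add]
    calc _ ≤ (M * R' ^ (p.1 0 + p.1 1)) * (M' * R' ^ (p.2 0 + p.2 1)) :=
          mul_le_mul (hF p.1) hb (norm_nonneg _) (by positivity)
      _ = _ := by ring
  have hcard : ((Finset.HasAntidiagonal.antidiagonal n).card : ℝ) ≤ 2 ^ (n 0 + n 1) := by
    have hinj : (Finset.HasAntidiagonal.antidiagonal n).card ≤
        ((Finset.range (n 0 + 1)) ×ˢ (Finset.range (n 1 + 1))).card := by
      refine Finset.card_le_card_of_injOn (fun p => (p.1 0, p.1 1)) ?_ ?_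
      · intro p hp
        have hp' : p.1 + p.2 = n := by simpa using hp
        have h0 := DFunLike.congr_fun hp' 0
        have h1 := DFunLike.congr_fun hp' 1
        simp only [Finsupp.add_apply] at h0 h1
        simp only [Finset.coe_product, Set.mem_prod, Finset.mem_coe, Finset.mem_range]
        omega
      · intro p hp q hq hpq
        have hp' : p.1 + p.2 = n := by simpa using hp
        have hq' : q.1 + q.2 = n := by simpa using hq
        simp only [Prod.mk.injEq] at hpq
        have h1 : p.1 = q.1 := by
          ext i; fin_cases i
          · exact hpq.1
          · exact hpq.2
        refine Prod.ext h1 ?_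
        rw [← hq', h1] at hp'
        exact add_left_cancel hp'
    rw [Finset.card_product, Finset.card_range, Finset.card_range] at hinj
    have hp : (n 0 + 1) * (n 1 + 1) ≤ 2 ^ (n 0 + n 1) := by
      rw [pow_add]
      exact Nat.mul_le_mul Nat.lt_two_pow_self Nat.lt_two_pow_self
    exact_mod_cast hinj.trans hp
  calc _ ≤ ∑ p ∈ Finset.HasAntidiagonal.antidiagonal n, M * M' * R' ^ (n 0 + n 1) :=
        norm_sum_le_of_le _ key
    _ = (Finset.HasAntidiagonal.antidiagonal n).card * (M * M' * R' ^ (n 0 + n 1)) := by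
        rw [Finset.sum_const, nsmul_eq_mul]
    _ ≤ 2 ^ (n 0 + n 1) * (M * M' * R' ^ (n 0 + n 1)) := by gcongr
    _ = _ := by rw [mul_pow]; ring

theorem IsConvergent.add {F G : MvPowerSeries (Fin 2) ℂ} (hF : IsConvergent F)
    (hG : IsConvergent G) : IsConvergent (F + G) := by
  obtain ⟨M, hM, hF⟩ := hF.exists_one_le
  obtain ⟨M', hM', hG⟩ := hG.exists_one_le
  obtain ⟨R, -, hR1, hG⟩ := hG 0
  obtain ⟨R', hR', hR1', hF⟩ := hF R
  refine ⟨M + M', R', fun n => ?_⟩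
  rw [map_add, add_mul]
  refine (norm_add_le _ _).trans (add_le_add (hF n) ((hG n).trans ?_))
  gcongr

theorem isConvergent_monomial (m : Fin 2 →₀ ℕ) (a : ℂ) :
    IsConvergent (MvPowerSeries.monomial m a) := by
  refine ⟨‖a‖, 1, fun n => ?_⟩
  rw [MvPowerSeries.coeff_monomial]
  split_ifs <;> simp

theorem IsConvergent.pderiv {F : MvPowerSeries (Fin 2) ℂ} (hF : IsConvergent F) (i : Fin 2) :
    IsConvergent (MvPowerSeries.pderiv ℂ i F) := by
  obtain ⟨M, hM, hF⟩ := hF.exists_one_le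
  obtain ⟨R, -, hR1, hF⟩ := hF 0
  refine ⟨M * R, 2 * R, fun n => ?_⟩
  rw [MvPowerSeries.coeff_pderiv, norm_mul]
  have h1 : ((n + Finsupp.single i 1 : Fin 2 →₀ ℕ) 0) + ((n + Finsupp.single i 1 : Fin 2 →₀ ℕ) 1)
      = n 0 + n 1 + 1 := by
    fin_cases i <;> simp <;> ring
  have h2 := hF (n + Finsupp.single i 1)
  rw [h1] at h2
  have h3 : ‖((n i : ℂ) + 1)‖ ≤ 2 ^ (n 0 + n 1) := by
    have e : ((n i : ℂ) + 1) = ((n i + 1 : ℕ) : ℂ) := by push_cast; rfl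
    rw [e, Complex.norm_natCast]
    have h4 : n i ≤ n 0 + n 1 := by fin_cases i <;> simp
    have h5 : n i + 1 ≤ 2 ^ (n 0 + n 1) :=
      (Nat.succ_le_of_lt Nat.lt_two_pow_self).trans (Nat.pow_le_pow_right (by norm_num) h4)
    exact_mod_cast h5
  calc _ ≤ (M * R ^ (n 0 + n 1 + 1)) * 2 ^ (n 0 + n 1) :=
        mul_le_mul h2 h3 (norm_nonneg _) (by positivity)
    _ = _ := by rw [mul_pow]; ring

/-- The ring `ℂ{x,y}` of convergent power series; `x` is the variable `0`, `y` the variable `1`. -/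
def convergentSubring : Subring (MvPowerSeries (Fin 2) ℂ) where
  carrier := {F | IsConvergent F}
  mul_mem' := IsConvergent.mul
  one_mem' := isConvergent_monomial 0 1
  add_mem' := IsConvergent.add
  zero_mem' := ⟨0, 0, fun n => by simp⟩
  neg_mem' := by
    rintro F ⟨M, R, h⟩
    exact ⟨M, R, fun n => by rw [map_neg, norm_neg]; exact h n⟩

/-- `ℂ{x,y}`. -/
abbrev Conv : Type := convergentSubring

/-- The coefficient of `x^i y^j`. -/
def coeffXY (F : Conv) (i j : ℕ) : ℂ :=
  MvPowerSeries.coeff (Finsupp.single 0 i + Finsupp.single 1 j) (F : MvPowerSeries (Fin 2) ℂ)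

/-- The coordinate function `y`, as an element of `ℂ{x,y}`. -/
def yVar : Conv := ⟨MvPowerSeries.X 1, isConvergent_monomial _ 1⟩

/-- `∂/∂x` on `ℂ{x,y}`. -/
def dx (F : Conv) : Conv := ⟨MvPowerSeries.pderiv ℂ 0 F, F.2.pderiv 0⟩

/-- `∂/∂y` on `ℂ{x,y}`. -/
def dy (F : Conv) : Conv := ⟨MvPowerSeries.pderiv ℂ 1 F, F.2.pderiv 1⟩

/-- The Jacobian determinant `f_y g_x - f_x g_y`. -/
def jac (f g : Conv) : Conv := dy f * dx g - dx f * dy g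

/-! ### Arcs and Newton-Puiseux roots -/

/-- The field of generalised power series in `y`, with rational exponents; the order `O_y` is
`HahnSeries.orderTop`. -/
abbrev K : Type := HahnSeries ℚ ℂ

/-- `ξ` is a fractional power series `∑ cₙ y^{n/D}`, `n ≥ 0`. -/
def IsArc (ξ : K) : Prop :=
  ∃ D : ℕ, 0 < D ∧ ∀ e ∈ ξ.support, ∃ n : ℕ, e * D = n

/-- The series `F(ξ(y), y) = ∑ a_{ij} ξ(y)^i y^j`, for an arc `ξ` of positive order. -/
def evalArc (F : Conv) (ξ : K) : K :=
  (HahnSeries.SummableFamily.smulFamily (fun n : ℕ × ℕ => coeffXY F n.1 n.2)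
    ((HahnSeries.SummableFamily.powers ξ).mul
      (HahnSeries.SummableFamily.powers (HahnSeries.single (1 : ℚ) (1 : ℂ))))).hsum

/-- `x = ξ(y)`, `O_y(ξ) > 0`, is a Newton-Puiseux root of `F`. -/
def IsRoot (F : Conv) (ξ : K) : Prop :=
  IsArc ξ ∧ 0 < ξ.orderTop ∧ evalArc F ξ = 0

/-- The multiplicity of `x = ξ(y)` as a root of `F`: the least `k` such that `∂ᵏF/∂xᵏ` does not
vanish along `ξ`. -/
def rootMult (F : Conv) (ξ : K) : ℕ :=
  sInf {k : ℕ | evalArc (dx^[k] F) ξ ≠ 0}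

/-- The polar roots of `(f, g)`. -/
def polarRoots (f g : Conv) : Set K :=
  {γ | IsRoot (jac f g) γ ∧ evalArc f γ * evalArc g γ ≠ 0}

/-! ### The tree model -/

/-- A bar `B` is given by the series `λ_B` and its (finite) height `h(B)`. -/
structure Bar where
  arc : K
  height : ℚ

/-- The ground bar `B_*`. -/
def groundBar : Bar := ⟨0, 0⟩

/-- `ξ = λ_B + a y^{h(B)} + ⋯`: the arc `ξ` climbs over `B` at `a`. -/
def ClimbsAt (ξ : K) (B : Bar) (a : ℂ) : Prop :=
  (B.height : WithTop ℚ) < (ξ - B.arc - HahnSeries.single B.height a).orderTop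

/-- `ξ` climbs over `B`. -/
def Climbs (ξ : K) (B : Bar) : Prop := ∃ a : ℂ, ClimbsAt ξ B a

/-- `ξ` is bounded by `B`. -/
def BoundedBy (ξ : K) (B : Bar) : Prop :=
  (ξ - B.arc).orderTop < (B.height : WithTop ℚ)

/-- The roots of `F` that climb over `B` at `c`. For `F = f * g` this is, if non-empty, the trunk
growing on `B` at `c`. -/
def rootsAt (F : Conv) (B : Bar) (c : ℂ) : Set K :=
  {ξ | IsRoot F ξ ∧ ClimbsAt ξ B c}

/-- The points of `B` at which a trunk grows. -/
def trunkPoints (f g : Conv) (B : Bar) : Set ℂ :=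
  {c | (rootsAt (f * g) B c).Nonempty}

/-- `B ⊥_c B'`: the bar `B'` (of finite height) is on top of the trunk that grows on `B` at `c`.
Its height is the least contact order in the trunk, and `λ_{B'}` is any root in the trunk, with
all terms `y^e`, `e ≥ h(B')`, omitted. -/
def IsPostbar (f g : Conv) (B : Bar) (c : ℂ) (B' : Bar) : Prop :=
  (∃ ξ ∈ rootsAt (f * g) B c, ∃ η ∈ rootsAt (f * g) B c,
    (ξ - η).orderTop = (B'.height : WithTop ℚ)) ∧
  (∀ ξ ∈ rootsAt (f * g) B c, ∀ η ∈ rootsAt (f * g) B c,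
    (B'.height : WithTop ℚ) ≤ (ξ - η).orderTop) ∧
  ∀ ξ ∈ rootsAt (f * g) B c, B'.arc = HahnSeries.truncLT B'.height ξ

/-- The bars of finite height of the tree model `T(f,g)`. -/
inductive IsBar (f g : Conv) : Bar → Prop
  | ground : IsBar f g groundBar
  | post (B : Bar) (c : ℂ) (B' : Bar) : IsBar f g B → IsPostbar f g B c B' → IsBar f g B'

/-- `B'` lies above `B`. -/
def LiesAbove (f g : Conv) (B' B : Bar) : Prop :=
  Relation.TransGen (fun X Y => ∃ c : ℂ, IsPostbar f g X c Y) B B'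

open Classical in
/-- `ν_F(B)`, the order in `y` of `F(λ_B(y) + z y^{h(B)}, y)` for generic `z`. For the ground bar
this is the order in `y` of `F(z, y)`, for generic `z` near `0`, so it is the exponent of `y` in
the factorisation of `F`. -/
def nu (F : Conv) (B : Bar) : ℚ :=
  if B.height = 0 then (multiplicity yVar F : ℚ)
  else if h : ∃ e : ℚ, ∀ᶠ z : ℂ in Filter.cofinite,
      (evalArc F (B.arc + HahnSeries.single B.height z)).orderTop = (e : WithTop ℚ)
    then h.choose else 0

/-- `Δ_B(c) = ν_f(B) q - ν_g(B) p`, where `[p, q]` is the bimultiplicity of `c` on `B`: `p` roots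
of `f` and `q` roots of `g` climb over `B` at `c`. -/
def Delta (f g : Conv) (B : Bar) (c : ℂ) : ℚ :=
  nu f B * (rootsAt g B c).ncard - nu g B * (rootsAt f B c).ncard

/-- `C(B)`, the set of collinear points on `B`. -/
def collinearPoints (f g : Conv) (B : Bar) : Set ℂ :=
  {c ∈ trunkPoints f g B | Delta f g B c = 0}

/-- `B` is a collinear bar. -/
def IsCollinear (f g : Conv) (B : Bar) : Prop :=
  ∀ c ∈ trunkPoints f g B, Delta f g B c = 0

/-- `ξ` leaves the tree on `B`. -/
def Leaves (f g : Conv) (ξ : K) (B : Bar) : Prop :=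
  ∃ a : ℂ, ClimbsAt ξ B a ∧ a ∉ trunkPoints f g B

/-- The set `S` of non-collinear bars is a cover of the point `c` on `B`. -/
structure IsCover (f g : Conv) (B : Bar) (c : ℂ) (S : Set Bar) : Prop where
  nonCollinear : ∀ B' ∈ S, ¬ IsCollinear f g B'
  minimal : ∀ B' ∈ S, ∃ B₁ : Bar, IsPostbar f g B c B₁ ∧
    Relation.ReflTransGen
      (fun X Y => IsCollinear f g X ∧ ∃ a : ℂ, IsPostbar f g X a Y) B₁ B'
  covers : ∀ ξ ∈ rootsAt (f * g) B c, ∃! B' : Bar, B' ∈ S ∧ Climbs ξ B'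

/-- `B` is a non-collinear bar, minimal in the sense that every bar below it is collinear. -/
def IsMinimalNonCollinear (f g : Conv) (B : Bar) : Prop :=
  IsBar f g B ∧ ¬ IsCollinear f g B ∧
    ∀ B' : Bar, IsBar f g B' → LiesAbove f g B B' → IsCollinear f g B'

/-- Conjugate bars. -/
def Conjugate (B B' : Bar) : Prop :=
  B.height = B'.height ∧ ∃ p : Conv, Irreducible p ∧
    (∃ ξ : K, IsRoot p ξ ∧ Climbs ξ B) ∧ ∃ ξ' : K, IsRoot p ξ' ∧ Climbs ξ' B'

/-- The conjugacy class of the bar `B` of `T(f,g)`. -/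
def conjClass (f g : Conv) (B : Bar) : Set Bar :=
  {B' | IsBar f g B' ∧ Conjugate B B'}

/-- The conjugacy classes of non-collinear bars of positive height. -/
def nonCollinearClasses (f g : Conv) : Set (Set Bar) :=
  {𝔹 | ∃ B : Bar, IsBar f g B ∧ ¬ IsCollinear f g B ∧ 0 < B.height ∧ 𝔹 = conjClass f g B}

/-! ### The factors -/

/-- The polar roots that leave the tree on some `B ∈ 𝔹`. -/
def pRoots (f g : Conv) (𝔹 : Set Bar) : Set K :=
  {γ ∈ polarRoots f g | ∃ B ∈ 𝔹, Leaves f g γ B}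

/-- The polar roots that climb over some `B ∈ 𝔹` at some `c ∈ C(B)`, and are bounded by every bar
of the cover of `c`. -/
def qRoots (f g : Conv) (𝔹 : Set Bar) : Set K :=
  {γ ∈ polarRoots f g | ∃ B ∈ 𝔹, ∃ c ∈ collinearPoints f g B, ClimbsAt γ B c ∧
    ∃ S : Set Bar, IsCover f g B c S ∧ ∀ B' ∈ S, BoundedBy γ B'}

/-- The polar roots that are bounded by every minimal non-collinear bar. -/
def groundRoots (f g : Conv) : Set K :=
  {γ ∈ polarRoots f g | ∀ B : Bar, IsMinimalNonCollinear f g B → BoundedBy γ B}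

/-- `∏ [x - γ(y)]` over the `γ ∈ S`, counted with their multiplicities as roots of `J`. -/
def rootProd (f g : Conv) (S : Set K) : K[X] :=
  ∏ᶠ γ ∈ S, (Polynomial.X - Polynomial.C γ) ^ rootMult (jac f g) γ

/-- The polynomial `P` in `x`, whose coefficients are generalised power series in `y`, is the
element `F` of `ℂ{x,y}`. -/
def IsGermOf (P : K[X]) (F : Conv) : Prop :=
  ∀ i : ℕ, P.coeff i = HahnSeries.ofPowerSeries ℚ ℂ (PowerSeries.mk fun j => coeffXY F i j)

end PolarTree

end

noncomputable section

namespace PolarTree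

/-! Let θ = y d/dy. Along an arc ξ the Jacobian satisfies y·J = θ(f)·g_x − f_x·θ(g), since the terms
containing θ(ξ) cancel (`y_mul_jac`). At a simple root of fg, say a root of f, the right side is
−f_x·θ(g). This is nonzero, because g(ξ(y), y) is a nonzero series of positive order
(`simple_left`). Hence J vanishes on no root of fg: the polar roots are all the Newton-Puiseux roots
of J, and J is nonzero as soon as fg has a root.

Let γ be a polar root. Dividing by fg gives (θf/f)(g_x/g) = (f_x/f)(θg/g) along γ. The leading
coefficient of θf/f is the order of f along γ, and f_x/f = u_x/u + Σ 1/(γ − α_i) is dominated by the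
roots closest to γ. If γ climbs over B at a point c where a trunk grows, but over no postbar there,
then all trunk roots at c have the same leading difference with γ and are the closest ones.
Comparing leading coefficients yields Δ_B(c) = 0 (`collinear_of_polar`, `delta_eq_zero_of_polar`).
So where Δ_B(c) ≠ 0, a polar root must climb over the postbar. That postbar is again non-collinear,
because Δ_B(c) is the sum of the values of Δ over the points of the postbar (`sum_delta`).

The bars over which an arc climbs form a chain. A polar root therefore either climbs over no
non-collinear bar of positive height, or has a unique highest one, B. The first kind are the ground
roots (`mem_groundRoots`). In the second case γ sits on B either at a point without trunk, which
gives the P-roots (`mem_pRoots`), or at a trunk point. That point must then be collinear, and being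
bounded by its cover says exactly that B is the highest bar, which gives the Q-roots (`mem_qRoots`).
The polar roots are thus partitioned (`polarRoots_eq`).

The rest is descent. The Newton-Puiseux theorem with convergence (`exists_branch`,
`exists_factorization`) writes J as a unit times y^E times ∏(x − γ). The conjugations y^e ↦ χ(e)y^e
with χ(1) = 1 permute the roots and preserve multiplicities, bars and Δ, and conjugate bars are
exactly those in one orbit (`conjugate_iff`). Each piece of the partition is stable, so the
coefficients of its product are convergent series with integral exponents
(`exists_isGermOf_rootPoly`). Uniqueness of germs identifies the product of the pieces with the
monic factor of J. -/

/-! ### Generalised power series: orders, leading terms, derivation, twists -/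

/-- All coefficients of exponent `< q` vanish. -/
def Vge (q : ℚ) (x : K) : Prop := ∀ e < q, x.coeff e = 0

/-- All coefficients of exponent `≤ q` vanish. -/
def Vgt (q : ℚ) (x : K) : Prop := ∀ e ≤ q, x.coeff e = 0

/-- `x = c y^q + ⋯`, where `c` may vanish. -/
def HasLead (x : K) (q : ℚ) (c : ℂ) : Prop := Vge q x ∧ x.coeff q = c

theorem le_orderTop_iff {q : ℚ} {x : K} : (q : WithTop ℚ) ≤ x.orderTop ↔ Vge q x := by
  rw [HahnSeries.le_orderTop_iff_forall]
  simp only [WithTop.coe_lt_coe]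
  rfl

theorem lt_orderTop_iff {q : ℚ} {x : K} : (q : WithTop ℚ) < x.orderTop ↔ Vgt q x := by
  constructor
  · intro h e he
    exact HahnSeries.coeff_eq_zero_of_lt_orderTop (lt_of_le_of_lt (WithTop.coe_le_coe.2 he) h)
  · intro h
    by_contra h'
    rw [not_lt] at h'
    have hx : x ≠ 0 := by
      rintro rfl
      simp at h'
    obtain ⟨e, he⟩ := WithTop.ne_top_iff_exists.1 (HahnSeries.orderTop_ne_top.2 hx)
    rw [← he] at h'
    exact HahnSeries.coeff_orderTop_ne he.symm (h e (WithTop.coe_le_coe.1 h'))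

theorem orderTop_eq_iff {q : ℚ} {x : K} :
    x.orderTop = (q : WithTop ℚ) ↔ Vge q x ∧ x.coeff q ≠ 0 := by
  constructor
  · intro h
    exact ⟨le_orderTop_iff.1 h.ge, HahnSeries.coeff_orderTop_ne h⟩
  · rintro ⟨h1, h2⟩
    refine le_antisymm ?_ (le_orderTop_iff.2 h1)
    exact HahnSeries.orderTop_le_of_coeff_ne_zero h2

theorem pos_orderTop_iff {x : K} : 0 < x.orderTop ↔ Vgt 0 x := by
  rw [← lt_orderTop_iff]; rfl

theorem Vge.mono {q r : ℚ} {x : K} (h : Vge q x) (hr : r ≤ q) : Vge r x :=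
  fun e he => h e (he.trans_le hr)

theorem Vge.vgt {q r : ℚ} {x : K} (h : Vge q x) (hr : r < q) : Vgt r x :=
  fun e he => h e (he.trans_lt hr)

theorem Vgt.vge {q : ℚ} {x : K} (h : Vgt q x) : Vge q x := fun e he => h e he.le

theorem vge_zero (q : ℚ) : Vge q 0 := fun _ _ => rfl

theorem Vge.add {q : ℚ} {x y : K} (hx : Vge q x) (hy : Vge q y) : Vge q (x + y) := by
  intro e he
  rw [HahnSeries.coeff_add, hx e he, hy e he, add_zero]

theorem Vge.neg {q : ℚ} {x : K} (hx : Vge q x) : Vge q (-x) := by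
  intro e he
  rw [HahnSeries.coeff_neg, hx e he, neg_zero]

theorem Vge.sub {q : ℚ} {x y : K} (hx : Vge q x) (hy : Vge q y) : Vge q (x - y) := by
  intro e he
  rw [HahnSeries.coeff_sub, hx e he, hy e he, sub_zero]

theorem Vgt.add {q : ℚ} {x y : K} (hx : Vgt q x) (hy : Vgt q y) : Vgt q (x + y) := by
  intro e he
  rw [HahnSeries.coeff_add, hx e he, hy e he, add_zero]

theorem Vgt.sub {q : ℚ} {x y : K} (hx : Vgt q x) (hy : Vgt q y) : Vgt q (x - y) := by
  intro e he
  rw [HahnSeries.coeff_sub, hx e he, hy e he, sub_zero]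

theorem Vge.mul {q r : ℚ} {x y : K} (hx : Vge q x) (hy : Vge r y) : Vge (q + r) (x * y) := by
  intro e he
  rw [HahnSeries.coeff_mul]
  refine Finset.sum_eq_zero fun p hp => ?_
  rw [Finset.mem_antidiagonal] at hp
  by_cases h : p.1 < q
  · rw [hx _ h, zero_mul]
  · rw [hy p.2 (by linarith [hp.2.2]), mul_zero]

theorem Vgt.mul_vge {q r : ℚ} {x y : K} (hx : Vgt q x) (hy : Vge r y) : Vgt (q + r) (x * y) := by
  intro e he
  rw [HahnSeries.coeff_mul]
  refine Finset.sum_eq_zero fun p hp => ?_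
  rw [Finset.mem_antidiagonal] at hp
  by_cases h : p.1 ≤ q
  · rw [hx _ h, zero_mul]
  · rw [hy p.2 (by linarith [hp.2.2]), mul_zero]

theorem vge_one : Vge 0 (1 : K) := by
  intro e he
  rw [HahnSeries.coeff_one, if_neg he.ne]

theorem Vge.pow {q : ℚ} {x : K} (hx : Vge q x) (n : ℕ) : Vge (n * q) (x ^ n) := by
  induction n with
  | zero => simpa using vge_one
  | succ n ih =>
    rw [pow_succ]
    have := ih.mul hx
    convert this using 1
    push_cast
    ring

theorem vge_single {q r : ℚ} (c : ℂ) (h : q ≤ r) : Vge q (HahnSeries.single r c) := by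
  intro e he
  exact HahnSeries.coeff_single_of_ne (he.trans_le h).ne

theorem vgt_single {q r : ℚ} (c : ℂ) (h : q < r) : Vgt q (HahnSeries.single r c) := by
  intro e he
  exact HahnSeries.coeff_single_of_ne (he.trans_lt h).ne

/-- Every exponent is exceeded by some nδ − C. The constant `C` leaves room for maps that lose a
bounded amount of order, such as derivations. -/
theorem eq_zero_of_forall_vge {x : K} {δ C : ℚ} (hδ : 0 < δ) (h : ∀ n : ℕ, Vge (n * δ - C) x) :
    x = 0 := by
  ext e
  obtain ⟨n, hn⟩ := exists_nat_gt ((e + C) / δ)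
  rw [div_lt_iff₀ hδ] at hn
  exact h n e (by linarith)

theorem exists_vge_of_pos {x : K} (hx : 0 < x.orderTop) : ∃ δ : ℚ, 0 < δ ∧ Vge δ x := by
  by_cases h : x = 0
  · exact ⟨1, one_pos, h ▸ vge_zero 1⟩
  · obtain ⟨e, he⟩ := WithTop.ne_top_iff_exists.1 (HahnSeries.orderTop_ne_top.2 h)
    refine ⟨e, ?_, le_orderTop_iff.1 he.le⟩
    rw [← he] at hx
    exact WithTop.coe_lt_coe.1 hx

theorem pos_orderTop_of_vge {x : K} {δ : ℚ} (hδ : 0 < δ) (h : Vge δ x) : 0 < x.orderTop :=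
  pos_orderTop_iff.2 (h.vgt hδ)

theorem hasLead_iff {x : K} {q : ℚ} {c : ℂ} :
    HasLead x q c ↔ (q : WithTop ℚ) < (x - HahnSeries.single q c).orderTop := by
  rw [lt_orderTop_iff]
  constructor
  · rintro ⟨h1, h2⟩ e he
    rw [HahnSeries.coeff_sub]
    rcases he.lt_or_eq with h | rfl
    · rw [h1 e h, HahnSeries.coeff_single_of_ne h.ne, sub_zero]
    · rw [h2, HahnSeries.coeff_single_same, sub_self]
  · intro h
    refine ⟨fun e he => ?_, ?_⟩
    · have := h e he.le
      rwa [HahnSeries.coeff_sub, HahnSeries.coeff_single_of_ne he.ne, sub_zero] at this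
    · have := h q le_rfl
      rwa [HahnSeries.coeff_sub, HahnSeries.coeff_single_same, sub_eq_zero] at this

theorem HasLead.vgt {x : K} {q : ℚ} {c : ℂ} (h : HasLead x q c) :
    Vgt q (x - HahnSeries.single q c) := lt_orderTop_iff.1 (hasLead_iff.1 h)

theorem hasLead_of_vgt {x : K} {q : ℚ} {c : ℂ} (h : Vgt q (x - HahnSeries.single q c)) :
    HasLead x q c := hasLead_iff.2 (lt_orderTop_iff.2 h)

theorem Vgt.hasLead {x : K} {q : ℚ} (h : Vgt q x) : HasLead x q 0 := ⟨h.vge, h q le_rfl⟩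

theorem HasLead.unique {x : K} {q : ℚ} {c d : ℂ} (h : HasLead x q c) (h' : HasLead x q d) :
    c = d := h.2.symm.trans h'.2

/-- Since a leading coefficient may vanish, leading terms add without any case distinction about
cancellation. Logarithmic derivatives can then be compared by linear algebra. -/
theorem HasLead.add {x y : K} {q : ℚ} {c d : ℂ} (hx : HasLead x q c) (hy : HasLead y q d) :
    HasLead (x + y) q (c + d) :=
  ⟨hx.1.add hy.1, by rw [HahnSeries.coeff_add, hx.2, hy.2]⟩

theorem HasLead.sum {ι : Type*} {s : Finset ι} {x : ι → K} {q : ℚ} {c : ι → ℂ}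
    (h : ∀ i ∈ s, HasLead (x i) q (c i)) : HasLead (∑ i ∈ s, x i) q (∑ i ∈ s, c i) := by
  classical
  induction s using Finset.induction_on with
  | empty => exact ⟨vge_zero q, rfl⟩
  | insert i s hi ih =>
    rw [Finset.sum_insert hi, Finset.sum_insert hi]
    exact (h i (Finset.mem_insert_self _ _)).add
      (ih fun j hj => h j (Finset.mem_insert_of_mem hj))

theorem HasLead.mul {x y : K} {q r : ℚ} {c d : ℂ} (hx : HasLead x q c) (hy : HasLead y r d) :
    HasLead (x * y) (q + r) (c * d) := by
  refine hasLead_of_vgt ?_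
  have e : x * y - HahnSeries.single (q + r) (c * d) =
      (x - HahnSeries.single q c) * y +
      (y - HahnSeries.single r d) * HahnSeries.single q c := by
    rw [← HahnSeries.single_mul_single]
    ring
  rw [e]
  refine (hx.vgt.mul_vge hy.1).add ?_
  rw [add_comm q r]
  exact hy.vgt.mul_vge (vge_single c le_rfl)

theorem HasLead.orderTop {x : K} {q : ℚ} {c : ℂ} (h : HasLead x q c) (hc : c ≠ 0) :
    x.orderTop = (q : WithTop ℚ) := orderTop_eq_iff.2 ⟨h.1, by rwa [h.2]⟩

theorem HasLead.ne_zero {x : K} {q : ℚ} {c : ℂ} (h : HasLead x q c) (hc : c ≠ 0) : x ≠ 0 := by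
  rintro rfl
  exact hc h.2.symm

theorem exists_hasLead {x : K} (hx : x ≠ 0) : ∃ q c, c ≠ 0 ∧ HasLead x q c := by
  obtain ⟨e, he⟩ := WithTop.ne_top_iff_exists.1 (HahnSeries.orderTop_ne_top.2 hx)
  have := orderTop_eq_iff.1 he.symm
  exact ⟨e, _, this.2, this.1, rfl⟩

/-- Order and leading coefficient of the inverse are forced by multiplicativity in x · x⁻¹ = 1. -/
theorem HasLead.inv {x : K} {q : ℚ} {c : ℂ} (h : HasLead x q c) (hc : c ≠ 0) :
    HasLead x⁻¹ (-q) c⁻¹ := by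
  have hx := h.ne_zero hc
  obtain ⟨r, d, hd, h'⟩ := exists_hasLead (inv_ne_zero hx)
  have h1 := h.mul h'
  rw [mul_inv_cancel₀ hx] at h1
  have h2 : HasLead (1 : K) 0 1 := ⟨vge_one, by simp⟩
  have h3 := (h1.orderTop (mul_ne_zero hc hd)).symm.trans (h2.orderTop one_ne_zero)
  have h4 : q + r = 0 := WithTop.coe_eq_coe.1 h3
  obtain rfl : r = -q := by linarith
  rw [h4] at h1
  have h5 := h1.unique h2
  rwa [← eq_inv_of_mul_eq_one_right h5]

theorem hasLead_single (q : ℚ) (c : ℂ) : HasLead (HahnSeries.single q c) q c :=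
  ⟨vge_single c le_rfl, HahnSeries.coeff_single_same _ _⟩

/-! ### The derivation `y d/dy` -/

/-- The derivation `y d/dy`. -/
def theta (x : K) : K where
  coeff e := (e : ℂ) * x.coeff e
  isPWO_support' := x.isPWO_support.mono fun e he => by
    rw [Function.mem_support] at he
    exact right_ne_zero_of_mul he

theorem coeff_theta (x : K) (e : ℚ) : (theta x).coeff e = e * x.coeff e := rfl

theorem theta_add (x y : K) : theta (x + y) = theta x + theta y := by
  ext e
  simp only [coeff_theta, HahnSeries.coeff_add, mul_add]

theorem theta_zero : theta 0 = 0 := by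
  ext e
  simp [coeff_theta]

theorem theta_smul (c : ℂ) (x : K) : theta (c • x) = c • theta x := by
  ext e
  simp only [coeff_theta, HahnSeries.coeff_smul, smul_eq_mul]
  ring

theorem theta_single (q : ℚ) (c : ℂ) :
    theta (HahnSeries.single q c) = HahnSeries.single q (q * c) := by
  ext e
  rw [coeff_theta]
  by_cases h : e = q
  · subst h
    simp
  · simp [HahnSeries.coeff_single_of_ne h]

theorem theta_mul (x y : K) : theta (x * y) = theta x * y + x * theta y := by
  ext e
  -- The support of θx can be smaller than that of x, as exponent 0 is lost. All three products are
  -- summed over the same pairs of exponents from the supports of x and y, where Leibniz' rule is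
  -- termwise the identity e = p.1 + p.2.
  have hx : (theta x).support ⊆ x.support := fun e he => right_ne_zero_of_mul he
  have hy : (theta y).support ⊆ y.support := fun e he => right_ne_zero_of_mul he
  rw [coeff_theta, HahnSeries.coeff_add, HahnSeries.coeff_mul,
    HahnSeries.coeff_mul_left' x.isPWO_support hx, HahnSeries.coeff_mul_right' y.isPWO_support hy,
    Finset.mul_sum, ← Finset.sum_add_distrib]
  refine Finset.sum_congr rfl fun p hp => ?_
  rw [Finset.mem_antidiagonal] at hp
  rw [coeff_theta, coeff_theta, ← hp.2.2]
  push_cast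
  ring

theorem theta_pow (x : K) (n : ℕ) : theta (x ^ n) = n * x ^ (n - 1) * theta x := by
  induction n with
  | zero =>
    have := theta_single 0 1
    simp at this ⊢
    exact this
  | succ n ih =>
    rw [pow_succ, theta_mul, ih]
    rcases n with _ | n
    · simp
    · simp only [Nat.add_sub_cancel]
      push_cast
      ring

theorem Vge.theta {q : ℚ} {x : K} (h : Vge q x) : Vge q (theta x) := by
  intro e he
  rw [coeff_theta, h e he, mul_zero]

theorem HasLead.theta {q : ℚ} {x : K} {c : ℂ} (h : HasLead x q c) :
    HasLead (theta x) q (q * c) := ⟨h.1.theta, by rw [coeff_theta, h.2]⟩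

/-- The series `x`, with `y^e` multiplied by `χ e`. -/
def twistFun (χ : AddChar ℚ ℂ) (x : K) : K where
  coeff e := χ e * x.coeff e
  isPWO_support' := x.isPWO_support.mono fun e he => by
    rw [Function.mem_support] at he
    exact right_ne_zero_of_mul he

theorem twist_ne (χ : AddChar ℚ ℂ) (e : ℚ) : χ e ≠ 0 := (χ.val_isUnit e).ne_zero

theorem support_twistFun (χ : AddChar ℚ ℂ) (x : K) : (twistFun χ x).support = x.support := by
  ext e
  simp only [HahnSeries.mem_support, twistFun, ne_eq, mul_eq_zero, twist_ne, false_or]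

/-- The automorphism of `K` that multiplies `y^e` by `χ e`. -/
def twist (χ : AddChar ℚ ℂ) : K →+* K where
  toFun := twistFun χ
  map_zero' := by
    ext e
    simp [twistFun]
  map_one' := by
    ext e
    by_cases h : e = 0
    · subst h
      simp [twistFun]
    · simp [twistFun, HahnSeries.coeff_one, h]
  map_add' x y := by
    ext e
    simp [twistFun, mul_add]
  map_mul' x y := by
    ext e
    have : (twistFun χ (x * y)).coeff e = χ e * (x * y).coeff e := rfl
    rw [this, HahnSeries.coeff_mul, HahnSeries.coeff_mul, Finset.mul_sum]
    refine Finset.sum_congr ?_ fun p hp => ?_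
    · ext p
      simp only [Finset.mem_antidiagonal, support_twistFun]
    · rw [Finset.mem_antidiagonal] at hp
      change _ = (χ p.1 * x.coeff p.1) * (χ p.2 * y.coeff p.2)
      rw [← hp.2.2, AddChar.map_add_eq_mul]
      ring

theorem coeff_twist (χ : AddChar ℚ ℂ) (x : K) (e : ℚ) :
    (twist χ x).coeff e = χ e * x.coeff e := rfl

theorem twist_twist (χ ψ : AddChar ℚ ℂ) (x : K) : twist χ (twist ψ x) = twist (χ * ψ) x := by
  ext e
  simp only [coeff_twist, AddChar.mul_apply, mul_assoc]

theorem twist_one (x : K) : twist 1 x = x := by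
  ext e
  simp only [coeff_twist, AddChar.one_apply, one_mul]

theorem twist_inv_twist (χ : AddChar ℚ ℂ) (x : K) : twist χ⁻¹ (twist χ x) = x := by
  rw [twist_twist, inv_mul_cancel, twist_one]

theorem twist_twist_inv (χ : AddChar ℚ ℂ) (x : K) : twist χ (twist χ⁻¹ x) = x := by
  rw [twist_twist, mul_inv_cancel, twist_one]

theorem twist_injective (χ : AddChar ℚ ℂ) : Function.Injective (twist χ) :=
  (twist χ).injective

theorem twist_single (χ : AddChar ℚ ℂ) (q : ℚ) (c : ℂ) :
    twist χ (HahnSeries.single q c) = HahnSeries.single q (χ q * c) := by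
  ext e
  rw [coeff_twist]
  by_cases h : e = q
  · subst h
    simp
  · simp [HahnSeries.coeff_single_of_ne h]

theorem vge_twist {χ : AddChar ℚ ℂ} {q : ℚ} {x : K} : Vge q (twist χ x) ↔ Vge q x := by
  simp only [Vge, coeff_twist, mul_eq_zero, twist_ne, false_or]

theorem support_twist (χ : AddChar ℚ ℂ) (x : K) : (twist χ x).support = x.support := by
  ext e
  simp only [HahnSeries.mem_support, coeff_twist, ne_eq, mul_eq_zero, twist_ne, false_or]

theorem orderTop_twist (χ : AddChar ℚ ℂ) (x : K) : (twist χ x).orderTop = x.orderTop := by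
  by_cases hx : x = 0
  · rw [hx, map_zero]
  · obtain ⟨q, c, hc, h⟩ := exists_hasLead hx
    rw [h.orderTop hc, orderTop_eq_iff, vge_twist, coeff_twist, h.2]
    exact ⟨h.1, mul_ne_zero (twist_ne χ q) hc⟩

theorem isArc_twist {χ : AddChar ℚ ℂ} {x : K} : IsArc (twist χ x) ↔ IsArc x := by
  simp only [IsArc, support_twist]

theorem truncLT_twist (χ : AddChar ℚ ℂ) (h : ℚ) (x : K) :
    HahnSeries.truncLT h (twist χ x) = twist χ (HahnSeries.truncLT h x) := by
  ext e
  rw [coeff_twist]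
  by_cases he : e < h
  · rw [HahnSeries.coeff_truncLT_of_lt he, HahnSeries.coeff_truncLT_of_lt he, coeff_twist]
  · rw [HahnSeries.coeff_truncLT_of_le (not_lt.1 he), HahnSeries.coeff_truncLT_of_le (not_lt.1 he),
      mul_zero]

/-- The character `e ↦ exp (2πie)` of `ℚ`. -/
def expChar : AddChar ℚ ℂ where
  toFun e := Complex.exp (2 * Real.pi * Complex.I * e)
  map_zero_eq_one' := by simp
  map_add_eq_mul' a b := by
    rw [← Complex.exp_add]
    push_cast
    ring_nf

theorem expChar_apply (e : ℚ) : expChar e = Complex.exp (2 * Real.pi * Complex.I * e) := rfl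

theorem expChar_one : expChar 1 = 1 := by
  rw [expChar_apply]
  simp [Complex.exp_two_pi_mul_I]

/-- This is why one character is enough for descent: a series fixed by `twist expChar` has integral
exponents only. -/
theorem expChar_eq_one {e : ℚ} (h : expChar e = 1) : ∃ n : ℤ, e = n := by
  rw [expChar_apply, Complex.exp_eq_one_iff] at h
  obtain ⟨n, hn⟩ := h
  refine ⟨n, ?_⟩
  have h2 : (2 * Real.pi * Complex.I : ℂ) ≠ 0 := Complex.two_pi_I_ne_zero
  have : (e : ℂ) = n := mul_left_cancel₀ h2 (by rw [hn]; ring)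
  exact_mod_cast this

/-! ### Evaluation of power series in two variables -/

/-- Formal power series in two variables. -/
abbrev FPS : Type := MvPowerSeries (Fin 2) ℂ

/-- The exponent of the monomial `x^i y^j`. -/
def mon (i j : ℕ) : Fin 2 →₀ ℕ := Finsupp.single 0 i + Finsupp.single 1 j

@[simp] theorem mon_apply_zero (i j : ℕ) : mon i j 0 = i := by simp [mon]

@[simp] theorem mon_apply_one (i j : ℕ) : mon i j 1 = j := by simp [mon]

theorem eq_mon (n : Fin 2 →₀ ℕ) : n = mon (n 0) (n 1) := by
  ext i
  fin_cases i <;> simp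

theorem mon_injective {i j i' j' : ℕ} (h : mon i j = mon i' j') : i = i' ∧ j = j' :=
  ⟨by simpa using DFunLike.congr_fun h 0, by simpa using DFunLike.congr_fun h 1⟩

theorem mon_add (i j i' j' : ℕ) : mon i j + mon i' j' = mon (i + i') (j + j') := by
  ext k
  fin_cases k <;> simp

theorem degree_fin_two (n : Fin 2 →₀ ℕ) : n.degree = n 0 + n 1 := by
  rw [Finsupp.degree_eq_sum]
  simp

/-- The coefficient of `x^i y^j`. -/
def cc (F : FPS) (i j : ℕ) : ℂ := MvPowerSeries.coeff (mon i j) F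

theorem coeff_eq_cc (F : FPS) (n : Fin 2 →₀ ℕ) : MvPowerSeries.coeff n F = cc F (n 0) (n 1) := by
  rw [cc, ← eq_mon]

theorem ext_cc {F G : FPS} (h : ∀ i j, cc F i j = cc G i j) : F = G := by
  ext n
  rw [coeff_eq_cc, coeff_eq_cc, h]

theorem cc_add (F G : FPS) (i j : ℕ) : cc (F + G) i j = cc F i j + cc G i j := map_add _ _ _

theorem cc_sub (F G : FPS) (i j : ℕ) : cc (F - G) i j = cc F i j - cc G i j := map_sub _ _ _

theorem cc_smul (c : ℂ) (F : FPS) (i j : ℕ) : cc (c • F) i j = c * cc F i j := by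
  rw [cc, MvPowerSeries.coeff_smul, cc]

theorem cc_monomial (i j i' j' : ℕ) (c : ℂ) :
    cc (MvPowerSeries.monomial (mon i j) c) i' j' = if i' = i ∧ j' = j then c else 0 := by
  rw [cc, MvPowerSeries.coeff_monomial]
  refine if_congr ⟨mon_injective, ?_⟩ rfl rfl
  rintro ⟨rfl, rfl⟩
  rfl

theorem monomial_mon (i j : ℕ) (c : ℂ) :
    (MvPowerSeries.monomial (mon i j) c : FPS) =
      MvPowerSeries.C c * (MvPowerSeries.X 0 ^ i * MvPowerSeries.X 1 ^ j) := by
  rw [MvPowerSeries.X_pow_eq, MvPowerSeries.X_pow_eq, MvPowerSeries.monomial_mul_monomial,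
    ← MvPowerSeries.monomial_zero_eq_C_apply, MvPowerSeries.monomial_mul_monomial]
  simp [mon]

/-- All terms of `F` have degree at least `n`. -/
def Low (n : ℕ) (F : FPS) : Prop := (n : ℕ∞) ≤ F.order

theorem low_iff {n : ℕ} {F : FPS} : Low n F ↔ ∀ i j, i + j < n → cc F i j = 0 := by
  constructor
  · intro h i j hij
    refine MvPowerSeries.coeff_of_lt_order (lt_of_lt_of_le ?_ h)
    rw [degree_fin_two]
    simpa using (by exact_mod_cast hij)
  · intro h
    refine MvPowerSeries.nat_le_order fun d hd => ?_
    rw [coeff_eq_cc]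
    rw [degree_fin_two] at hd
    exact h _ _ hd

theorem Low.mul_right {n : ℕ} {F : FPS} (h : Low n F) (G : FPS) : Low n (F * G) :=
  h.trans (le_self_add.trans MvPowerSeries.le_order_mul)

theorem Low.mul_left {n : ℕ} {F : FPS} (h : Low n F) (G : FPS) : Low n (G * F) := by
  rw [mul_comm]
  exact h.mul_right G

/-- The sum of the terms `x^i y^j` of `F` with `i, j < n`. -/
def boxTrunc (n : ℕ) (F : FPS) : FPS :=
  ∑ p ∈ Finset.range n ×ˢ Finset.range n, MvPowerSeries.monomial (mon p.1 p.2) (cc F p.1 p.2)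

/-- A monomial outside the box has an exponent that is at least n, hence degree at least n.
Polynomials are therefore dense for the order topology. -/
theorem low_sub_boxTrunc (n : ℕ) (F : FPS) : Low n (F - boxTrunc n F) := by
  rw [low_iff]
  intro i j hij
  rw [cc_sub, boxTrunc, cc, cc, map_sum, sub_eq_zero]
  rw [Finset.sum_eq_single (i, j)]
  · have := cc_monomial i j i j (cc F i j)
    rw [cc] at this
    rw [this]
    simp [cc]
  · rintro ⟨a, b⟩ - hne
    have := cc_monomial a b i j (cc F a b)
    rw [cc] at this
    rw [this, if_neg]
    rintro ⟨rfl, rfl⟩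
    exact hne rfl
  · intro h
    simp only [Finset.mem_product, Finset.mem_range, not_and_or, not_lt] at h
    omega

/-- Multiplication by `z`, as a linear map. -/
def mulL (z : K) : K →ₗ[ℂ] K where
  toFun x := x * z
  map_add' x y := add_mul x y z
  map_smul' c x := by
    rw [RingHom.id_apply, ← HahnSeries.C_mul_eq_smul, ← HahnSeries.C_mul_eq_smul, mul_assoc]

theorem mulL_apply (z x : K) : mulL z x = x * z := rfl

/-- A linear map `FPS → K` that is continuous and vanishes on monomials is zero. -/
theorem linearMap_eq_zero {Φ : FPS →ₗ[ℂ] K} {δ C : ℚ} (hδ : 0 < δ)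
    (hcont : ∀ n F, Low n F → Vge (n * δ - C) (Φ F))
    (hmon : ∀ i j, Φ (MvPowerSeries.monomial (mon i j) 1) = 0) : Φ = 0 := by
  ext1 F
  refine eq_zero_of_forall_vge (C := C) hδ fun n => ?_
  have h : Φ (boxTrunc n F) = 0 := by
    rw [boxTrunc, map_sum]
    refine Finset.sum_eq_zero fun p _ => ?_
    have : (MvPowerSeries.monomial (mon p.1 p.2) (cc F p.1 p.2) : FPS) =
        cc F p.1 p.2 • MvPowerSeries.monomial (mon p.1 p.2) 1 := by
      rw [← map_smul, smul_eq_mul, mul_one]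
    rw [this, map_smul, hmon, smul_zero]
  have h2 := hcont n _ (low_sub_boxTrunc n F)
  rwa [map_sub, h, sub_zero] at h2

open HahnSeries.SummableFamily in
/-- `F(ξ, η)`. -/
def ev (ξ η : K) : FPS →ₗ[ℂ] K where
  toFun F := (smulFamily (fun n : ℕ × ℕ => cc F n.1 n.2) ((powers ξ).mul (powers η))).hsum
  map_add' F G := by
    rw [← hsum_add]
    congr 1
    ext1 n
    simp only [smulFamily_toFun, HahnSeries.SummableFamily.add_apply, cc_add, add_smul]
  map_smul' c F := by
    ext e
    rw [HahnSeries.coeff_smul, coeff_hsum, coeff_hsum, RingHom.id_apply, smul_finsum]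
    refine finsum_congr fun n => ?_
    rw [smulFamily_toFun, smulFamily_toFun, cc_smul, HahnSeries.coeff_smul, HahnSeries.coeff_smul,
      smul_eq_mul, smul_eq_mul, smul_eq_mul, mul_assoc]

/-- The second argument of `ev` is kept free because, after a ramification, the variable y is
evaluated at y^{1/D} instead of y. -/
theorem evalArc_eq_ev (F : Conv) (ξ : K) : evalArc F ξ = ev ξ (HahnSeries.single 1 1) F.1 := rfl

open HahnSeries.SummableFamily in
theorem coeff_ev {ξ η : K} (hξ : 0 < ξ.orderTop) (hη : 0 < η.orderTop) (F : FPS) (e : ℚ) :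
    (ev ξ η F).coeff e = ∑ᶠ n : ℕ × ℕ, cc F n.1 n.2 * (ξ ^ n.1 * η ^ n.2).coeff e := by
  change (smulFamily (fun n : ℕ × ℕ => cc F n.1 n.2) ((powers ξ).mul (powers η))).hsum.coeff e = _
  rw [coeff_hsum]
  refine finsum_congr fun n => ?_
  rw [smulFamily_toFun, mul_toFun, powers_of_orderTop_pos hξ, powers_of_orderTop_pos hη,
    HahnSeries.coeff_smul, smul_eq_mul]

theorem vge_pow_mul_pow {δ : ℚ} {ξ η : K} (hξ : Vge δ ξ) (hη : Vge δ η) (i j : ℕ) :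
    Vge ((i + j : ℕ) * δ) (ξ ^ i * η ^ j) := by
  have := (hξ.pow i).mul (hη.pow j)
  convert this using 1
  push_cast
  ring

theorem vge_ev {δ : ℚ} (hδ : 0 < δ) {ξ η : K} (hξ : Vge δ ξ) (hη : Vge δ η) {n : ℕ} {F : FPS}
    (hF : Low n F) : Vge (n * δ) (ev ξ η F) := by
  intro e he
  rw [coeff_ev (pos_orderTop_of_vge hδ hξ) (pos_orderTop_of_vge hδ hη)]
  refine finsum_eq_zero_of_forall_eq_zero fun p => ?_
  by_cases h : p.1 + p.2 < n
  · rw [low_iff.1 hF _ _ h, zero_mul]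
  · rw [vge_pow_mul_pow hξ hη p.1 p.2 e (he.trans_le ?_), mul_zero]
    have : (n : ℚ) ≤ ((p.1 + p.2 : ℕ) : ℚ) := by exact_mod_cast not_lt.1 h
    exact mul_le_mul_of_nonneg_right this hδ.le

theorem ev_monomial {ξ η : K} (hξ : 0 < ξ.orderTop) (hη : 0 < η.orderTop) (i j : ℕ) (c : ℂ) :
    ev ξ η (MvPowerSeries.monomial (mon i j) c) = c • (ξ ^ i * η ^ j) := by
  ext e
  rw [coeff_ev hξ hη, finsum_eq_single _ (i, j)]
  · simp [cc_monomial]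
  · rintro ⟨a, b⟩ hab
    rw [cc_monomial, if_neg, zero_mul]
    rintro ⟨rfl, rfl⟩
    exact hab rfl

theorem exists_common_vge {ξ η : K} (hξ : 0 < ξ.orderTop) (hη : 0 < η.orderTop) :
    ∃ δ : ℚ, 0 < δ ∧ Vge δ ξ ∧ Vge δ η := by
  obtain ⟨a, ha, h1⟩ := exists_vge_of_pos hξ
  obtain ⟨b, hb, h2⟩ := exists_vge_of_pos hη
  exact ⟨min a b, lt_min ha hb, h1.mono (min_le_left _ _), h2.mono (min_le_right _ _)⟩

theorem low_zero (F : FPS) : Low 0 F := by simp [Low]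

theorem vge_ev_zero {ξ η : K} (hξ : 0 < ξ.orderTop) (hη : 0 < η.orderTop) (F : FPS) :
    Vge 0 (ev ξ η F) := by
  obtain ⟨δ, hδ, h1, h2⟩ := exists_common_vge hξ hη
  simpa using vge_ev hδ h1 h2 (low_zero F)

/-- Both sides are bilinear and continuous, so monomials suffice. The density argument is applied
once in each factor. -/
theorem ev_mul {ξ η : K} (hξ : 0 < ξ.orderTop) (hη : 0 < η.orderTop) (F G : FPS) :
    ev ξ η (F * G) = ev ξ η F * ev ξ η G := by
  obtain ⟨δ, hδ, h1, h2⟩ := exists_common_vge hξ hη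
  have key : ∀ G : FPS, (ev ξ η) ∘ₗ (LinearMap.mulRight ℂ G) -
      (mulL (ev ξ η G)) ∘ₗ ev ξ η = 0 := by
    intro G
    refine linearMap_eq_zero (C := 0) hδ (fun n F hF => ?_) fun i j => ?_
    · rw [sub_zero]
      refine (vge_ev hδ h1 h2 (hF.mul_right G)).sub ?_
      simpa [mulL_apply] using (vge_ev hδ h1 h2 hF).mul (vge_ev_zero hξ hη G)
    · have : (ev ξ η) ∘ₗ (LinearMap.mulLeft ℂ (MvPowerSeries.monomial (mon i j) 1)) -
          (mulL (ev ξ η (MvPowerSeries.monomial (mon i j) 1))) ∘ₗ ev ξ η = 0 := by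
        refine linearMap_eq_zero (C := 0) hδ (fun n F hF => ?_) fun i' j' => ?_
        · rw [sub_zero]
          refine (vge_ev hδ h1 h2 (hF.mul_left _)).sub ?_
          simpa [mulL_apply] using (vge_ev hδ h1 h2 hF).mul (vge_ev_zero hξ hη _)
        · simp only [LinearMap.sub_apply, LinearMap.comp_apply, LinearMap.mulLeft_apply, mulL_apply]
          rw [MvPowerSeries.monomial_mul_monomial, mon_add, ev_monomial hξ hη,
            ev_monomial hξ hη, ev_monomial hξ hη]
          simp only [mul_one, one_smul]
          ring
      have h := LinearMap.congr_fun this G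
      simp only [LinearMap.sub_apply, LinearMap.comp_apply, LinearMap.mulLeft_apply, mulL_apply,
        LinearMap.mulRight_apply, LinearMap.zero_apply] at h ⊢
      rw [mul_comm (ev ξ η _) (ev ξ η G)]
      exact h
  exact sub_eq_zero.1 (LinearMap.congr_fun (key G) F)

theorem ev_C {ξ η : K} (hξ : 0 < ξ.orderTop) (hη : 0 < η.orderTop) (c : ℂ) :
    ev ξ η (MvPowerSeries.C c) = HahnSeries.C c := by
  have := ev_monomial hξ hη 0 0 c
  rw [monomial_mon] at this
  simpa [← HahnSeries.C_mul_eq_smul] using this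

theorem ev_one {ξ η : K} (hξ : 0 < ξ.orderTop) (hη : 0 < η.orderTop) : ev ξ η 1 = 1 := by
  rw [← map_one (MvPowerSeries.C (σ := Fin 2) (R := ℂ)), ev_C hξ hη, map_one]

/-- Evaluation at a pair of series of positive order, as a ring homomorphism. -/
def evHom {ξ η : K} (hξ : 0 < ξ.orderTop) (hη : 0 < η.orderTop) : FPS →+* K where
  toFun := ev ξ η
  map_zero' := map_zero _
  map_one' := ev_one hξ hη
  map_add' := map_add _
  map_mul' := ev_mul hξ hη

theorem ev_X_zero {ξ η : K} (hξ : 0 < ξ.orderTop) (hη : 0 < η.orderTop) :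
    ev ξ η (MvPowerSeries.X 0) = ξ := by
  have := ev_monomial hξ hη 1 0 1
  rw [monomial_mon] at this
  simpa using this

theorem ev_X_one {ξ η : K} (hξ : 0 < ξ.orderTop) (hη : 0 < η.orderTop) :
    ev ξ η (MvPowerSeries.X 1) = η := by
  have := ev_monomial hξ hη 0 1 1
  rw [monomial_mon] at this
  simpa using this

theorem pos_orderTop_ev {ξ η : K} (hξ : 0 < ξ.orderTop) (hη : 0 < η.orderTop) {F : FPS}
    (hF : MvPowerSeries.constantCoeff F = 0) : 0 < (ev ξ η F).orderTop := by
  obtain ⟨δ, hδ, h1, h2⟩ := exists_common_vge hξ hη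
  refine pos_orderTop_of_vge hδ ?_
  have : Low 1 F := by
    rw [Low, Nat.cast_one]
    exact MvPowerSeries.one_le_order_iff_constCoeff_eq_zero.2 hF
  simpa using vge_ev hδ h1 h2 this

theorem hasLead_ev_zero {ξ η : K} (hξ : 0 < ξ.orderTop) (hη : 0 < η.orderTop) (F : FPS) :
    HasLead (ev ξ η F) 0 (MvPowerSeries.constantCoeff F) := by
  have h : 0 < (ev ξ η (F - MvPowerSeries.C (MvPowerSeries.constantCoeff F))).orderTop :=
    pos_orderTop_ev hξ hη (by simp)
  rw [map_sub, ev_C hξ hη] at h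
  exact hasLead_iff.2 h

/-- Linear continuous maps `FPS → K` that agree on monomials are equal. -/
theorem linearMap_ext {Φ Ψ : FPS →ₗ[ℂ] K} {δ C : ℚ} (hδ : 0 < δ)
    (h1 : ∀ n F, Low n F → Vge (n * δ - C) (Φ F)) (h2 : ∀ n F, Low n F → Vge (n * δ - C) (Ψ F))
    (hmon : ∀ i j, Φ (MvPowerSeries.monomial (mon i j) 1) = Ψ (MvPowerSeries.monomial (mon i j) 1)) :
    Φ = Ψ := by
  refine sub_eq_zero.1 (linearMap_eq_zero (C := C) hδ (fun n F hF => ?_) fun i j => ?_)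
  · exact (h1 n F hF).sub (h2 n F hF)
  · rw [LinearMap.sub_apply, hmon, sub_self]

theorem twist_ev {ξ η : K} (hξ : 0 < ξ.orderTop) (hη : 0 < η.orderTop) (χ : AddChar ℚ ℂ)
    (F : FPS) : twist χ (ev ξ η F) = ev (twist χ ξ) (twist χ η) F := by
  ext e
  rw [coeff_twist, coeff_ev hξ hη, coeff_ev (by rwa [orderTop_twist]) (by rwa [orderTop_twist])]
  rw [← smul_eq_mul, smul_finsum]
  refine finsum_congr fun n => ?_
  rw [← map_pow, ← map_pow, ← map_mul, coeff_twist, smul_eq_mul]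
  ring

/-! ### Substitution -/

/-- `F(A, B)`. -/
def sub (A B F : FPS) : FPS := MvPowerSeries.subst ![A, B] F

/-- `F` has no constant term. -/
abbrev Z (F : FPS) : Prop := MvPowerSeries.constantCoeff F = 0

theorem hasSubst_pair {A B : FPS} (hA : Z A) (hB : Z B) : MvPowerSeries.HasSubst ![A, B] := by
  refine MvPowerSeries.hasSubst_of_constantCoeff_zero fun i => ?_
  fin_cases i
  · exact hA
  · exact hB

/-- Substitution as an algebra homomorphism. -/
def subHom {A B : FPS} (hA : Z A) (hB : Z B) : FPS →ₐ[ℂ] FPS :=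
  MvPowerSeries.substAlgHom (hasSubst_pair hA hB)

theorem subHom_apply {A B : FPS} (hA : Z A) (hB : Z B) (F : FPS) : subHom hA hB F = sub A B F := by
  rw [subHom, MvPowerSeries.substAlgHom_apply]
  rfl

theorem sub_mul' {A B : FPS} (hA : Z A) (hB : Z B) (F G : FPS) :
    sub A B (F * G) = sub A B F * sub A B G := by
  simp only [← subHom_apply hA hB, map_mul]

theorem sub_add' {A B : FPS} (hA : Z A) (hB : Z B) (F G : FPS) :
    sub A B (F + G) = sub A B F + sub A B G := by
  simp only [← subHom_apply hA hB, map_add]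

theorem sub_sub' {A B : FPS} (hA : Z A) (hB : Z B) (F G : FPS) :
    sub A B (F - G) = sub A B F - sub A B G := by
  simp only [← subHom_apply hA hB, map_sub]

theorem sub_pow' {A B : FPS} (hA : Z A) (hB : Z B) (F : FPS) (n : ℕ) :
    sub A B (F ^ n) = sub A B F ^ n := by
  simp only [← subHom_apply hA hB, map_pow]

theorem sub_zero' {A B : FPS} (hA : Z A) (hB : Z B) : sub A B 0 = 0 := by
  simp only [← subHom_apply hA hB, map_zero]

theorem sub_C {A B : FPS} (c : ℂ) : sub A B (MvPowerSeries.C c) = MvPowerSeries.C c :=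
  MvPowerSeries.subst_C c

theorem sub_X_zero {A B : FPS} (hA : Z A) (hB : Z B) : sub A B (MvPowerSeries.X 0) = A :=
  MvPowerSeries.subst_X (hasSubst_pair hA hB) 0

theorem sub_X_one {A B : FPS} (hA : Z A) (hB : Z B) : sub A B (MvPowerSeries.X 1) = B :=
  MvPowerSeries.subst_X (hasSubst_pair hA hB) 1

theorem sub_X_X (F : FPS) : sub (MvPowerSeries.X 0) (MvPowerSeries.X 1) F = F := by
  have : (![MvPowerSeries.X 0, MvPowerSeries.X 1] : Fin 2 → FPS) = MvPowerSeries.X := by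
    ext1 i
    fin_cases i <;> rfl
  rw [sub, this, MvPowerSeries.subst_self]
  rfl

theorem zero_sub {A B : FPS} (hA : Z A) (hB : Z B) {F : FPS} (hF : Z F) : Z (sub A B F) :=
  MvPowerSeries.constantCoeff_subst_eq_zero (hasSubst_pair hA hB) (fun i => by
    fin_cases i
    · exact hA
    · exact hB) hF

theorem sub_sub_comp {A B C D : FPS} (hA : Z A) (hB : Z B) (hC : Z C) (hD : Z D) (F : FPS) :
    sub A B (sub C D F) = sub (sub A B C) (sub A B D) F := by
  rw [sub, sub, MvPowerSeries.subst_comp_subst_apply (hasSubst_pair hC hD) (hasSubst_pair hA hB)]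
  rw [sub]
  congr 1
  ext1 i
  fin_cases i <;> rfl

theorem zero_X (i : Fin 2) : Z (MvPowerSeries.X i : FPS) := MvPowerSeries.constantCoeff_X i

theorem zero_X_pow (i : Fin 2) {n : ℕ} (hn : n ≠ 0) : Z (MvPowerSeries.X i ^ n : FPS) := by
  rw [Z, map_pow, zero_X, zero_pow hn]

theorem zero_zero : Z (0 : FPS) := map_zero _

theorem Low.sub {A B : FPS} (hA : Z A) (hB : Z B) {n : ℕ} {F : FPS} (hF : Low n F) :
    Low n (PolarTree.sub A B F) := by
  have h := MvPowerSeries.le_order_subst (hasSubst_pair hA hB) F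
  refine le_trans ?_ h
  have h1 : (1 : ℕ∞) ≤ ⨅ i, (![A, B] i).order := by
    refine le_iInf fun i => ?_
    rw [MvPowerSeries.one_le_order_iff_constCoeff_eq_zero]
    fin_cases i
    · exact hA
    · exact hB
  calc (n : ℕ∞) ≤ F.order := hF
    _ = 1 * F.order := (one_mul _).symm
    _ ≤ _ := by gcongr

/-- Both sides are linear and continuous in F and agree on monomials. The rates of growth of the
order at (ξ, η) and at the substituted pair can differ, hence the minimum below. -/
theorem ev_sub {A B : FPS} (hA : Z A) (hB : Z B) {ξ η : K} (hξ : 0 < ξ.orderTop)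
    (hη : 0 < η.orderTop) (F : FPS) : ev ξ η (sub A B F) = ev (ev ξ η A) (ev ξ η B) F := by
  have h1 := pos_orderTop_ev hξ hη hA
  have h2 := pos_orderTop_ev hξ hη hB
  obtain ⟨δ, hδ, h3, h4⟩ := exists_common_vge hξ hη
  obtain ⟨ε, hε, h5, h6⟩ := exists_common_vge h1 h2
  have : ev ξ η ∘ₗ (subHom hA hB).toLinearMap = ev (ev ξ η A) (ev ξ η B) := by
    refine linearMap_ext (δ := min δ ε) (C := 0) (lt_min hδ hε) (fun n F hF => ?_)
      (fun n F hF => ?_) fun i j => ?_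
    · rw [sub_zero]
      have : (subHom hA hB).toLinearMap F = PolarTree.sub A B F := subHom_apply hA hB F
      rw [LinearMap.comp_apply, this]
      refine (vge_ev hδ h3 h4 (hF.sub hA hB)).mono ?_
      gcongr
      exact min_le_left _ _
    · rw [sub_zero]
      refine (vge_ev hε h5 h6 hF).mono ?_
      gcongr
      exact min_le_right _ _
    · rw [LinearMap.comp_apply]
      have : (subHom hA hB).toLinearMap (MvPowerSeries.monomial (mon i j) 1) =
          PolarTree.sub A B (MvPowerSeries.monomial (mon i j) 1) := subHom_apply hA hB _
      rw [this, ev_monomial h1 h2, monomial_mon, sub_mul' hA hB, sub_mul' hA hB,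
        sub_pow' hA hB, sub_pow' hA hB, sub_C, sub_X_zero hA hB, sub_X_one hA hB]
      have hm := map_mul (evHom hξ hη)
      have hp := map_pow (evHom hξ hη)
      change ∀ x y, ev ξ η (x * y) = ev ξ η x * ev ξ η y at hm
      change ∀ x n, ev ξ η (x ^ n) = (ev ξ η x) ^ n at hp
      rw [hm, hm, hp, hp, map_one, ev_one hξ hη, one_mul, one_smul]
  have h := LinearMap.congr_fun this F
  rw [← h, LinearMap.comp_apply]
  congr 1
  exact (subHom_apply hA hB F).symm

/-! ### The chain rule -/

theorem cc_pderiv_zero (F : FPS) (i j : ℕ) :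
    cc (MvPowerSeries.pderiv ℂ 0 F) i j = cc F (i + 1) j * (i + 1) := by
  rw [cc, MvPowerSeries.coeff_pderiv, cc, mon_apply_zero]
  congr 3
  ext k
  fin_cases k <;> simp

theorem cc_pderiv_one (F : FPS) (i j : ℕ) :
    cc (MvPowerSeries.pderiv ℂ 1 F) i j = cc F i (j + 1) * (j + 1) := by
  rw [cc, MvPowerSeries.coeff_pderiv, cc, mon_apply_one]
  congr 3
  ext k
  fin_cases k <;> simp

theorem Low.pderiv {n : ℕ} {F : FPS} (h : Low n F) (k : Fin 2) :
    Low (n - 1) (MvPowerSeries.pderiv ℂ k F) := by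
  rw [low_iff] at h ⊢
  intro i j hij
  fin_cases k
  · exact (cc_pderiv_zero F i j).trans (by rw [h _ _ (by omega), zero_mul])
  · exact (cc_pderiv_one F i j).trans (by rw [h _ _ (by omega), zero_mul])

/-- The chain rule extends from monomials by continuity. A partial derivative lowers the order of F
by one, which costs δ after evaluation; this is the loss constant `C = δ`. -/
theorem theta_ev {ξ η : K} (hξ : 0 < ξ.orderTop) (hη : 0 < η.orderTop) (F : FPS) :
    theta (ev ξ η F) = ev ξ η (MvPowerSeries.pderiv ℂ 0 F) * theta ξ +
      ev ξ η (MvPowerSeries.pderiv ℂ 1 F) * theta η := by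
  obtain ⟨δ, hδ, h1, h2⟩ := exists_common_vge hξ hη
  let T : K →ₗ[ℂ] K := ⟨⟨theta, theta_add⟩, theta_smul⟩
  let D (i : Fin 2) : FPS →ₗ[ℂ] FPS := (MvPowerSeries.pderiv ℂ i).toLinearMap
  have hle (n : ℕ) : (n : ℚ) - 1 ≤ ((n - 1 : ℕ) : ℚ) := by
    rcases n with _ | n
    · simp
    · simp
  have hD (i : Fin 2) {ζ : K} (hζ : Vge δ ζ) (n : ℕ) (F : FPS) (hF : Low n F) :
      Vge (n * δ - δ) (ev ξ η (D i F) * theta ζ) := by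
    have := (vge_ev hδ h1 h2 (hF.pderiv i)).mul hζ.theta
    refine this.mono ?_
    nlinarith [hle n]
  have : T ∘ₗ ev ξ η = (mulL (theta ξ)) ∘ₗ ev ξ η ∘ₗ D 0 +
      (mulL (theta η)) ∘ₗ ev ξ η ∘ₗ D 1 := by
    refine linearMap_ext (δ := δ) (C := δ) hδ (fun n F hF => ?_)
      (fun n F hF => ?_) fun i j => ?_
    · exact (vge_ev hδ h1 h2 hF).theta.mono (by linarith)
    · exact (hD 0 h1 n F hF).add (hD 1 h2 n F hF)
    · change theta (ev ξ η (MvPowerSeries.monomial (mon i j) 1)) =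
        ev ξ η (MvPowerSeries.pderiv ℂ 0 (MvPowerSeries.monomial (mon i j) 1)) * theta ξ +
        ev ξ η (MvPowerSeries.pderiv ℂ 1 (MvPowerSeries.monomial (mon i j) 1)) * theta η
      have e0 : MvPowerSeries.pderiv ℂ 0 (MvPowerSeries.monomial (mon i j) (1 : ℂ)) =
          MvPowerSeries.monomial (mon (i - 1) j) (i : ℂ) := by
        refine ext_cc fun a b => ?_
        rw [cc_pderiv_zero, cc_monomial, cc_monomial]
        rcases i with _ | i
        · simp
        · by_cases h : a = i ∧ b = j
          · obtain ⟨rfl, rfl⟩ := h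
            simp
          · rw [if_neg (by simpa using h), if_neg (by simpa using h), zero_mul]
      have e1 : MvPowerSeries.pderiv ℂ 1 (MvPowerSeries.monomial (mon i j) (1 : ℂ)) =
          MvPowerSeries.monomial (mon i (j - 1)) (j : ℂ) := by
        refine ext_cc fun a b => ?_
        rw [cc_pderiv_one, cc_monomial, cc_monomial]
        rcases j with _ | j
        · simp
        · by_cases h : a = i ∧ b = j
          · obtain ⟨rfl, rfl⟩ := h
            simp
          · rw [if_neg (by simpa using h), if_neg (by simpa using h), zero_mul]
      rw [e0, e1, ev_monomial hξ hη, ev_monomial hξ hη, ev_monomial hξ hη, one_smul, theta_mul,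
        theta_pow, theta_pow, ← HahnSeries.C_mul_eq_smul, ← HahnSeries.C_mul_eq_smul, map_natCast,
        map_natCast]
      ring
  exact LinearMap.congr_fun this F

/-- The Jacobian along `ξ`. -/
theorem y_mul_jac {ξ : K} (hξ : 0 < ξ.orderTop) (f g : Conv) :
    HahnSeries.single 1 1 * evalArc (jac f g) ξ =
      theta (evalArc f ξ) * evalArc (dx g) ξ - evalArc (dx f) ξ * theta (evalArc g ξ) := by
  have hη : 0 < (HahnSeries.single (1 : ℚ) (1 : ℂ)).orderTop :=
    pos_orderTop_of_vge one_pos (vge_single _ le_rfl)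
  have hJ : (jac f g).1 = MvPowerSeries.pderiv ℂ 1 f.1 * MvPowerSeries.pderiv ℂ 0 g.1 -
    MvPowerSeries.pderiv ℂ 0 f.1 * MvPowerSeries.pderiv ℂ 1 g.1 := rfl
  simp only [evalArc_eq_ev]
  -- The product f_x g_x θ(ξ) occurs twice with opposite signs and cancels; θ(y) = y supplies the
  -- factor y on the left.
  rw [theta_ev hξ hη, theta_ev hξ hη, hJ, map_sub, ev_mul hξ hη, ev_mul hξ hη, theta_single]
  simp only [Rat.cast_one, mul_one, dx]
  ring

/-! ### Convergence -/

open scoped ENNReal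

/-- The weighted `ℓ¹`-norm `∑ |aₙ| r^{|n|}`. -/
def wnorm (r : ℝ≥0∞) (F : FPS) : ℝ≥0∞ :=
  ∑' n : Fin 2 →₀ ℕ, ‖MvPowerSeries.coeff n F‖ₑ * r ^ (n 0 + n 1)

theorem wnorm_mono {r s : ℝ≥0∞} (h : r ≤ s) (F : FPS) : wnorm r F ≤ wnorm s F :=
  ENNReal.tsum_le_tsum fun n => by gcongr

theorem wnorm_add (r : ℝ≥0∞) (F G : FPS) : wnorm r (F + G) ≤ wnorm r F + wnorm r G := by
  rw [wnorm, wnorm, wnorm, ← ENNReal.tsum_add]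
  refine ENNReal.tsum_le_tsum fun n => ?_
  rw [map_add, ← add_mul]
  gcongr
  exact enorm_add_le _ _

theorem wnorm_mul (r : ℝ≥0∞) (F G : FPS) : wnorm r (F * G) ≤ wnorm r F * wnorm r G := by
  have h1 : wnorm r F * wnorm r G = ∑' p : (Fin 2 →₀ ℕ) × (Fin 2 →₀ ℕ),
      (‖MvPowerSeries.coeff p.1 F‖ₑ * r ^ (p.1 0 + p.1 1)) *
        (‖MvPowerSeries.coeff p.2 G‖ₑ * r ^ (p.2 0 + p.2 1)) := by
    rw [ENNReal.tsum_prod', wnorm, wnorm, ← ENNReal.tsum_mul_right]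
    refine tsum_congr fun n => ?_
    exact ENNReal.tsum_mul_left.symm
  rw [h1, ← Finset.HasAntidiagonal.sigmaAntidiagonalEquivProd.tsum_eq, ENNReal.tsum_sigma']
  refine ENNReal.tsum_le_tsum fun n => ?_
  rw [MvPowerSeries.coeff_mul, tsum_fintype, Finset.univ_eq_attach]
  refine le_of_le_of_eq ?_ (Finset.sum_attach (Finset.HasAntidiagonal.antidiagonal n) (fun p =>
    (‖MvPowerSeries.coeff p.1 F‖ₑ * r ^ (p.1 0 + p.1 1)) *
        (‖MvPowerSeries.coeff p.2 G‖ₑ * r ^ (p.2 0 + p.2 1)))).symm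
  calc _ ≤ (∑ p ∈ Finset.HasAntidiagonal.antidiagonal n, ‖MvPowerSeries.coeff p.1 F * MvPowerSeries.coeff p.2 G‖ₑ)
        * r ^ (n 0 + n 1) := by
        gcongr
        exact enorm_sum_le _ _
    _ = ∑ p ∈ Finset.HasAntidiagonal.antidiagonal n,
        ‖MvPowerSeries.coeff p.1 F * MvPowerSeries.coeff p.2 G‖ₑ * r ^ (n 0 + n 1) := by
        rw [Finset.sum_mul]
    _ ≤ _ := by
        refine Finset.sum_le_sum fun p hp => le_of_eq ?_
        rw [Finset.HasAntidiagonal.mem_antidiagonal] at hp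
        have e : n 0 + n 1 = (p.1 0 + p.1 1) + (p.2 0 + p.2 1) := by
          rw [← hp]
          simp only [Finsupp.add_apply]
          ring
        rw [enorm_mul, e, pow_add]
        ring

theorem wnorm_one (r : ℝ≥0∞) : wnorm r 1 ≤ 1 := by
  rw [wnorm, tsum_eq_single 0]
  · simp
  · intro n hn
    rw [MvPowerSeries.coeff_one, if_neg hn]
    simp

theorem wnorm_pow (r : ℝ≥0∞) (F : FPS) (n : ℕ) : wnorm r (F ^ n) ≤ wnorm r F ^ n := by
  induction n with
  | zero => simpa using wnorm_one r
  | succ n ih =>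
    rw [pow_succ, pow_succ]
    exact (wnorm_mul r _ _).trans (by gcongr)

theorem wnorm_X (r : ℝ≥0∞) (i : Fin 2) : wnorm r (MvPowerSeries.X i) ≤ r := by
  rw [wnorm, tsum_eq_single (Finsupp.single i 1)]
  · rw [MvPowerSeries.coeff_X, if_pos rfl]
    fin_cases i <;> simp
  · intro n hn
    rw [MvPowerSeries.coeff_X, if_neg hn]
    simp

theorem enorm_finsum_le {ι : Type*} {f : ι → ℂ} (hf : f.HasFiniteSupport) :
    ‖∑ᶠ i, f i‖ₑ ≤ ∑' i, ‖f i‖ₑ := by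
  rw [finsum_eq_sum f hf]
  exact (enorm_sum_le _ _).trans (ENNReal.sum_le_tsum _)

theorem prod_pair (A B : FPS) (d : Fin 2 →₀ ℕ) :
    (d.prod fun s e => (![A, B] s) ^ e) = A ^ d 0 * B ^ d 1 := by
  rw [Finsupp.prod_fintype _ _ (fun i => pow_zero _), Fin.prod_univ_two]
  rfl

theorem coeff_sub_eq {A B : FPS} (hA : Z A) (hB : Z B) (F : FPS) (e : Fin 2 →₀ ℕ) :
    MvPowerSeries.coeff e (sub A B F) =
      ∑ᶠ d, MvPowerSeries.coeff d F * MvPowerSeries.coeff e (A ^ d 0 * B ^ d 1) := by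
  rw [sub, MvPowerSeries.coeff_subst (hasSubst_pair hA hB)]
  simp only [prod_pair, smul_eq_mul]

/-- Expand F, exchange the two sums and use submultiplicativity: a monomial of degree n contributes
at most ρ^n. Sums in [0, ∞] may be exchanged without any summability condition. -/
theorem wnorm_sub {A B : FPS} (hA : Z A) (hB : Z B) {r ρ : ℝ≥0∞} (h1 : wnorm r A ≤ ρ)
    (h2 : wnorm r B ≤ ρ) (F : FPS) : wnorm r (sub A B F) ≤ wnorm ρ F := by
  have hfin (e : Fin 2 →₀ ℕ) := MvPowerSeries.coeff_subst_finite (hasSubst_pair hA hB) F e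
  simp only [prod_pair, smul_eq_mul] at hfin
  calc wnorm r (sub A B F)
      ≤ ∑' e : Fin 2 →₀ ℕ, ∑' d : Fin 2 →₀ ℕ, ‖MvPowerSeries.coeff d F‖ₑ *
          (‖MvPowerSeries.coeff e (A ^ d 0 * B ^ d 1)‖ₑ * r ^ (e 0 + e 1)) := by
        refine ENNReal.tsum_le_tsum fun e => ?_
        rw [coeff_sub_eq hA hB]
        calc _ ≤ (∑' d : Fin 2 →₀ ℕ, ‖MvPowerSeries.coeff d F *
              MvPowerSeries.coeff e (A ^ d 0 * B ^ d 1)‖ₑ) * r ^ (e 0 + e 1) := by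
              gcongr
              exact enorm_finsum_le (hfin e)
          _ = _ := by
              rw [← ENNReal.tsum_mul_right]
              refine tsum_congr fun d => ?_
              rw [enorm_mul, mul_assoc]
    _ = ∑' d : Fin 2 →₀ ℕ, ‖MvPowerSeries.coeff d F‖ₑ * wnorm r (A ^ d 0 * B ^ d 1) := by
        rw [ENNReal.tsum_comm]
        refine tsum_congr fun d => ?_
        rw [ENNReal.tsum_mul_left, wnorm]
    _ ≤ wnorm ρ F := by
        refine ENNReal.tsum_le_tsum fun d => ?_
        gcongr
        calc _ ≤ wnorm r (A ^ d 0) * wnorm r (B ^ d 1) := wnorm_mul _ _ _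
          _ ≤ ρ ^ d 0 * ρ ^ d 1 := by
            gcongr
            · exact (wnorm_pow _ _ _).trans (by gcongr)
            · exact (wnorm_pow _ _ _).trans (by gcongr)
          _ = _ := (pow_add _ _ _).symm

/-- The equivalence between pairs of exponents and monomials. -/
def monEquiv : ℕ × ℕ ≃ (Fin 2 →₀ ℕ) where
  toFun p := mon p.1 p.2
  invFun n := (n 0, n 1)
  left_inv p := by simp
  right_inv n := (eq_mon n).symm

/-- At radius 1/(2R) a bound by M·R^{|n|} gives a double geometric series. Conversely, each term is
bounded by the finite sum. -/
theorem isConvergent_iff (F : FPS) :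
    IsConvergent F ↔ ∃ r : ℝ≥0∞, r ≠ 0 ∧ r ≠ ⊤ ∧ wnorm r F ≠ ⊤ := by
  constructor
  · intro h
    obtain ⟨M, hM, h⟩ := h.exists_one_le
    obtain ⟨R, -, hR, h⟩ := h 1
    have hR0 : (0 : ℝ) < R := by linarith
    refine ⟨ENNReal.ofReal (1 / (2 * R)), ?_, ENNReal.ofReal_ne_top, ?_⟩
    · simpa using hR0
    · have hb : wnorm (ENNReal.ofReal (1 / (2 * R))) F ≤
          ∑' n : Fin 2 →₀ ℕ, ENNReal.ofReal M * ((2⁻¹ : ℝ≥0∞) ^ (n 0) * 2⁻¹ ^ (n 1)) := by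
        refine ENNReal.tsum_le_tsum fun n => ?_
        calc _ ≤ ENNReal.ofReal (M * R ^ (n 0 + n 1)) *
                ENNReal.ofReal (1 / (2 * R)) ^ (n 0 + n 1) := by
                gcongr
                rw [← ofReal_norm]
                exact ENNReal.ofReal_le_ofReal (h n)
          _ = ENNReal.ofReal (M * (2⁻¹ : ℝ) ^ (n 0 + n 1)) := by
                rw [← ENNReal.ofReal_pow (by positivity), ← ENNReal.ofReal_mul (by positivity),
                  mul_assoc, ← mul_pow]
                congr 3
                field_simp
          _ = _ := by
                rw [ENNReal.ofReal_mul (by positivity), ← pow_add,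
                  ENNReal.ofReal_pow (by positivity), ENNReal.ofReal_inv_of_pos (by norm_num)]
                simp
      refine ne_top_of_le_ne_top ?_ hb
      rw [ENNReal.tsum_mul_left]
      refine ENNReal.mul_ne_top ENNReal.ofReal_ne_top ?_
      rw [← monEquiv.tsum_eq, ENNReal.tsum_prod']
      simp only [monEquiv, Equiv.coe_fn_mk, mon_apply_zero, mon_apply_one]
      simp only [ENNReal.tsum_mul_left, ENNReal.tsum_mul_right, ENNReal.tsum_geometric]
      simp only [ENNReal.one_sub_inv_two, inv_inv]
      exact ENNReal.mul_ne_top ENNReal.ofNat_ne_top ENNReal.ofNat_ne_top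
  · rintro ⟨r, h0, h1, h⟩
    refine ⟨(wnorm r F).toReal, r.toReal⁻¹, fun n => ?_⟩
    have h2 : ‖MvPowerSeries.coeff n F‖ₑ * r ^ (n 0 + n 1) ≤ wnorm r F :=
      ENNReal.le_tsum n
    have hr : 0 < r.toReal := ENNReal.toReal_pos h0 h1
    have h3 := ENNReal.toReal_mono h h2
    rw [ENNReal.toReal_mul, ENNReal.toReal_pow, toReal_enorm] at h3
    rw [inv_pow, ← div_eq_mul_inv, le_div_iff₀ (by positivity)]
    exact h3

/-- All monomials have degree at least 1, so shrinking the radius by s ≤ 1 gains at least a factor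
s. The norm can thus be made as small as desired. -/
theorem wnorm_small {F : FPS} (hF : Z F) {s : ℝ≥0∞} (hs : s ≤ 1) (r : ℝ≥0∞) :
    wnorm (s * r) F ≤ s * wnorm r F := by
  rw [wnorm, wnorm, ← ENNReal.tsum_mul_left]
  refine ENNReal.tsum_le_tsum fun n => ?_
  by_cases hn : n = 0
  · subst hn
    have : MvPowerSeries.coeff 0 F = 0 := hF
    rw [this]
    simp
  · have hd : n 0 + n 1 ≠ 0 := by
      intro h
      apply hn
      rw [eq_mon n]
      have h0 : n 0 = 0 := by omega
      have h1 : n 1 = 0 := by omega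
      rw [h0, h1]
      simp [mon]
    rw [mul_pow, ← mul_assoc, mul_comm _ (s ^ _), mul_assoc]
    refine mul_le_mul' ?_ le_rfl
    exact pow_le_of_le_one zero_le hs hd

theorem exists_wnorm_le {F : FPS} (hF : Z F) (hc : IsConvergent F) {ρ : ℝ≥0∞} (hρ : ρ ≠ 0) :
    ∃ r : ℝ≥0∞, r ≠ 0 ∧ r ≠ ⊤ ∧ wnorm r F ≤ ρ := by
  obtain ⟨r, h0, h1, h⟩ := (isConvergent_iff F).1 hc
  have hN : wnorm r F + 1 ≠ ⊤ := ENNReal.add_ne_top.2 ⟨h, ENNReal.one_ne_top⟩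
  refine ⟨min 1 (ρ / (wnorm r F + 1)) * r, ?_, ?_, ?_⟩
  · refine mul_ne_zero ?_ h0
    rw [← bot_eq_zero, ← bot_lt_iff_ne_bot, lt_min_iff]
    exact ⟨by simp, bot_lt_iff_ne_bot.2 (ENNReal.div_ne_zero.2 ⟨hρ, hN⟩)⟩
  · exact ENNReal.mul_ne_top (ne_top_of_le_ne_top ENNReal.one_ne_top (min_le_left _ _)) h1
  · refine (wnorm_small hF (min_le_left _ _) r).trans ?_
    calc _ ≤ ρ / (wnorm r F + 1) * (wnorm r F + 1) := by
          gcongr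
          · exact min_le_right _ _
          · exact le_self_add
      _ = ρ := ENNReal.div_mul_cancel (by simp) hN

/-- Without constant terms, A and B have norm below the radius of F once their own radius is small
enough. -/
theorem IsConvergent.sub' {A B F : FPS} (hA : Z A) (hB : Z B) (hcA : IsConvergent A)
    (hcB : IsConvergent B) (hF : IsConvergent F) : IsConvergent (PolarTree.sub A B F) := by
  obtain ⟨ρ, h0, h1, h⟩ := (isConvergent_iff F).1 hF
  obtain ⟨r, hr0, hr1, hr⟩ := exists_wnorm_le hA hcA h0
  obtain ⟨s, hs0, hs1, hs⟩ := exists_wnorm_le hB hcB h0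
  refine (isConvergent_iff _).2 ⟨min r s, ?_, ?_, ?_⟩
  · rw [← bot_eq_zero, ← bot_lt_iff_ne_bot, lt_min_iff]
    exact ⟨bot_lt_iff_ne_bot.2 hr0, bot_lt_iff_ne_bot.2 hs0⟩
  · exact ne_top_of_le_ne_top hr1 (min_le_left _ _)
  · exact ne_top_of_le_ne_top h (wnorm_sub hA hB ((wnorm_mono (min_le_left _ _) _).trans hr)
      ((wnorm_mono (min_le_right _ _) _).trans hs) F)

theorem isConvergent_X (i : Fin 2) : IsConvergent (MvPowerSeries.X i) := isConvergent_monomial _ 1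

theorem isConvergent_C (c : ℂ) : IsConvergent (MvPowerSeries.C c) := isConvergent_monomial 0 c

theorem isConvergent_zero : IsConvergent 0 := convergentSubring.zero_mem

theorem isConvergent_one : IsConvergent 1 := convergentSubring.one_mem

theorem IsConvergent.neg {F : FPS} (h : IsConvergent F) : IsConvergent (-F) :=
  convergentSubring.neg_mem h

theorem IsConvergent.minus {F G : FPS} (h : IsConvergent F) (h' : IsConvergent G) :
    IsConvergent (F - G) := convergentSubring.sub_mem h h'

theorem IsConvergent.pow {F : FPS} (h : IsConvergent F) (n : ℕ) : IsConvergent (F ^ n) :=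
  convergentSubring.pow_mem h n

theorem cc_X_zero_pow_mul (n : ℕ) (G : FPS) (i j : ℕ) :
    cc (MvPowerSeries.X 0 ^ n * G) i j = if n ≤ i then cc G (i - n) j else 0 := by
  rw [cc, MvPowerSeries.X_pow_eq, MvPowerSeries.coeff_monomial_mul]
  refine if_congr ?_ ?_ rfl
  · rw [Finsupp.single_le_iff, mon_apply_zero]
  · rw [one_mul, coeff_eq_cc]
    simp

theorem cc_X_one_pow_mul (n : ℕ) (G : FPS) (i j : ℕ) :
    cc (MvPowerSeries.X 1 ^ n * G) i j = if n ≤ j then cc G i (j - n) else 0 := by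
  rw [cc, MvPowerSeries.X_pow_eq, MvPowerSeries.coeff_monomial_mul]
  refine if_congr ?_ ?_ rfl
  · rw [Finsupp.single_le_iff, mon_apply_one]
  · rw [one_mul, coeff_eq_cc]
    simp

theorem IsConvergent.of_cc {F : FPS} (h : ∃ M R : ℝ, ∀ i j, ‖cc F i j‖ ≤ M * R ^ (i + j)) :
    IsConvergent F := by
  obtain ⟨M, R, h⟩ := h
  exact ⟨M, R, fun n => by rw [coeff_eq_cc]; exact h _ _⟩

theorem IsConvergent.exists_cc {F : FPS} (h : IsConvergent F) :
    ∃ M R : ℝ, 1 ≤ M ∧ 1 ≤ R ∧ ∀ i j, ‖cc F i j‖ ≤ M * R ^ (i + j) := by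
  obtain ⟨M, hM, h⟩ := h.exists_one_le
  obtain ⟨R, -, hR, h⟩ := h 1
  refine ⟨M, R, hM, hR, fun i j => ?_⟩
  have := h (mon i j)
  rwa [mon_apply_zero, mon_apply_one] at this

theorem IsConvergent.of_X_zero_pow_mul {n : ℕ} {G : FPS}
    (h : IsConvergent (MvPowerSeries.X 0 ^ n * G)) : IsConvergent G := by
  obtain ⟨M, R, -, -, h⟩ := h.exists_cc
  refine .of_cc ⟨M * R ^ n, R, fun i j => ?_⟩
  have := h (i + n) j
  rw [cc_X_zero_pow_mul, if_pos (Nat.le_add_left _ _), Nat.add_sub_cancel] at this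
  refine this.trans (le_of_eq ?_)
  ring

theorem IsConvergent.of_X_one_pow_mul {n : ℕ} {G : FPS}
    (h : IsConvergent (MvPowerSeries.X 1 ^ n * G)) : IsConvergent G := by
  obtain ⟨M, R, -, -, h⟩ := h.exists_cc
  refine .of_cc ⟨M * R ^ n, R, fun i j => ?_⟩
  have := h i (j + n)
  rw [cc_X_one_pow_mul, if_pos (Nat.le_add_left _ _), Nat.add_sub_cancel] at this
  refine this.trans (le_of_eq ?_)
  ring

/-- A power series with prescribed coefficients. -/
def mkcc (a : ℕ → ℕ → ℂ) : FPS := fun n => a (n 0) (n 1)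

theorem cc_mkcc (a : ℕ → ℕ → ℂ) (i j : ℕ) : cc (mkcc a) i j = a i j := by
  change a (mon i j 0) (mon i j 1) = _
  rw [mon_apply_zero, mon_apply_one]

theorem cc_C (c : ℂ) (i j : ℕ) : cc (MvPowerSeries.C c) i j = if i = 0 ∧ j = 0 then c else 0 := by
  rw [← cc_monomial 0 0 i j c, monomial_mon]
  simp

theorem cc_one (i j : ℕ) : cc 1 i j = if i = 0 ∧ j = 0 then 1 else 0 := by
  rw [← map_one (MvPowerSeries.C (σ := Fin 2) (R := ℂ)), cc_C]

theorem cc_zero_zero (F : FPS) : cc F 0 0 = MvPowerSeries.constantCoeff F := by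
  rw [cc, ← MvPowerSeries.coeff_zero_eq_constantCoeff_apply]
  congr 2
  ext i
  fin_cases i <;> simp

/-- The series 1 − F/c has no constant term and is substituted for x in the geometric series 1/(1 −
x), so convergence comes from that of compositions. -/
theorem exists_convergent_inverse {F : FPS} (hF : IsConvergent F)
    (h0 : MvPowerSeries.constantCoeff F ≠ 0) : ∃ G, IsConvergent G ∧ F * G = 1 := by
  set c := MvPowerSeries.constantCoeff F with hc
  let g : FPS := mkcc fun _ j => if j = 0 then 1 else 0
  have hg : (1 - MvPowerSeries.X 0) * g = 1 := by
    refine ext_cc fun i j => ?_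
    have := cc_X_zero_pow_mul 1 g i j
    rw [pow_one] at this
    rw [sub_mul, one_mul, cc_sub, this, cc_mkcc, cc_mkcc, cc_one]
    by_cases hj : j = 0
    · rcases i with _ | i <;> simp [hj]
    · simp [hj]
  have hgc : IsConvergent g := by
    refine .of_cc ⟨1, 1, fun i j => ?_⟩
    rw [cc_mkcc]
    split_ifs <;> simp
  let A : FPS := 1 - MvPowerSeries.C c⁻¹ * F
  have hA : Z A := by
    simp only [Z, A, map_sub, map_one, map_mul, MvPowerSeries.constantCoeff_C, ← hc]
    rw [inv_mul_cancel₀ h0, sub_self]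
  have hAc : IsConvergent A := isConvergent_one.minus ((isConvergent_C _).mul hF)
  refine ⟨MvPowerSeries.C c⁻¹ * sub A 0 g,
    (isConvergent_C _).mul (IsConvergent.sub' hA zero_zero hAc isConvergent_zero hgc), ?_⟩
  have h := congrArg (sub A 0) hg
  have h1 : sub A 0 1 = 1 := by
    rw [← map_one (MvPowerSeries.C (σ := Fin 2) (R := ℂ)), sub_C]
  rw [sub_mul' hA zero_zero, sub_sub' hA zero_zero, sub_X_zero hA zero_zero, h1] at h
  rw [← h]
  simp only [A]
  ring

/-! ### The implicit function theorem -/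

open scoped ENNReal

theorem Low.add {n : ℕ} {F G : FPS} (hF : Low n F) (hG : Low n G) : Low n (F + G) := by
  rw [low_iff] at *
  intro i j h
  rw [cc_add, hF i j h, hG i j h, add_zero]

theorem Low.neg {n : ℕ} {F : FPS} (hF : Low n F) : Low n (-F) := by
  rw [Low, MvPowerSeries.order_neg]
  exact hF

theorem Low.minus {n : ℕ} {F G : FPS} (hF : Low n F) (hG : Low n G) : Low n (F - G) := by
  rw [sub_eq_add_neg]
  exact hF.add hG.neg

theorem Low.sum {ι : Type*} {s : Finset ι} {n : ℕ} {F : ι → FPS} (h : ∀ i ∈ s, Low n (F i)) :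
    Low n (∑ i ∈ s, F i) := by
  classical
  induction s using Finset.induction_on with
  | empty => simp [Low]
  | insert i s hi ih =>
    rw [Finset.sum_insert hi]
    exact (h i (Finset.mem_insert_self _ _)).add
      (ih fun j hj => h j (Finset.mem_insert_of_mem hj))

theorem Low.mono {m n : ℕ} {F : FPS} (h : Low n F) (hm : m ≤ n) : Low m F :=
  le_trans (by exact_mod_cast hm) h

theorem Low.mul {m n : ℕ} {F G : FPS} (hF : Low m F) (hG : Low n G) : Low (m + n) (F * G) := by
  rw [Low, Nat.cast_add]
  exact (add_le_add hF hG).trans MvPowerSeries.le_order_mul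

theorem Z.low {F : FPS} (h : Z F) : Low 1 F := by
  rw [Low, Nat.cast_one]
  exact MvPowerSeries.one_le_order_iff_constCoeff_eq_zero.2 h

theorem eq_zero_of_forall_low {F : FPS} (h : ∀ n, Low n F) : F = 0 := by
  refine ext_cc fun i j => ?_
  rw [low_iff.1 (h (i + j + 1)) i j (by omega)]
  simp [cc]

/-- The difference u − v divides u^i − v^i, which treats the truncation of G to the n-box; the
remainder of G already has order at least n. -/
theorem low_sub_sub {u v : FPS} (hu : Z u) (hv : Z v) {n : ℕ} (h : Low n (u - v)) (G : FPS) :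
    Low n (sub u (MvPowerSeries.X 1) G - sub v (MvPowerSeries.X 1) G) := by
  have hX := zero_X 1
  have e : sub u (MvPowerSeries.X 1) G - sub v (MvPowerSeries.X 1) G =
      (sub u (MvPowerSeries.X 1) (G - boxTrunc n G) -
        sub v (MvPowerSeries.X 1) (G - boxTrunc n G)) +
      (sub u (MvPowerSeries.X 1) (boxTrunc n G) - sub v (MvPowerSeries.X 1) (boxTrunc n G)) := by
    rw [sub_sub' hu hX, sub_sub' hv hX]
    ring
  rw [e]
  have hl := low_sub_boxTrunc n G
  refine ((hl.sub hu hX).minus (hl.sub hv hX)).add ?_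
  rw [boxTrunc, ← subHom_apply hu hX, ← subHom_apply hv hX, map_sum, map_sum,
    ← Finset.sum_sub_distrib]
  refine Low.sum fun p _ => ?_
  rw [subHom_apply, subHom_apply, monomial_mon]
  rw [sub_mul' hu hX, sub_mul' hu hX, sub_mul' hv hX, sub_mul' hv hX, sub_pow' hu hX,
    sub_pow' hu hX, sub_pow' hv hX, sub_pow' hv hX, sub_C, sub_C, sub_X_zero hu hX,
    sub_X_zero hv hX, sub_X_one hu hX, sub_X_one hv hX, ← mul_sub, ← sub_mul]
  obtain ⟨w, hw⟩ := sub_dvd_pow_sub_pow u v p.1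
  rw [hw]
  exact ((h.mul_right w).mul_right _).mul_left _

/-- `F(0, y)`. -/
abbrev tPart (F : FPS) : FPS := sub 0 (MvPowerSeries.X 1) F

theorem cc_X_zero_mul (G : FPS) (i j : ℕ) :
    cc (MvPowerSeries.X 0 * G) i j = if 1 ≤ i then cc G (i - 1) j else 0 := by
  have := cc_X_zero_pow_mul 1 G i j
  rwa [pow_one] at this

theorem cc_X_one_mul (G : FPS) (i j : ℕ) :
    cc (MvPowerSeries.X 1 * G) i j = if 1 ≤ j then cc G i (j - 1) else 0 := by
  have := cc_X_one_pow_mul 1 G i j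
  rwa [pow_one] at this

/-- `F = F(x, 0) + y G`. -/
theorem exists_eq_xPart_add (F : FPS) : ∃ P G : FPS, F = P + MvPowerSeries.X 1 * G ∧
    (∀ i j, cc P i j = if j = 0 then cc F i 0 else 0) ∧ (∀ i j, cc G i j = cc F i (j + 1)) := by
  refine ⟨mkcc fun i j => if j = 0 then cc F i 0 else 0, mkcc fun i j => cc F i (j + 1), ?_,
    fun i j => cc_mkcc _ _ _, fun i j => cc_mkcc _ _ _⟩
  refine ext_cc fun i j => ?_
  rw [cc_add, cc_mkcc, cc_X_one_mul, cc_mkcc]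
  rcases j with _ | j <;> simp

/-- Under the hypotheses Φ = x²a(x) + y·b(x, y). Hence u ↦ Φ(u, y) is a contraction for the order
topology, and iteration from 0 converges formally. The same map preserves a ball of the weighted
norm, which makes the limit convergent. -/
theorem exists_implicit {Φ : FPS} (hZ : Z Φ) (h1 : cc Φ 1 0 = 0) (hΦ : IsConvergent Φ) :
    ∃ γ, IsConvergent γ ∧ Z γ ∧ tPart γ = γ ∧ sub γ (MvPowerSeries.X 1) Φ = γ := by
  have hX := zero_X 1
  -- decomposition of `Φ`
  obtain ⟨P, b, hPb, hP, hb⟩ := exists_eq_xPart_add Φ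
  let a : FPS := mkcc fun i j => if j = 0 then cc Φ (i + 2) 0 else 0
  have hΦ' : Φ = MvPowerSeries.X 0 ^ 2 * a + MvPowerSeries.X 1 * b := by
    rw [hPb]
    congr 1
    refine ext_cc fun i j => ?_
    rw [hP, cc_X_zero_pow_mul, cc_mkcc]
    rcases i with _ | _ | i
    · simp [cc_zero_zero, hZ]
    · simp [h1]
    · simp
  have hca : IsConvergent a := by
    obtain ⟨M, R, hM, hR, h⟩ := hΦ.exists_cc
    refine .of_cc ⟨M * R ^ 2, R, fun i j => ?_⟩
    rw [cc_mkcc]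
    split_ifs with hj
    · subst hj
      refine (h _ _).trans (le_of_eq ?_)
      ring
    · rw [norm_zero]
      positivity
  have hcb : IsConvergent b := by
    obtain ⟨M, R, hM, hR, h⟩ := hΦ.exists_cc
    refine .of_cc ⟨M * R, R, fun i j => ?_⟩
    rw [hb]
    refine (h _ _).trans (le_of_eq ?_)
    ring
  have hsub {u : FPS} (hu : Z u) : sub u (MvPowerSeries.X 1) Φ =
      u ^ 2 * sub u (MvPowerSeries.X 1) a + MvPowerSeries.X 1 * sub u (MvPowerSeries.X 1) b := by
    rw [hΦ', sub_add' hu hX, sub_mul' hu hX, sub_mul' hu hX, sub_pow' hu hX, sub_X_zero hu hX,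
      sub_X_one hu hX]
  have hcontr {u v : FPS} (hu : Z u) (hv : Z v) {n : ℕ} (h : Low n (u - v)) :
      Low (n + 1) (sub u (MvPowerSeries.X 1) Φ - sub v (MvPowerSeries.X 1) Φ) := by
    rw [hsub hu, hsub hv]
    have e : u ^ 2 * sub u (MvPowerSeries.X 1) a + MvPowerSeries.X 1 * sub u (MvPowerSeries.X 1) b -
        (v ^ 2 * sub v (MvPowerSeries.X 1) a + MvPowerSeries.X 1 * sub v (MvPowerSeries.X 1) b) =
        (u - v) * (u + v) * sub u (MvPowerSeries.X 1) a +
        (sub u (MvPowerSeries.X 1) a - sub v (MvPowerSeries.X 1) a) * v * v +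
        (sub u (MvPowerSeries.X 1) b - sub v (MvPowerSeries.X 1) b) * MvPowerSeries.X 1 := by ring
    rw [e]
    exact (((h.mul (hu.low.add hv.low)).mul_right _).add
      (((low_sub_sub hu hv h a).mul hv.low).mul_right _)).add
      ((low_sub_sub hu hv h b).mul (Z.low hX))
  -- the iteration
  obtain ⟨w, hw0, hws⟩ : ∃ w : ℕ → FPS, w 0 = 0 ∧
      ∀ n, w (n + 1) = sub (w n) (MvPowerSeries.X 1) Φ :=
    ⟨fun n => Nat.rec 0 (fun _ u => sub u (MvPowerSeries.X 1) Φ) n, rfl, fun _ => rfl⟩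
  have hwZ (n : ℕ) : Z (w n) := by
    induction n with
    | zero => rw [hw0]; exact zero_zero
    | succ n ih => rw [hws]; exact zero_sub ih hX hZ
  have hwT (n : ℕ) : tPart (w n) = w n := by
    induction n with
    | zero => rw [hw0]; exact sub_zero' zero_zero hX
    | succ n ih =>
      rw [hws, tPart, sub_sub_comp zero_zero hX (hwZ n) hX, sub_X_one zero_zero hX]
      rw [tPart] at ih
      rw [ih]
  have hwL (n : ℕ) : Low (n + 1) (w (n + 1) - w n) := by
    induction n with
    | zero =>
      rw [hw0, sub_zero]
      exact (hwZ 1).low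
    | succ n ih =>
      have := hcontr (hwZ (n + 1)) (hwZ n) ih
      rwa [← hws, ← hws] at this
  have hwL' (n m : ℕ) : Low (n + 1) (w (n + m) - w n) := by
    induction m with
    | zero => simp [Low]
    | succ m ih =>
      have : w (n + (m + 1)) - w n = (w (n + m + 1) - w (n + m)) + (w (n + m) - w n) := by
        rw [add_assoc]
        ring
      rw [this]
      exact ((hwL (n + m)).mono (by omega)).add ih
  -- Later iterates differ from the n-th one only in degrees above n, so the coefficients of degree
  -- n are final at stage n.
  obtain ⟨γ, hγc⟩ : ∃ γ : FPS, ∀ i j, cc γ i j = cc (w (i + j)) i j :=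
    ⟨mkcc fun i j => cc (w (i + j)) i j, fun i j => cc_mkcc _ i j⟩
  have hγ (n : ℕ) : Low (n + 1) (γ - w n) := by
    rw [low_iff]
    intro i j hij
    rw [cc_sub, hγc, sub_eq_zero]
    have := low_iff.1 (hwL' (i + j) (n - (i + j))) i j (by omega)
    rw [cc_sub, sub_eq_zero] at this
    rw [← this]
    congr 2
    omega
  have hγZ : Z γ := by
    have := low_iff.1 (hγ 0) 0 0 (by omega)
    rw [cc_sub, hw0, sub_eq_zero, cc_zero_zero] at this
    rw [Z, this]
    simp [cc]
  have hγT : tPart γ = γ := by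
    refine sub_eq_zero.1 (eq_zero_of_forall_low fun n => ?_)
    have h := hγ n
    have e : tPart γ - γ = tPart (γ - w n) - (γ - w n) := by
      rw [tPart, tPart, sub_sub' zero_zero hX]
      have := hwT n
      rw [tPart] at this
      rw [this]
      ring
    rw [e]
    exact ((h.sub zero_zero hX).minus h).mono (Nat.le_succ n)
  have hγΦ : sub γ (MvPowerSeries.X 1) Φ = γ := by
    refine sub_eq_zero.1 (eq_zero_of_forall_low fun n => ?_)
    have e : sub γ (MvPowerSeries.X 1) Φ - γ =
        (sub γ (MvPowerSeries.X 1) Φ - sub (w n) (MvPowerSeries.X 1) Φ) - (γ - w (n + 1)) := by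
      rw [hws]
      ring
    rw [e]
    exact ((low_sub_sub hγZ (hwZ n) (hγ n) Φ).minus ((hγ (n + 1)).mono (by omega))).mono
      (Nat.le_succ n)
  refine ⟨γ, ?_, hγZ, hγT, hγΦ⟩
  -- the estimate
  obtain ⟨σ, hσ0, hσ1, hσa⟩ := (isConvergent_iff a).1 hca
  obtain ⟨τ, hτ0, hτ1, hτb⟩ := (isConvergent_iff b).1 hcb
  set A := wnorm (min σ τ) a with hA
  set B := wnorm (min σ τ) b with hB
  have hA1 : A ≠ ⊤ := ne_top_of_le_ne_top hσa (wnorm_mono (min_le_left _ _) a)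
  have hB1 : B ≠ ⊤ := ne_top_of_le_ne_top hτb (wnorm_mono (min_le_right _ _) b)
  have hne {x y : ℝ≥0∞} (hx : x ≠ 0) (hy : y ≠ 0) : min x y ≠ 0 := by
    rcases min_choice x y with h | h <;> rw [h] <;> assumption
  have hinv {x : ℝ≥0∞} (hx : x ≠ ⊤) : (2 * (x + 1))⁻¹ ≠ 0 := by
    rw [ENNReal.inv_ne_zero]
    exact ENNReal.mul_ne_top ENNReal.ofNat_ne_top (ENNReal.add_ne_top.2 ⟨hx, ENNReal.one_ne_top⟩)
  have hhalf {x : ℝ≥0∞} (hx : x ≠ ⊤) : (2 * (x + 1))⁻¹ * x ≤ 2⁻¹ := by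
    have hx1 : x + 1 ≠ ⊤ := ENNReal.add_ne_top.2 ⟨hx, ENNReal.one_ne_top⟩
    rw [ENNReal.mul_inv (Or.inl two_ne_zero) (Or.inl ENNReal.ofNat_ne_top), mul_assoc]
    calc _ ≤ 2⁻¹ * ((x + 1)⁻¹ * (x + 1)) := by
          gcongr
          exact le_self_add
      _ = 2⁻¹ := by rw [ENNReal.inv_mul_cancel (by simp) hx1, mul_one]
  -- With this choice ρA ≤ 1/2 and, for r below, rB ≤ ρ/2. Thus ρ²A + rB ≤ ρ, and the ball of radius
  -- ρ is preserved by the iteration. Adding 1 to A and B avoids inverting 0.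
  let ρ := min (min σ τ) (2 * (A + 1))⁻¹
  let r := min ρ (ρ * (2 * (B + 1))⁻¹)
  have hρ0 : ρ ≠ 0 := hne (hne hσ0 hτ0) (hinv hA1)
  have hρ1 : ρ ≠ ⊤ := ne_top_of_le_ne_top hσ1 ((min_le_left _ _).trans (min_le_left _ _))
  have hr0 : r ≠ 0 := hne hρ0 (mul_ne_zero hρ0 (hinv hB1))
  have hrρ : r ≤ ρ := min_le_left _ _
  have hρσ : ρ ≤ min σ τ := min_le_left _ _
  have hwn (n : ℕ) : wnorm r (w n) ≤ ρ := by
    induction n with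
    | zero => simp [hw0, wnorm]
    | succ n ih =>
      rw [hws, hsub (hwZ n)]
      have hXr : wnorm r (MvPowerSeries.X 1) ≤ ρ := (wnorm_X r 1).trans hrρ
      have ha1 : wnorm r (sub (w n) (MvPowerSeries.X 1) a) ≤ A :=
        (wnorm_sub (hwZ n) hX ih hXr a).trans (wnorm_mono hρσ a)
      have hb1 : wnorm r (sub (w n) (MvPowerSeries.X 1) b) ≤ B :=
        (wnorm_sub (hwZ n) hX ih hXr b).trans (wnorm_mono hρσ b)
      calc _ ≤ wnorm r (w n ^ 2 * sub (w n) (MvPowerSeries.X 1) a) +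
            wnorm r (MvPowerSeries.X 1 * sub (w n) (MvPowerSeries.X 1) b) := wnorm_add _ _ _
        _ ≤ ρ ^ 2 * A + r * B := by
            refine add_le_add ((wnorm_mul _ _ _).trans ?_) ((wnorm_mul _ _ _).trans ?_)
            · exact mul_le_mul' ((wnorm_pow _ _ _).trans (by gcongr)) ha1
            · exact mul_le_mul' (wnorm_X r 1) hb1
        _ ≤ ρ * ((2 * (A + 1))⁻¹ * A) + ρ * ((2 * (B + 1))⁻¹ * B) := by
            refine add_le_add ?_ ?_
            · rw [pow_two, mul_assoc]
              gcongr
              exact min_le_right _ _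
            · rw [← mul_assoc]
              gcongr
              exact min_le_right _ _
        _ ≤ ρ * 2⁻¹ + ρ * 2⁻¹ := by
            gcongr
            · exact hhalf hA1
            · exact hhalf hB1
        _ = ρ := by rw [← mul_add, ENNReal.inv_two_add_inv_two, mul_one]
  refine (isConvergent_iff γ).2 ⟨r, hr0, ne_top_of_le_ne_top hρ1 hrρ,
    ne_top_of_le_ne_top hρ1 ?_⟩
  -- A finite partial sum involves finitely many coefficients, which agree with those of one
  -- iterate; its norm is at most ρ.
  rw [wnorm, ENNReal.tsum_eq_iSup_sum]
  refine iSup_le fun s => ?_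
  refine le_trans ?_ (hwn (s.sup fun n => n 0 + n 1))
  refine le_trans (le_of_eq ?_) (ENNReal.sum_le_tsum s)
  refine Finset.sum_congr rfl fun n hn => ?_
  have := low_iff.1 (hγ (s.sup fun n => n 0 + n 1)) (n 0) (n 1)
    (Nat.lt_succ_of_le (Finset.le_sup (f := fun n : Fin 2 →₀ ℕ => n 0 + n 1) hn))
  rw [cc_sub, sub_eq_zero] at this
  rw [coeff_eq_cc, coeff_eq_cc, this]

/-- `F(x, 0)` has order `d` in `x`. -/
def Reg (d : ℕ) (F : FPS) : Prop := (∀ i < d, cc F i 0 = 0) ∧ cc F d 0 ≠ 0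

/-- `γ(y)` is a convergent power series without constant term such that `F(γ(y), y^D) = 0`. -/
def IsBranch (F : FPS) (D : ℕ) (γ : FPS) : Prop :=
  IsConvergent γ ∧ Z γ ∧ tPart γ = γ ∧ sub γ (MvPowerSeries.X 1 ^ D) F = 0

/-- The equation F = 0 is the fixed point equation of Φ = x − F/c, where c is the coefficient of x
in F. The linear term of Φ in x vanishes. -/
theorem exists_branch_of_reg_one {F : FPS} (hF : IsConvergent F) (h : Reg 1 F) :
    ∃ γ, IsBranch F 1 γ := by
  obtain ⟨h0, h1⟩ := h
  have h00 := h0 0 one_pos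
  rw [cc_zero_zero] at h00
  have hX := zero_X 1
  let Φ : FPS := MvPowerSeries.X 0 - MvPowerSeries.C (cc F 1 0)⁻¹ * F
  have hcX : cc (MvPowerSeries.X 0) 1 0 = 1 := by
    have := cc_monomial 1 0 1 0 1
    rw [monomial_mon] at this
    simpa using this
  obtain ⟨γ, h2, h3, h4, h5⟩ := exists_implicit (Φ := Φ) (by simp [Z, Φ, h00]) (by
    rw [cc_sub, hcX, cc, MvPowerSeries.coeff_C_mul, ← cc, inv_mul_cancel₀ h1, sub_self])
    ((isConvergent_X 0).minus ((isConvergent_C _).mul hF))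
  refine ⟨γ, h2, h3, h4, ?_⟩
  rw [pow_one]
  rw [sub_sub' h3 hX, sub_X_zero h3 hX, sub_mul' h3 hX, sub_C, sub_eq_self] at h5
  have h6 : (MvPowerSeries.C (cc F 1 0)⁻¹ : FPS) ≠ 0 := by
    rw [← map_zero (MvPowerSeries.C (σ := Fin 2) (R := ℂ)), Ne, MvPowerSeries.C_injective.eq_iff]
    exact inv_ne_zero h1
  exact (mul_eq_zero.1 h5).resolve_left h6

/-! ### Newton-Puiseux roots -/

theorem cc_X_pow_mul_X_pow (a b i j : ℕ) :
    cc (MvPowerSeries.X 0 ^ a * MvPowerSeries.X 1 ^ b) i j = if i = a ∧ j = b then 1 else 0 := by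
  have := cc_monomial a b i j 1
  rwa [monomial_mon, map_one, one_mul] at this

theorem cc_X_zero_pow (a i j : ℕ) :
    cc (MvPowerSeries.X 0 ^ a) i j = if i = a ∧ j = 0 then 1 else 0 := by
  have := cc_X_pow_mul_X_pow a 0 i j
  rwa [pow_zero, mul_one] at this

theorem cc_X_one_pow (b i j : ℕ) :
    cc (MvPowerSeries.X 1 ^ b) i j = if i = 0 ∧ j = b then 1 else 0 := by
  have := cc_X_pow_mul_X_pow 0 b i j
  rwa [pow_zero, one_mul] at this

theorem cc_sub_eq {A B : FPS} (hA : Z A) (hB : Z B) (F : FPS) (i j : ℕ) :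
    cc (sub A B F) i j = ∑ᶠ d : Fin 2 →₀ ℕ, cc F (d 0) (d 1) * cc (A ^ d 0 * B ^ d 1) i j := by
  rw [cc, coeff_sub_eq hA hB]
  simp only [coeff_eq_cc, mon_apply_zero, mon_apply_one]

theorem cc_zero (i j : ℕ) : cc 0 i j = 0 := map_zero _

theorem cc_tPart (F : FPS) (i j : ℕ) : cc (tPart F) i j = if i = 0 then cc F 0 j else 0 := by
  rw [tPart, cc_sub_eq zero_zero (zero_X 1), finsum_eq_single _ (mon 0 j)]
  · simp only [mon_apply_zero, mon_apply_one, pow_zero, one_mul, cc_X_one_pow]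
    split_ifs with h1 h2 h2
    · rw [mul_one]
    · exact absurd h1.1 h2
    · exact absurd ⟨h2, trivial⟩ h1
    · rw [mul_zero]
  · intro d hd
    by_cases h0 : d 0 = 0
    · rw [h0, pow_zero, one_mul, cc_X_one_pow, if_neg, mul_zero]
      rintro ⟨-, rfl⟩
      apply hd
      rw [eq_mon d, h0]
      simp
    · rw [zero_pow h0, zero_mul, cc_zero, mul_zero]

theorem cc_xPart (F : FPS) (i j : ℕ) :
    cc (sub (MvPowerSeries.X 0) 0 F) i j = if j = 0 then cc F i 0 else 0 := by
  rw [cc_sub_eq (zero_X 0) zero_zero, finsum_eq_single _ (mon i 0)]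
  · simp only [mon_apply_zero, mon_apply_one, pow_zero, mul_one, cc_X_zero_pow]
    split_ifs with h1 h2 h2
    · rw [mul_one]
    · exact absurd h1.2 h2
    · exact absurd ⟨trivial, h2⟩ h1
    · rw [mul_zero]
  · intro d hd
    by_cases h0 : d 1 = 0
    · rw [h0, pow_zero, mul_one, cc_X_zero_pow, if_neg, mul_zero]
      rintro ⟨rfl, -⟩
      apply hd
      rw [eq_mon d, h0]
      simp
    · rw [zero_pow h0, mul_zero, cc_zero, mul_zero]

theorem cc_of_tPart {γ : FPS} (h : tPart γ = γ) {i : ℕ} (hi : i ≠ 0) (j : ℕ) : cc γ i j = 0 := by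
  rw [← h, cc_tPart, if_neg hi]

theorem tPart_of_cc {γ : FPS} (h : ∀ i j, i ≠ 0 → cc γ i j = 0) : tPart γ = γ := by
  refine ext_cc fun i j => ?_
  rw [cc_tPart]
  split_ifs with hi
  · rw [hi]
  · rw [h i j hi]

theorem xPart_of_tPart {γ : FPS} (hZ : Z γ) (h : tPart γ = γ) :
    sub (MvPowerSeries.X 0) 0 γ = 0 := by
  refine ext_cc fun i j => ?_
  rw [cc_xPart, cc_zero]
  split_ifs with hj
  · rcases i with _ | i
    · rw [cc_zero_zero, hZ]
    · exact cc_of_tPart h (Nat.succ_ne_zero i) 0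
  · rfl

theorem zero_X_add {τ : FPS} (h : Z τ) : Z (MvPowerSeries.X 0 + τ) := by
  rw [Z, map_add, zero_X, h, add_zero]

/-- The translation `F(x + τ(y), y)`. -/
abbrev shift (τ F : FPS) : FPS := sub (MvPowerSeries.X 0 + τ) (MvPowerSeries.X 1) F

theorem cc_shift_zero {τ : FPS} (hZ : Z τ) (h : tPart τ = τ) (F : FPS) (i : ℕ) :
    cc (shift τ F) i 0 = cc F i 0 := by
  have h1 : sub (MvPowerSeries.X 0) 0 (shift τ F) = sub (MvPowerSeries.X 0) 0 F := by
    rw [shift, sub_sub_comp (zero_X 0) zero_zero (zero_X_add hZ) (zero_X 1),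
      sub_add' (zero_X 0) zero_zero, sub_X_zero (zero_X 0) zero_zero, sub_X_one (zero_X 0) zero_zero,
      xPart_of_tPart hZ h, add_zero]
  have h2 := congrArg (fun G => cc G i 0) h1
  simpa only [cc_xPart, if_pos] using h2

theorem Reg.shift {d : ℕ} {τ F : FPS} (hZ : Z τ) (h : tPart τ = τ) (hF : Reg d F) :
    Reg d (PolarTree.shift τ F) := by
  refine ⟨fun i hi => ?_, ?_⟩
  · rw [cc_shift_zero hZ h, hF.1 i hi]
  · rw [cc_shift_zero hZ h]
    exact hF.2

theorem IsConvergent.shift {τ F : FPS} (hZ : Z τ) (hτ : IsConvergent τ) (hF : IsConvergent F) :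
    IsConvergent (PolarTree.shift τ F) :=
  .sub' (zero_X_add hZ) (zero_X 1) ((isConvergent_X 0).add hτ) (isConvergent_X 1) hF

/-- The series τ depends on y alone, so translation of x by τ commutes with ∂/∂x. This is checked on
monomials and extended by approximation. -/
theorem pderiv_shift {τ : FPS} (hZ : Z τ) (h : tPart τ = τ) (F : FPS) :
    MvPowerSeries.pderiv ℂ 0 (shift τ F) = shift τ (MvPowerSeries.pderiv ℂ 0 F) := by
  have hA := zero_X_add hZ
  have hX := zero_X 1
  have hτ : MvPowerSeries.pderiv ℂ 0 τ = 0 := by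
    refine ext_cc fun i j => ?_
    rw [cc_pderiv_zero, cc_of_tPart h (Nat.succ_ne_zero i), zero_mul, cc_zero]
  have key (i j : ℕ) : MvPowerSeries.pderiv ℂ 0 (shift τ (MvPowerSeries.monomial (mon i j) 1)) =
      shift τ (MvPowerSeries.pderiv ℂ 0 (MvPowerSeries.monomial (mon i j) 1)) := by
    rw [monomial_mon, map_one, one_mul, shift, shift, sub_mul' hA hX, sub_pow' hA hX,
      sub_pow' hA hX, sub_X_zero hA hX, sub_X_one hA hX]
    simp only [Derivation.leibniz, Derivation.leibniz_pow, map_add, hτ, MvPowerSeries.pderiv_X_self,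
      MvPowerSeries.pderiv_X_of_ne (R := ℂ) (i := (0 : Fin 2)) (j := 1) (by decide),
      add_zero, smul_eq_mul, mul_one]
    simp only [nsmul_eq_mul, mul_zero, zero_add]
    rw [sub_mul' hA hX, sub_mul' hA hX, sub_pow' hA hX, sub_pow' hA hX, sub_X_zero hA hX,
      sub_X_one hA hX, ← subHom_apply hA hX (_ : FPS), map_natCast]
  refine sub_eq_zero.1 (eq_zero_of_forall_low fun n => ?_)
  have hl := low_sub_boxTrunc (n + 1) F
  have e : MvPowerSeries.pderiv ℂ 0 (shift τ F) - shift τ (MvPowerSeries.pderiv ℂ 0 F) =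
      (MvPowerSeries.pderiv ℂ 0 (shift τ (F - boxTrunc (n + 1) F)) -
        shift τ (MvPowerSeries.pderiv ℂ 0 (F - boxTrunc (n + 1) F))) +
      (MvPowerSeries.pderiv ℂ 0 (shift τ (boxTrunc (n + 1) F)) -
        shift τ (MvPowerSeries.pderiv ℂ 0 (boxTrunc (n + 1) F))) := by
    simp only [shift, sub_sub' hA hX, map_sub]
    ring
  rw [e]
  refine (((hl.sub hA hX).pderiv 0).minus ((hl.pderiv 0).sub hA hX)).add ?_
  have : MvPowerSeries.pderiv ℂ 0 (shift τ (boxTrunc (n + 1) F)) -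
        shift τ (MvPowerSeries.pderiv ℂ 0 (boxTrunc (n + 1) F)) = 0 := by
    rw [sub_eq_zero, boxTrunc, map_sum]
    simp only [shift] at key ⊢
    simp only [← subHom_apply hA hX] at key ⊢
    rw [map_sum, map_sum, map_sum]
    refine Finset.sum_congr rfl fun p _ => ?_
    have e2 : (MvPowerSeries.monomial (mon p.1 p.2) (cc F p.1 p.2) : FPS) =
        cc F p.1 p.2 • MvPowerSeries.monomial (mon p.1 p.2) 1 := by
      rw [← map_smul, smul_eq_mul, mul_one]
    rw [e2, map_smul, Derivation.map_smul, Derivation.map_smul, map_smul, key]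
  rw [this]
  simp [Low]

theorem cc_pderiv_iterate (F : FPS) (k i j : ℕ) :
    ∃ m : ℕ, m ≠ 0 ∧ cc ((MvPowerSeries.pderiv ℂ 0)^[k] F) i j = m * cc F (i + k) j := by
  induction k generalizing i with
  | zero => exact ⟨1, one_ne_zero, by simp⟩
  | succ k ih =>
    obtain ⟨m, hm, h⟩ := ih (i + 1)
    refine ⟨m * (i + 1), mul_ne_zero hm (Nat.succ_ne_zero i), ?_⟩
    rw [Function.iterate_succ_apply', cc_pderiv_zero, h, add_right_comm i 1 k, ← add_assoc i k 1]
    push_cast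
    ring

theorem cc_aeval (Q : ℂ[X]) (k : ℕ) :
    cc (Polynomial.aeval (MvPowerSeries.X 0 : FPS) Q) k 0 = Q.coeff k := by
  induction Q using Polynomial.induction_on' with
  | add p q hp hq => rw [map_add, cc_add, hp, hq, Polynomial.coeff_add]
  | monomial n a =>
    rw [Polynomial.aeval_monomial, Polynomial.coeff_monomial, MvPowerSeries.algebraMap_apply,
      Algebra.algebraMap_self_apply, cc, MvPowerSeries.coeff_C_mul, ← cc, cc_X_zero_pow]
    by_cases h : k = n
    · simp [h]
    · simp [h, Ne.symm h]

/-- The substitution x = t^a A, y = t^b turns the weight ai + bj of a monomial into a power of t. -/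
theorem X_one_pow_dvd_sub {a b N : ℕ} {A F : FPS} (ha : a ≠ 0) (hb : b ≠ 0)
    (h : ∀ i j, cc F i j ≠ 0 → N ≤ a * i + b * j) :
    MvPowerSeries.X 1 ^ N ∣ sub (MvPowerSeries.X 1 ^ a * A) (MvPowerSeries.X 1 ^ b) F := by
  rw [MvPowerSeries.X_pow_dvd_iff]
  intro m hm
  have hA : Z (MvPowerSeries.X 1 ^ a * A) := by
    rw [Z, map_mul, zero_X_pow 1 ha, zero_mul]
  rw [coeff_sub_eq hA (zero_X_pow 1 hb)]
  refine finsum_eq_zero_of_forall_eq_zero fun d => ?_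
  by_cases hd : MvPowerSeries.coeff d F = 0
  · rw [hd, zero_mul]
  · have h1 := h (d 0) (d 1) (by rwa [← coeff_eq_cc])
    have h2 : (MvPowerSeries.X 1 : FPS) ^ N ∣
        (MvPowerSeries.X 1 ^ a * A) ^ d 0 * (MvPowerSeries.X 1 ^ b) ^ d 1 := by
      rw [mul_pow, ← pow_mul, ← pow_mul]
      refine (pow_dvd_pow _ h1).trans ⟨A ^ d 0, ?_⟩
      rw [pow_add]
      ring
    rw [MvPowerSeries.X_pow_dvd_iff.1 h2 m hm, mul_zero]

/-- The first slope of the Newton polygon. -/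
theorem exists_slope {c : ℕ → ℕ → ℂ} {d : ℕ} (h : ∃ i j, i < d ∧ c i j ≠ 0) :
    ∃ i₀ j₀, i₀ < d ∧ c i₀ j₀ ≠ 0 ∧
      ∀ i j, i < d → c i j ≠ 0 → j₀ * (d - i) ≤ j * (d - i₀) := by
  obtain ⟨i, j, hi, hc⟩ := h
  let S : Set (ℕ × ℕ) := {p | p.1 < d ∧ c p.1 p.2 ≠ 0}
  -- The slopes j/(d − i) are compared after multiplication by d!, which makes them integers and
  -- lets well-foundedness of ℕ produce the minimum.
  let q : ℕ → ℕ := fun i => d.factorial / (d - i)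
  have hq {i : ℕ} (hi : i < d) : q i * (d - i) = d.factorial :=
    Nat.div_mul_cancel (Nat.dvd_factorial (by omega) (Nat.sub_le _ _))
  obtain ⟨p, hp, hmin⟩ := exists_minimal_of_wellFoundedLT (α := ℕ)
    (fun n => ∃ p ∈ S, p.2 * q p.1 = n) ⟨_, (i, j), ⟨hi, hc⟩, rfl⟩
  obtain ⟨⟨i₀, j₀⟩, ⟨hi₀, hc₀⟩, rfl⟩ := hp
  refine ⟨i₀, j₀, hi₀, hc₀, fun i j hi hc => ?_⟩
  have h1 : j₀ * q i₀ ≤ j * q i := by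
    by_contra hlt
    rw [not_le] at hlt
    exact absurd (hmin ⟨(i, j), ⟨hi, hc⟩, rfl⟩ hlt.le) (not_le.2 hlt)
  have h2 : 0 < d.factorial := Nat.factorial_pos d
  refine Nat.le_of_mul_le_mul_left ?_ h2
  calc d.factorial * (j₀ * (d - i)) = (j₀ * q i₀) * ((d - i₀) * (d - i)) := by
        rw [← hq hi₀]
        ring
    _ ≤ (j * q i) * ((d - i₀) * (d - i)) := Nat.mul_le_mul_right _ h1
    _ = d.factorial * (j * (d - i₀)) := by
        rw [← hq hi]
        ring

/-- A polynomial of degree `d` without a term of degree `d - 1`, which is not a monomial, has a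
root whose multiplicity is less than `d`. -/
theorem exists_root_lt {P : ℂ[X]} {d : ℕ} (hd : 2 ≤ d) (hP : P.natDegree = d)
    (h1 : P.coeff (d - 1) = 0) {i₀ : ℕ} (hi : i₀ < d) (hi₀ : P.coeff i₀ ≠ 0) :
    ∃ c : ℂ, ∃ m, 1 ≤ m ∧ m < d ∧ (∀ k < m, (P.comp (Polynomial.X + Polynomial.C c)).coeff k = 0) ∧
      (P.comp (Polynomial.X + Polynomial.C c)).coeff m ≠ 0 := by
  have hdeg : P.degree ≠ 0 := by
    intro h
    have : P.natDegree = 0 := Polynomial.natDegree_eq_of_degree_eq_some h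
    omega
  obtain ⟨c, hc⟩ := IsAlgClosed.exists_root P hdeg
  set T := P.comp (Polynomial.X + Polynomial.C c) with hT
  have hTd : T.natDegree = d := by
    rw [hT, Polynomial.natDegree_comp, Polynomial.natDegree_X_add_C, mul_one, hP]
  have hT0 : T ≠ 0 := by
    rintro h
    rw [h, Polynomial.natDegree_zero] at hTd
    omega
  have hex : ∃ m, T.coeff m ≠ 0 := ⟨d, by rw [← hTd]; exact Polynomial.leadingCoeff_ne_zero.2 hT0⟩
  classical
  refine ⟨c, Nat.find hex, ?_, ?_, fun k hk => not_not.1 (Nat.find_min hex hk), Nat.find_spec hex⟩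
  · rw [Nat.one_le_iff_ne_zero]
    intro h0
    have := Nat.find_spec hex
    rw [h0, Polynomial.coeff_zero_eq_eval_zero, hT, Polynomial.eval_comp] at this
    simp only [Polynomial.eval_add, Polynomial.eval_X, Polynomial.eval_C, zero_add] at this
    exact this hc
  -- Multiplicity d would force P to be a constant times (x − c)^d. The coefficient of x^{d−1} is
  -- then −dc times the leading one, so c = 0 and P is a monomial, contrary to `hi₀`.
  · by_contra hlt
    rw [not_lt] at hlt
    have hlow : ∀ k < d, T.coeff k = 0 := fun k hk => not_not.1 (Nat.find_min hex (hk.trans_le hlt))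
    have hTm : T = Polynomial.C (T.coeff d) * Polynomial.X ^ d := by
      ext k
      rw [Polynomial.coeff_C_mul, Polynomial.coeff_X_pow]
      rcases lt_trichotomy k d with h | rfl | h
      · rw [hlow k h, if_neg h.ne, mul_zero]
      · simp
      · rw [Polynomial.coeff_eq_zero_of_natDegree_lt (hTd ▸ h), if_neg h.ne', mul_zero]
    have hPT : P = T.comp (Polynomial.X - Polynomial.C c) := by
      rw [hT, Polynomial.comp_assoc]
      simp
    have hTd0 : T.coeff d ≠ 0 := by
      rw [← hTd]
      exact Polynomial.leadingCoeff_ne_zero.2 hT0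
    have hP2 : P = Polynomial.C (T.coeff d) * (Polynomial.X - Polynomial.C c) ^ d := by
      rw [hPT]
      conv_lhs => rw [hTm]
      simp
    rw [hP2, Polynomial.coeff_C_mul, sub_eq_add_neg, ← Polynomial.C_neg,
      Polynomial.coeff_X_add_C_pow] at h1
    have h2 : d - (d - 1) = 1 := by omega
    rw [h2, pow_one] at h1
    have h3 : ((d.choose (d - 1) : ℕ) : ℂ) ≠ 0 := by
      exact_mod_cast (Nat.choose_pos (Nat.sub_le _ _)).ne'
    have hc0 : c = 0 := by
      have := (mul_eq_zero.1 ((mul_eq_zero.1 h1).resolve_left hTd0)).resolve_right h3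
      exact neg_eq_zero.1 this
    apply hi₀
    rw [hP2, hc0, Polynomial.coeff_C_mul, map_zero, sub_zero, Polynomial.coeff_X_pow,
      if_neg hi.ne, mul_zero]

/-- The substitution `x = t^a (c + x)`, `y = t^b` along an edge of the Newton polygon. -/
theorem exists_blowUp {G : FPS} {d i₀ j₀ : ℕ} (hd : 2 ≤ d) (hG : Reg d G)
    (hT : ∀ j, cc G (d - 1) j = 0) (hi₀ : i₀ < d) (hc₀ : cc G i₀ j₀ ≠ 0)
    (hmin : ∀ i j, i < d → cc G i j ≠ 0 → j₀ * (d - i) ≤ j * (d - i₀)) :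
    j₀ ≠ 0 ∧ ∃ c : ℂ, ∃ m, 1 ≤ m ∧ m < d ∧ ∃ G₂ : FPS, Reg m G₂ ∧
      sub (MvPowerSeries.X 1 ^ j₀ * (MvPowerSeries.C c + MvPowerSeries.X 0))
        (MvPowerSeries.X 1 ^ (d - i₀)) G = MvPowerSeries.X 1 ^ (j₀ * d) * G₂ := by
  have hj₀ : j₀ ≠ 0 := by
    rintro rfl
    exact hc₀ (hG.1 i₀ hi₀)
  refine ⟨hj₀, ?_⟩
  obtain ⟨b, hb⟩ : ∃ b, b = d - i₀ := ⟨_, rfl⟩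
  have hb0 : b ≠ 0 := by omega
  rw [← hb] at hmin ⊢
  -- The coefficients of G on the edge j₀(d − i) = bj of the Newton polygon; for an index i without
  -- integral j the value is 0.
  obtain ⟨p, hp⟩ : ∃ p : ℕ → ℂ, ∀ i, p i =
    if b ∣ j₀ * (d - i) then cc G i (j₀ * (d - i) / b) else 0 := ⟨_, fun _ => rfl⟩
  let P : ℂ[X] := ∑ i ∈ Finset.range (d + 1), Polynomial.monomial i (p i)
  have hPc (i : ℕ) : P.coeff i = if i ≤ d then p i else 0 := by
    simp only [P, Polynomial.finsetSum_coeff, Polynomial.coeff_monomial, Finset.sum_ite_eq',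
      Finset.mem_range, Nat.lt_succ_iff]
  have hpd : p d = cc G d 0 := by simp [hp]
  have hPd : P.natDegree = d := by
    refine Polynomial.natDegree_eq_of_le_of_coeff_ne_zero ?_ ?_
    · rw [Polynomial.natDegree_le_iff_coeff_eq_zero]
      intro N hN
      rw [hPc, if_neg (not_le.2 hN)]
    · rw [hPc, if_pos le_rfl, hpd]
      exact hG.2
  have hP1 : P.coeff (d - 1) = 0 := by
    rw [hPc, if_pos (Nat.sub_le _ _), hp]
    split_ifs
    · exact hT _
    · rfl
  have hPi : P.coeff i₀ ≠ 0 := by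
    rw [hPc, if_pos hi₀.le, hp, ← hb, if_pos (Dvd.intro_left _ rfl),
      Nat.mul_div_cancel _ (Nat.pos_of_ne_zero hb0)]
    exact hc₀
  obtain ⟨c, m, hm1, hmd, hlow, hm⟩ := exists_root_lt hd hPd hP1 hi₀ hPi
  refine ⟨c, m, hm1, hmd, ?_⟩
  have hU : Z (MvPowerSeries.X 1 ^ j₀ * (MvPowerSeries.C c + MvPowerSeries.X 0)) := by
    rw [Z, map_mul, zero_X_pow 1 hj₀, zero_mul]
  have hV : Z (MvPowerSeries.X 1 ^ b) := zero_X_pow 1 hb0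
  -- The edge part of G, of weight j₀i + bj = j₀d. By minimality of the slope every other term of G
  -- has a larger weight (`hweight`), hence gains a further factor t.
  let G₁ : FPS := ∑ i ∈ Finset.range (d + 1),
    MvPowerSeries.monomial (mon i (j₀ * (d - i) / b)) (p i)
  have hG₁ (i j : ℕ) : cc G₁ i j = if i ≤ d ∧ j = j₀ * (d - i) / b then p i else 0 := by
    have e : cc G₁ i j = ∑ k ∈ Finset.range (d + 1),
        cc (MvPowerSeries.monomial (mon k (j₀ * (d - k) / b)) (p k)) i j := map_sum _ _ _
    rw [e]
    simp only [cc_monomial]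
    by_cases hi : i ≤ d
    · rw [Finset.sum_eq_single i]
      · simp [hi]
      · intro k _ hk
        rw [if_neg]
        rintro ⟨rfl, -⟩
        exact hk rfl
      · intro h
        exact absurd (Finset.mem_range.2 (Nat.lt_succ_of_le hi)) h
    · rw [if_neg (fun h => hi h.1)]
      refine Finset.sum_eq_zero fun k hk => ?_
      rw [if_neg]
      rintro ⟨rfl, -⟩
      exact hi (Nat.lt_succ_iff.1 (Finset.mem_range.1 hk))
  have hweight (i j : ℕ) (h : cc (G - G₁) i j ≠ 0) : j₀ * d + 1 ≤ j₀ * i + b * j := by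
    rw [cc_sub, hG₁] at h
    by_contra hlt
    have hle : j₀ * i + b * j ≤ j₀ * d := by omega
    have hid : i ≤ d := by
      by_contra hid
      have : j₀ * (d + 1) ≤ j₀ * i := Nat.mul_le_mul_left _ (by omega)
      rw [mul_add] at this
      omega
    have hsplit : j₀ * d = j₀ * i + j₀ * (d - i) := by
      rw [← mul_add]
      congr 1
      omega
    have hle2 : b * j ≤ j₀ * (d - i) := by omega
    by_cases heq : b * j = j₀ * (d - i)
    · have hj : j = j₀ * (d - i) / b := by
        rw [← heq, Nat.mul_div_cancel_left _ (Nat.pos_of_ne_zero hb0)]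
      rw [if_pos ⟨hid, hj⟩, hp, if_pos ⟨j, heq.symm⟩, ← hj, sub_self] at h
      exact h rfl
    · have hcG : cc G i j = 0 := by
        by_contra hne
        rcases hid.lt_or_eq with hid | rfl
        · have := hmin i j hid hne
          rw [mul_comm j b] at this
          omega
        · rw [Nat.sub_self, mul_zero] at hle2 heq
          omega
      rw [hcG, _root_.zero_sub] at h
      split_ifs at h with h1
      · rw [hp] at h
        split_ifs at h with h2
        · apply heq
          rw [h1.2, Nat.mul_div_cancel' h2]
        · simp at h
      · simp at h
  obtain ⟨W, hW⟩ := X_one_pow_dvd_sub (A := MvPowerSeries.C c + MvPowerSeries.X 0) hj₀ hb0 hweight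
  have hmain : sub (MvPowerSeries.X 1 ^ j₀ * (MvPowerSeries.C c + MvPowerSeries.X 0))
      (MvPowerSeries.X 1 ^ b) G₁ = MvPowerSeries.X 1 ^ (j₀ * d) *
        Polynomial.aeval (MvPowerSeries.X 0 + MvPowerSeries.C c) P := by
    rw [← subHom_apply hU hV, map_sum, map_sum, Finset.mul_sum]
    refine Finset.sum_congr rfl fun i hi => ?_
    rw [subHom_apply, monomial_mon, sub_mul' hU hV, sub_mul' hU hV, sub_pow' hU hV, sub_pow' hU hV,
      sub_X_zero hU hV, sub_X_one hU hV, sub_C, Polynomial.aeval_monomial,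
      MvPowerSeries.algebraMap_apply, Algebra.algebraMap_self_apply]
    by_cases hdvd : b ∣ j₀ * (d - i)
    · have hid : i ≤ d := Nat.lt_succ_iff.1 (Finset.mem_range.1 hi)
      have e : j₀ * d = j₀ * i + b * (j₀ * (d - i) / b) := by
        rw [Nat.mul_div_cancel' hdvd, ← mul_add]
        congr 1
        omega
      rw [e, pow_add, mul_pow, ← pow_mul, ← pow_mul]
      ring
    · have : p i = 0 := by rw [hp, if_neg hdvd]
      rw [this, map_zero, zero_mul, zero_mul, mul_zero]
  -- At t = 0 this series is P(x + c), so its order in x is the multiplicity m < d of the root c.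
  refine ⟨Polynomial.aeval (MvPowerSeries.X 0 + MvPowerSeries.C c) P + MvPowerSeries.X 1 * W, ?_, ?_⟩
  · have hcc (k : ℕ) : cc (Polynomial.aeval (MvPowerSeries.X 0 + MvPowerSeries.C c) P +
        MvPowerSeries.X 1 * W) k 0 = (P.comp (Polynomial.X + Polynomial.C c)).coeff k := by
      rw [cc_add, cc_X_one_mul, if_neg (by omega), add_zero, ← cc_aeval, Polynomial.aeval_comp]
      simp [MvPowerSeries.algebraMap_apply]
    exact ⟨fun k hk => by rw [hcc, hlow k hk], by rwa [hcc]⟩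
  · have e : G = G₁ + (G - G₁) := by ring
    conv_lhs => rw [e]
    rw [sub_add' hU hV, hmain, hW, pow_succ]
    ring

theorem IsBranch.shift {F τ γ : FPS} {D : ℕ} (hD : D ≠ 0) (hτ : IsConvergent τ) (hZ : Z τ)
    (hT : tPart τ = τ) (h : IsBranch (shift τ F) D γ) :
    IsBranch F D (γ + sub 0 (MvPowerSeries.X 1 ^ D) τ) := by
  obtain ⟨h1, h2, h3, h4⟩ := h
  have hX := zero_X 1
  have hXD := zero_X_pow 1 hD
  refine ⟨h1.add (.sub' zero_zero hXD isConvergent_zero ((isConvergent_X 1).pow D) hτ), ?_, ?_, ?_⟩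
  · rw [Z, map_add, h2, zero_sub zero_zero hXD hZ, add_zero]
  · rw [tPart] at h3 ⊢
    rw [sub_add' zero_zero hX, h3, sub_sub_comp zero_zero hX zero_zero hXD, sub_zero' zero_zero hX,
      sub_pow' zero_zero hX, sub_X_one zero_zero hX]
  · rw [PolarTree.shift, sub_sub_comp h2 hXD (zero_X_add hZ) hX, sub_add' h2 hXD, sub_X_zero h2 hXD,
      sub_X_one h2 hXD] at h4
    have e : sub γ (MvPowerSeries.X 1 ^ D) τ = sub 0 (MvPowerSeries.X 1 ^ D) τ := by
      conv_lhs => rw [← hT, tPart, sub_sub_comp h2 hXD zero_zero hX, sub_zero' h2 hXD,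
        sub_X_one h2 hXD]
    rwa [e] at h4

/-- The Newton-Puiseux theorem: a convergent power series that is regular of order `d ≥ 1` in `x`
has a convergent fractional root. -/
theorem exists_branch : ∀ d : ℕ, 1 ≤ d → ∀ F : FPS, IsConvergent F → Reg d F →
    ∃ D, D ≠ 0 ∧ ∃ γ, IsBranch F D γ := by
  intro d
  induction d using Nat.strong_induction_on with
  | _ d ih =>
    intro hd F hF hreg
    have hX := zero_X 1
    rcases hd.lt_or_eq with hd | rfl
    swap
    · exact ⟨1, one_ne_zero, exists_branch_of_reg_one hF hreg⟩
    have hFk (k : ℕ) : IsConvergent ((MvPowerSeries.pderiv ℂ 0)^[k] F) := by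
      induction k with
      | zero => exact hF
      | succ k ih =>
        rw [Function.iterate_succ_apply']
        exact ih.pderiv 0
    -- Tschirnhaus transformation: the (d−1)-st derivative in x is regular of order 1, and
    -- translation by its root τ(y) makes the coefficient of x^{d−1} vanish for all y. The edge
    -- polynomial then cannot be a nontrivial d-th power.
    have hreg1 : Reg 1 ((MvPowerSeries.pderiv ℂ 0)^[d - 1] F) := by
      constructor
      · intro i hi
        obtain ⟨m, hm, h⟩ := cc_pderiv_iterate F (d - 1) i 0
        rw [h, hreg.1 _ (by omega), mul_zero]
      · obtain ⟨m, hm, h⟩ := cc_pderiv_iterate F (d - 1) 1 0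
        have e : 1 + (d - 1) = d := by omega
        rw [h, e]
        exact mul_ne_zero (Nat.cast_ne_zero.2 hm) hreg.2
    obtain ⟨τ, hτc, hτZ, hτT, hτ⟩ := exists_branch_of_reg_one (hFk _) hreg1
    rw [pow_one] at hτ
    suffices h : ∃ D, D ≠ 0 ∧ ∃ γ, IsBranch (shift τ F) D γ by
      obtain ⟨D, hD, γ, hγ⟩ := h
      exact ⟨D, hD, _, hγ.shift hD hτc hτZ hτT⟩
    have hGc : IsConvergent (shift τ F) := IsConvergent.shift hτZ hτc hF
    have hGreg : Reg d (shift τ F) := hreg.shift hτZ hτT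
    have hGT (j : ℕ) : cc (shift τ F) (d - 1) j = 0 := by
      have hit (k : ℕ) : (MvPowerSeries.pderiv ℂ 0)^[k] (shift τ F) =
          shift τ ((MvPowerSeries.pderiv ℂ 0)^[k] F) := by
        induction k with
        | zero => rfl
        | succ k ih => rw [Function.iterate_succ_apply', ih, pderiv_shift hτZ hτT,
            Function.iterate_succ_apply']
      have h1 : tPart ((MvPowerSeries.pderiv ℂ 0)^[d - 1] (shift τ F)) = 0 := by
        rw [hit, tPart, shift, sub_sub_comp zero_zero hX (zero_X_add hτZ) hX,
          sub_add' zero_zero hX, sub_X_zero zero_zero hX, sub_X_one zero_zero hX, zero_add]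
        rw [tPart] at hτT
        rw [hτT, hτ]
      obtain ⟨m, hm, h⟩ := cc_pderiv_iterate (shift τ F) (d - 1) 0 j
      have h2 := cc_tPart ((MvPowerSeries.pderiv ℂ 0)^[d - 1] (shift τ F)) 0 j
      rw [h1, cc_zero, if_pos rfl, h, zero_add] at h2
      exact (mul_eq_zero.1 h2.symm).resolve_left (Nat.cast_ne_zero.2 hm)
    obtain ⟨G, hG⟩ : ∃ G, G = shift τ F := ⟨_, rfl⟩
    rw [← hG] at hGc hGreg hGT ⊢
    by_cases hex : ∃ i j, i < d ∧ cc G i j ≠ 0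
    · obtain ⟨i₀, j₀, hi₀, hc₀, hmin⟩ := exists_slope hex
      obtain ⟨hj₀, c, m, hm1, hmd, G₂, hG₂, hblow⟩ := exists_blowUp hd hGreg hGT hi₀ hc₀ hmin
      obtain ⟨b, hb⟩ : ∃ b, b = d - i₀ := ⟨_, rfl⟩
      have hb0 : b ≠ 0 := by omega
      rw [← hb] at hblow
      have hU : Z (MvPowerSeries.X 1 ^ j₀ * (MvPowerSeries.C c + MvPowerSeries.X 0)) := by
        rw [Z, map_mul, zero_X_pow 1 hj₀, zero_mul]
      have hV : Z (MvPowerSeries.X 1 ^ b) := zero_X_pow 1 hb0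
      have hG₂c : IsConvergent G₂ := by
        refine IsConvergent.of_X_one_pow_mul (n := j₀ * d) ?_
        rw [← hblow]
        exact .sub' hU hV (((isConvergent_X 1).pow _).mul
          ((isConvergent_C c).add (isConvergent_X 0))) ((isConvergent_X 1).pow _) hGc
      obtain ⟨D, hD, γ, h1, h2, h3, h4⟩ := ih m hmd hm1 G₂ hG₂c hG₂
      have hXD := zero_X_pow 1 hD
      have e1 : sub γ (MvPowerSeries.X 1 ^ D)
          (MvPowerSeries.X 1 ^ j₀ * (MvPowerSeries.C c + MvPowerSeries.X 0)) =
          MvPowerSeries.X 1 ^ (D * j₀) * (MvPowerSeries.C c + γ) := by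
        rw [sub_mul' h2 hXD, sub_pow' h2 hXD, sub_X_one h2 hXD, sub_add' h2 hXD, sub_C,
          sub_X_zero h2 hXD, pow_mul]
      refine ⟨D * b, mul_ne_zero hD hb0, MvPowerSeries.X 1 ^ (D * j₀) * (MvPowerSeries.C c + γ),
        ((isConvergent_X 1).pow _).mul ((isConvergent_C c).add h1), ?_, ?_, ?_⟩
      · rw [Z, map_mul, zero_X_pow 1 (mul_ne_zero hD hj₀), zero_mul]
      · rw [tPart] at h3 ⊢
        rw [sub_mul' zero_zero hX, sub_pow' zero_zero hX, sub_X_one zero_zero hX,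
          sub_add' zero_zero hX, sub_C, h3]
      · have h5 := congrArg (sub γ (MvPowerSeries.X 1 ^ D)) hblow
        rw [sub_mul' h2 hXD, h4, mul_zero, sub_sub_comp h2 hXD hU hV, e1, sub_pow' h2 hXD,
          sub_X_one h2 hXD, ← pow_mul] at h5
        exact h5
    -- No term has x-exponent below d, so x = 0 is already a root.
    · push Not at hex
      refine ⟨1, one_ne_zero, 0, isConvergent_zero, zero_zero, sub_zero' zero_zero hX, ?_⟩
      rw [pow_one]
      refine ext_cc fun i j => ?_
      have := cc_tPart G i j
      rw [tPart] at this
      rw [this, cc_zero, hex 0 j (by omega), ite_self]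

theorem sub_self_X_pow {γ : FPS} (hT : tPart γ = γ) {A B : FPS} (hA : Z A) (hB : Z B) :
    sub A B γ = sub 0 B γ := by
  have hX := zero_X 1
  conv_lhs => rw [← hT, tPart, sub_sub_comp hA hB zero_zero hX, sub_zero' hA hB, sub_X_one hA hB]

theorem tPart_sub {γ : FPS} (hT : tPart γ = γ) {D : ℕ} (hD : D ≠ 0) :
    tPart (sub (MvPowerSeries.X 0) (MvPowerSeries.X 1 ^ D) γ) =
      sub (MvPowerSeries.X 0) (MvPowerSeries.X 1 ^ D) γ := by
  have hX := zero_X 1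
  have hXD := zero_X_pow 1 hD
  rw [tPart, sub_sub_comp zero_zero hX (zero_X 0) hXD, sub_X_zero zero_zero hX,
    sub_pow' zero_zero hX, sub_X_one zero_zero hX, sub_self_X_pow hT (zero_X 0) hXD]

/-- The ramification `F(x, t^D)`. -/
abbrev ram (D : ℕ) (F : FPS) : FPS := sub (MvPowerSeries.X 0) (MvPowerSeries.X 1 ^ D) F

theorem cc_ram_zero {D : ℕ} (hD : D ≠ 0) (F : FPS) (i : ℕ) : cc (ram D F) i 0 = cc F i 0 := by
  have hX := zero_X 0
  have h1 : sub (MvPowerSeries.X 0) 0 (ram D F) = sub (MvPowerSeries.X 0) 0 F := by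
    rw [ram, sub_sub_comp hX zero_zero hX (zero_X_pow 1 hD), sub_X_zero hX zero_zero,
      sub_pow' hX zero_zero, sub_X_one hX zero_zero, zero_pow hD]
  simpa only [cc_xPart, if_pos] using congrArg (fun G => cc G i 0) h1

/-- After translating the root to x = 0 the series is divisible by x. Translating back does not
affect the restriction to y = 0, because γ has no constant term, so the order in x drops by exactly
one. -/
theorem IsBranch.exists_factor {F γ : FPS} {d D : ℕ} (hD : D ≠ 0) (hF : IsConvergent F)
    (hreg : Reg (d + 1) F) (h : IsBranch F D γ) :
    ∃ Q, IsConvergent Q ∧ Reg d Q ∧ ram D F = (MvPowerSeries.X 0 - γ) * Q := by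
  obtain ⟨h1, h2, h3, h4⟩ := h
  have hX0 := zero_X 0
  have hX := zero_X 1
  have hXD := zero_X_pow 1 hD
  have hγ : sub (MvPowerSeries.X 0 + -γ) (MvPowerSeries.X 1) γ = γ := by
    rw [sub_self_X_pow h3 (by simp [Z, h2]) hX]
    exact h3
  have hZn : Z (-γ) := by simp [Z, h2]
  have hZn' := zero_X_add hZn
  have hZ' := zero_X_add h2
  have hFc : IsConvergent (ram D F) := .sub' hX0 hXD (isConvergent_X 0) ((isConvergent_X 1).pow D) hF
  have hGc : IsConvergent (PolarTree.shift γ (ram D F)) := .shift h2 h1 hFc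
  have hG0 : tPart (PolarTree.shift γ (ram D F)) = 0 := by
    rw [tPart, PolarTree.shift, sub_sub_comp zero_zero hX hZ' hX, sub_add' zero_zero hX,
      sub_X_zero zero_zero hX, sub_X_one zero_zero hX, zero_add,
      show sub 0 (MvPowerSeries.X 1) γ = γ from h3,
      ram, sub_sub_comp h2 hX hX0 hXD, sub_X_zero h2 hX, sub_pow' h2 hX, sub_X_one h2 hX, h4]
  obtain ⟨G, hG⟩ : (MvPowerSeries.X 0 : FPS) ∣ PolarTree.shift γ (ram D F) := by
    rw [MvPowerSeries.X_dvd_iff]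
    intro m hm
    have := cc_tPart (PolarTree.shift γ (ram D F)) 0 (m 1)
    rw [hG0, cc_zero, if_pos rfl] at this
    rw [coeff_eq_cc, hm, ← this]
  have hGc' : IsConvergent G := by
    refine IsConvergent.of_X_zero_pow_mul (n := 1) ?_
    rwa [pow_one, ← hG]
  have e : ram D F = (MvPowerSeries.X 0 - γ) * PolarTree.shift (-γ) G := by
    have e1 : PolarTree.shift (-γ) (PolarTree.shift γ (ram D F)) = ram D F := by
      rw [PolarTree.shift, PolarTree.shift, sub_sub_comp hZn' hX hZ' hX, sub_add' hZn' hX, sub_X_zero hZn' hX,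
        sub_X_one hZn' hX, hγ, neg_add_cancel_right, sub_X_X]
    rw [← e1, hG, PolarTree.shift, sub_mul' hZn' hX, sub_X_zero hZn' hX, sub_eq_add_neg]
  have key (i : ℕ) : cc F (i + 1) 0 = cc (PolarTree.shift (-γ) G) i 0 := by
    have h5 := cc_X_zero_mul (sub (MvPowerSeries.X 0) 0 (PolarTree.shift (-γ) G)) (i + 1) 0
    rw [if_pos (Nat.succ_le_succ (Nat.zero_le _)), cc_xPart, if_pos rfl, Nat.add_sub_cancel] at h5
    rw [← cc_ram_zero hD, ← h5]
    have h6 := cc_xPart (ram D F) (i + 1) 0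
    rw [if_pos rfl] at h6
    rw [← h6, e, sub_mul' hX0 zero_zero, sub_sub' hX0 zero_zero, sub_X_zero hX0 zero_zero,
      xPart_of_tPart h2 h3, _root_.sub_zero]
  refine ⟨PolarTree.shift (-γ) G, .shift hZn h1.neg hGc', ⟨fun i hi => ?_, ?_⟩, e⟩
  · rw [← key, hreg.1 _ (by omega)]
  · rw [← key]
    exact hreg.2

/-- A regular convergent power series splits into linear factors after a ramification. -/
theorem exists_split (d : ℕ) : ∀ F : FPS, IsConvergent F → Reg d F → ∃ D, D ≠ 0 ∧
    ∃ L : Multiset FPS, (∀ γ ∈ L, IsConvergent γ ∧ Z γ ∧ tPart γ = γ) ∧ ∃ u, IsConvergent u ∧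
      cc u 0 0 ≠ 0 ∧ ram D F = u * (L.map fun γ => MvPowerSeries.X 0 - γ).prod := by
  induction d with
  | zero =>
    intro F hF hreg
    refine ⟨1, one_ne_zero, 0, by simp, F, hF, hreg.2, ?_⟩
    rw [ram, pow_one, sub_X_X]
    simp
  | succ d ih =>
    intro F hF hreg
    obtain ⟨D, hD, γ, hγ⟩ := exists_branch (d + 1) (Nat.succ_le_succ (Nat.zero_le d)) F hF hreg
    obtain ⟨Q, hQ, hQreg, hQe⟩ := hγ.exists_factor hD hF hreg
    obtain ⟨D', hD', L, hL, u, hu, hu0, he⟩ := ih Q hQ hQreg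
    obtain ⟨h1, h2, h3, h4⟩ := hγ
    have hX0 := zero_X 0
    have hXD' := zero_X_pow 1 hD'
    refine ⟨D * D', mul_ne_zero hD hD', ram D' γ ::ₘ L, fun δ hδ => ?_, u, hu, hu0, ?_⟩
    · rcases Multiset.mem_cons.1 hδ with rfl | hδ
      · exact ⟨.sub' hX0 hXD' (isConvergent_X 0) ((isConvergent_X 1).pow _) h1,
          zero_sub hX0 hXD' h2, tPart_sub h3 hD'⟩
      · exact hL δ hδ
    · have e : ram (D * D') F = ram D' (ram D F) := by
        rw [ram, ram, ram, sub_sub_comp hX0 hXD' hX0 (zero_X_pow 1 hD), sub_X_zero hX0 hXD',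
          sub_pow' hX0 hXD', sub_X_one hX0 hXD', ← pow_mul, mul_comm]
      rw [e, hQe, ram, sub_mul' hX0 hXD', sub_sub' hX0 hXD', sub_X_zero hX0 hXD',
        show sub (MvPowerSeries.X 0) (MvPowerSeries.X 1 ^ D') Q = _ from he, Multiset.map_cons,
        Multiset.prod_cons]
      ring

/-! ### The order of vanishing along an arc -/

/-- The ring homomorphism `φ` kills `F` to the exact order `m` in the direction of `x`. -/
def ExactOrder (φ : FPS →+* K) (m : ℕ) (F : FPS) : Prop :=
  (∀ k < m, φ ((MvPowerSeries.pderiv ℂ 0)^[k] F) = 0) ∧ φ ((MvPowerSeries.pderiv ℂ 0)^[m] F) ≠ 0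

/-- By Leibniz' rule every term with fewer than m derivatives on G is killed by φ. -/
theorem map_pderiv_iterate_mul (φ : FPS →+* K) (m : ℕ) : ∀ u G : FPS,
    (∀ k < m, φ ((MvPowerSeries.pderiv ℂ 0)^[k] G) = 0) →
    φ ((MvPowerSeries.pderiv ℂ 0)^[m] (u * G)) = φ u * φ ((MvPowerSeries.pderiv ℂ 0)^[m] G) := by
  have hadd (k : ℕ) (F G : FPS) : (MvPowerSeries.pderiv ℂ 0)^[k] (F + G) =
      (MvPowerSeries.pderiv ℂ 0)^[k] F + (MvPowerSeries.pderiv ℂ 0)^[k] G := by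
    induction k with
    | zero => rfl
    | succ k ih => simp only [Function.iterate_succ_apply', ih, map_add]
  induction m with
  | zero => intro u G _; simp
  | succ m ih =>
    intro u G h
    rw [Function.iterate_succ_apply, Derivation.leibniz, hadd, map_add, smul_eq_mul, smul_eq_mul,
      mul_comm G, ih _ G fun k hk => h k (by omega), h m (by omega), mul_zero, add_zero,
      ih u (MvPowerSeries.pderiv ℂ 0 G) fun k hk => ?_, ← Function.iterate_succ_apply]
    rw [← Function.iterate_succ_apply]
    exact h (k + 1) (by omega)

theorem ExactOrder.mul_of_ne {φ : FPS →+* K} {m : ℕ} {u G : FPS} (h : ExactOrder φ m G)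
    (hu : φ u ≠ 0) : ExactOrder φ m (u * G) := by
  refine ⟨fun k hk => ?_, ?_⟩
  · rw [map_pderiv_iterate_mul φ k u G fun l hl => h.1 l (hl.trans hk), h.1 k hk, mul_zero]
  · rw [map_pderiv_iterate_mul φ m u G h.1]
    exact mul_ne_zero hu h.2

theorem pderiv_iterate_linear_mul {L : FPS} (hL : MvPowerSeries.pderiv ℂ 0 L = 1) (G : FPS)
    (k : ℕ) : (MvPowerSeries.pderiv ℂ 0)^[k + 1] (L * G) =
      L * (MvPowerSeries.pderiv ℂ 0)^[k + 1] G + (k + 1) * (MvPowerSeries.pderiv ℂ 0)^[k] G := by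
  induction k with
  | zero => simp [hL]
  | succ k ih =>
    have hc : MvPowerSeries.pderiv ℂ 0 ((k : FPS) + 1) = 0 := by simp
    rw [Function.iterate_succ_apply', ih, map_add, Derivation.leibniz, Derivation.leibniz, hL, hc,
      ← Function.iterate_succ_apply' (MvPowerSeries.pderiv ℂ 0), smul_eq_mul, smul_eq_mul,
      smul_eq_mul, smul_eq_mul, ← Function.iterate_succ_apply' (MvPowerSeries.pderiv ℂ 0)]
    push_cast
    ring

theorem ExactOrder.linear_mul {φ : FPS →+* K} {m : ℕ} {L G : FPS} (h : ExactOrder φ m G)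
    (hL : MvPowerSeries.pderiv ℂ 0 L = 1) (h0 : φ L = 0) : ExactOrder φ (m + 1) (L * G) := by
  refine ⟨fun k hk => ?_, ?_⟩
  · rcases k with _ | k
    · simp [h0]
    · rw [pderiv_iterate_linear_mul hL, map_add, map_mul, h0, zero_mul, map_mul,
        h.1 k (by omega), mul_zero, add_zero]
  · rw [pderiv_iterate_linear_mul hL, map_add, map_mul, h0, zero_mul, zero_add, map_mul]
    refine mul_ne_zero ?_ h.2
    rw [map_add, map_natCast, map_one]
    have : CharZero K := charZero_of_injective_ringHom (HahnSeries.C : ℂ →+* K).injective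
    exact Nat.cast_add_one_ne_zero m

theorem exactOrder_zero {φ : FPS →+* K} {u : FPS} (hu : φ u ≠ 0) : ExactOrder φ 0 u :=
  ⟨fun k hk => absurd hk (Nat.not_lt_zero k), hu⟩

theorem pderiv_X_sub {γ : FPS} (h : tPart γ = γ) :
    MvPowerSeries.pderiv ℂ 0 (MvPowerSeries.X 0 - γ) = 1 := by
  refine ext_cc fun i j => ?_
  have hx := cc_X_zero_pow 1 (i + 1) j
  rw [pow_one] at hx
  rw [cc_pderiv_zero, cc_sub, cc_of_tPart h (Nat.succ_ne_zero i), hx, cc_one]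
  by_cases hi : i = 0
  · simp [hi]
  · simp [hi]

-- A factor that vanishes at ξ raises the order of vanishing by one, and any other factor leaves it
-- unchanged. This links multiplicities defined by derivatives to multiplicities in a product.
open Classical in
theorem exactOrder_prod {φ : FPS →+* K} {ξ : K} (hξ : φ (MvPowerSeries.X 0) = ξ) {u : FPS}
    (hu : φ u ≠ 0) {L : Multiset FPS} (hL : ∀ γ ∈ L, tPart γ = γ) :
    ExactOrder φ ((L.map φ).count ξ) (u * (L.map fun γ => MvPowerSeries.X 0 - γ).prod) := by
  induction L using Multiset.induction_on with
  | empty => simpa using exactOrder_zero hu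
  | cons γ L ih =>
    have ih := ih fun δ hδ => hL δ (Multiset.mem_cons_of_mem hδ)
    have hγ := hL γ (Multiset.mem_cons_self γ L)
    rw [Multiset.map_cons, Multiset.map_cons, Multiset.prod_cons, mul_left_comm]
    by_cases h : ξ = φ γ
    · rw [← h, Multiset.count_cons_self]
      exact ih.linear_mul (pderiv_X_sub hγ) (by rw [map_sub, hξ, h, sub_self])
    · rw [Multiset.count_cons_of_ne h]
      exact ih.mul_of_ne (by rw [map_sub, hξ]; exact sub_ne_zero.2 h)

theorem cc_ram {D : ℕ} (hD : D ≠ 0) (F : FPS) (i j : ℕ) :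
    cc (ram D F) i j = if D ∣ j then cc F i (j / D) else 0 := by
  rw [ram, cc_sub_eq (zero_X 0) (zero_X_pow 1 hD)]
  simp only [← pow_mul, cc_X_pow_mul_X_pow]
  rw [finsum_eq_single _ (mon i (j / D))]
  · simp only [mon_apply_zero, mon_apply_one, true_and]
    by_cases h : D ∣ j
    · rw [if_pos (Nat.mul_div_cancel' h).symm, if_pos h, mul_one]
    · rw [if_neg fun h' => h (Dvd.intro _ h'.symm), if_neg h, mul_zero]
  · intro d hd
    rw [if_neg, mul_zero]
    rintro ⟨h1, h2⟩
    apply hd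
    rw [eq_mon d, h1, h2, Nat.mul_div_cancel_left _ (Nat.pos_of_ne_zero hD)]

/-! ### Convergent fractional power series -/

theorem pos_orderTop_zero : 0 < (0 : K).orderTop := by simp

theorem pos_orderTop_single {q : ℚ} (hq : 0 < q) : 0 < (HahnSeries.single q (1 : ℂ)).orderTop :=
  pos_orderTop_iff.2 (vgt_single 1 hq)

theorem coeff_ev_mul {q : ℚ} (hq : 0 < q) (γ : FPS) (n : ℕ) :
    (ev 0 (HahnSeries.single q 1) γ).coeff (n * q) = cc γ 0 n := by
  rw [coeff_ev pos_orderTop_zero (pos_orderTop_single hq), finsum_eq_single _ (0, n)]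
  · simp [HahnSeries.single_pow]
  · rintro ⟨i, j⟩ hij
    by_cases hi : i = 0
    · have hj : n ≠ j := fun h => hij (by rw [hi, h])
      rw [hi, pow_zero, one_mul, HahnSeries.single_pow, HahnSeries.coeff_single_of_ne, mul_zero]
      rw [nsmul_eq_mul]
      intro h
      exact hj (by exact_mod_cast mul_right_cancel₀ hq.ne' h)
    · simp [hi]

theorem coeff_ev_of_ne {q e : ℚ} (hq : 0 < q) (γ : FPS) (he : ∀ n : ℕ, e ≠ n * q) :
    (ev 0 (HahnSeries.single q 1) γ).coeff e = 0 := by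
  rw [coeff_ev pos_orderTop_zero (pos_orderTop_single hq)]
  refine finsum_eq_zero_of_forall_eq_zero fun p => ?_
  by_cases hi : p.1 = 0
  · rw [hi, pow_zero, one_mul, HahnSeries.single_pow, HahnSeries.coeff_single_of_ne, mul_zero]
    rw [nsmul_eq_mul]
    exact he _
  · simp [hi]

/-- The series `y^{1/D}`. -/
abbrev yRoot (D : ℕ) : K := HahnSeries.single (1 / D : ℚ) 1

theorem pos_one_div {D : ℕ} (hD : D ≠ 0) : (0 : ℚ) < 1 / D := by positivity

theorem pos_yRoot {D : ℕ} (hD : D ≠ 0) : 0 < (yRoot D).orderTop :=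
  pos_orderTop_single (pos_one_div hD)

theorem yRoot_pow {D : ℕ} (hD : D ≠ 0) : yRoot D ^ D = HahnSeries.single 1 1 := by
  rw [yRoot, HahnSeries.single_pow, one_pow, nsmul_eq_mul]
  congr 1
  field_simp

theorem ev_ram {D : ℕ} (hD : D ≠ 0) {ξ η : K} (hξ : 0 < ξ.orderTop) (hη : 0 < η.orderTop)
    (F : FPS) : ev ξ η (ram D F) = ev ξ (η ^ D) F := by
  rw [ram, ev_sub (zero_X 0) (zero_X_pow 1 hD) hξ hη, ev_X_zero hξ hη]
  rw [show ev ξ η (MvPowerSeries.X 1 ^ D) = ev ξ η (MvPowerSeries.X 1) ^ D from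
    map_pow (evHom hξ hη) _ _, ev_X_one hξ hη]

theorem ev_of_tPart {γ : FPS} (h : tPart γ = γ) {ξ η : K} (hξ : 0 < ξ.orderTop)
    (hη : 0 < η.orderTop) : ev ξ η γ = ev 0 η γ := by
  conv_lhs => rw [← h, tPart, ev_sub zero_zero (zero_X 1) hξ hη, ev_X_one hξ hη, map_zero]

/-- `ξ` is a convergent fractional power series. -/
def ConvArc (ξ : K) : Prop :=
  ∃ D : ℕ, D ≠ 0 ∧ ∃ γ : FPS, IsConvergent γ ∧ tPart γ = γ ∧ ξ = ev 0 (yRoot D) γ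

theorem yRoot_mul_pow {D k : ℕ} (hk : k ≠ 0) : yRoot (D * k) ^ k = yRoot D := by
  rw [yRoot, yRoot, HahnSeries.single_pow, one_pow, nsmul_eq_mul]
  congr 1
  push_cast
  field_simp

/-- Ramification brings two series with denominators D and D' to the denominator DD'. Sums and
products can then be formed in one ring of power series. -/
theorem ConvArc.exists_common {ξ η : K} (hξ : ConvArc ξ) (hη : ConvArc η) :
    ∃ D : ℕ, D ≠ 0 ∧ ∃ γ δ : FPS, IsConvergent γ ∧ tPart γ = γ ∧ IsConvergent δ ∧ tPart δ = δ ∧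
      ξ = ev 0 (yRoot D) γ ∧ η = ev 0 (yRoot D) δ := by
  obtain ⟨D, hD, γ, h1, h2, rfl⟩ := hξ
  obtain ⟨D', hD', δ, h3, h4, rfl⟩ := hη
  have hDD := mul_ne_zero hD hD'
  have hX0 := zero_X 0
  refine ⟨D * D', hDD, ram D' γ, ram D δ,
    .sub' hX0 (zero_X_pow 1 hD') (isConvergent_X 0) ((isConvergent_X 1).pow _) h1, tPart_sub h2 hD',
    .sub' hX0 (zero_X_pow 1 hD) (isConvergent_X 0) ((isConvergent_X 1).pow _) h3, tPart_sub h4 hD,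
    ?_, ?_⟩
  · rw [ev_ram hD' pos_orderTop_zero (pos_yRoot hDD), yRoot_mul_pow hD']
  · rw [ev_ram hD pos_orderTop_zero (pos_yRoot hDD), mul_comm D D', yRoot_mul_pow hD]

theorem tPart_mul {F G : FPS} (hF : tPart F = F) (hG : tPart G = G) : tPart (F * G) = F * G := by
  rw [tPart, sub_mul' zero_zero (zero_X 1)]
  exact congrArg₂ _ hF hG

theorem tPart_add {F G : FPS} (hF : tPart F = F) (hG : tPart G = G) : tPart (F + G) = F + G := by
  rw [tPart, sub_add' zero_zero (zero_X 1)]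
  exact congrArg₂ _ hF hG

theorem tPart_C (c : ℂ) : tPart (MvPowerSeries.C c) = MvPowerSeries.C c := sub_C c

theorem ConvArc.add {ξ η : K} (hξ : ConvArc ξ) (hη : ConvArc η) : ConvArc (ξ + η) := by
  obtain ⟨D, hD, γ, δ, h1, h2, h3, h4, rfl, rfl⟩ := hξ.exists_common hη
  exact ⟨D, hD, γ + δ, h1.add h3, tPart_add h2 h4, (map_add _ _ _).symm⟩

theorem ConvArc.mul {ξ η : K} (hξ : ConvArc ξ) (hη : ConvArc η) : ConvArc (ξ * η) := by
  obtain ⟨D, hD, γ, δ, h1, h2, h3, h4, rfl, rfl⟩ := hξ.exists_common hη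
  exact ⟨D, hD, γ * δ, h1.mul h3, tPart_mul h2 h4,
    (ev_mul pos_orderTop_zero (pos_yRoot hD) _ _).symm⟩

theorem convArc_C (c : ℂ) : ConvArc (HahnSeries.C c) :=
  ⟨1, one_ne_zero, MvPowerSeries.C c, isConvergent_C c, tPart_C c,
    (ev_C pos_orderTop_zero (pos_yRoot one_ne_zero) c).symm⟩

/-- The ring of convergent fractional power series. -/
def convArcs : Subring K where
  carrier := {ξ | ConvArc ξ}
  mul_mem' := ConvArc.mul
  one_mem' := by
    have := convArc_C 1
    rwa [map_one] at this
  add_mem' := ConvArc.add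
  zero_mem' := by
    have := convArc_C 0
    rwa [map_zero] at this
  neg_mem' := by
    intro ξ hξ
    have e : HahnSeries.C (-1 : ℂ) * ξ = -ξ := by simp
    rw [← e]
    exact (convArc_C (-1)).mul hξ

theorem ConvArc.isArc {ξ : K} (h : ConvArc ξ) : IsArc ξ := by
  obtain ⟨D, hD, γ, -, -, rfl⟩ := h
  refine ⟨D, Nat.pos_of_ne_zero hD, fun e he => ?_⟩
  by_contra hn
  push Not at hn
  refine he (coeff_ev_of_ne (pos_one_div hD) γ fun n h => hn n ?_)
  rw [h]
  field_simp

/-- The series in `y` that a power series of the form `w(y)` represents. -/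
def row (w : FPS) : K := HahnSeries.ofPowerSeries ℚ ℂ (PowerSeries.mk fun j => cc w 0 j)

theorem coeff_row_nat (w : FPS) (n : ℕ) : (row w).coeff n = cc w 0 n := by
  rw [row, HahnSeries.ofPowerSeries_apply_coeff, PowerSeries.coeff_mk]

theorem coeff_row_of_ne (w : FPS) {e : ℚ} (he : ∀ n : ℕ, e ≠ n) : (row w).coeff e = 0 := by
  rw [row, HahnSeries.ofPowerSeries_apply]
  refine HahnSeries.embDomain_of_notMem_range ?_
  rintro ⟨n, hn⟩
  exact he n hn.symm

theorem row_eq_iff {w : FPS} {ξ : K} :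
    row w = ξ ↔ (∀ n : ℕ, ξ.coeff n = cc w 0 n) ∧ ∀ e : ℚ, (∀ n : ℕ, e ≠ n) → ξ.coeff e = 0 := by
  constructor
  · rintro rfl
    exact ⟨coeff_row_nat w, fun e he => coeff_row_of_ne w he⟩
  · rintro ⟨h1, h2⟩
    ext e
    by_cases he : ∃ n : ℕ, e = n
    · obtain ⟨n, rfl⟩ := he
      rw [coeff_row_nat, h1]
    · push Not at he
      rw [coeff_row_of_ne w he, h2 e he]

theorem ev_eq_row {w : FPS} (h : tPart w = w) {ξ : K} (hξ : 0 < ξ.orderTop) :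
    ev ξ (HahnSeries.single 1 1) w = row w := by
  rw [ev_of_tPart h hξ (pos_orderTop_single one_pos), eq_comm, row_eq_iff]
  refine ⟨fun n => ?_, fun e he => coeff_ev_of_ne one_pos w fun n => by rw [mul_one]; exact he n⟩
  have := coeff_ev_mul one_pos w n
  rwa [mul_one] at this

/-- Invariance leaves only integral exponents. The coefficient of y^n is the one of t^{Dn}, so the
bound with R for γ becomes one with R^D. -/
theorem ConvArc.exists_row {ξ : K} (h : ConvArc ξ) (hχ : twist expChar ξ = ξ) :
    ∃ w, IsConvergent w ∧ tPart w = w ∧ row w = ξ := by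
  obtain ⟨D, hD, γ, hc, -, rfl⟩ := h
  have hn (n : ℕ) : (ev 0 (yRoot D) γ).coeff n = cc γ 0 (D * n) := by
    rw [← coeff_ev_mul (pos_one_div hD) γ (D * n)]
    congr 1
    push_cast
    field_simp
  refine ⟨mkcc fun i j => if i = 0 then cc γ 0 (D * j) else 0, ?_, ?_, ?_⟩
  · obtain ⟨M, R, hM, hR, h⟩ := hc.exists_cc
    refine .of_cc ⟨M, R ^ D, fun i j => ?_⟩
    rw [cc_mkcc]
    split_ifs
    · refine (h _ _).trans ?_
      rw [← pow_mul]
      refine mul_le_mul_of_nonneg_left (pow_le_pow_right₀ hR ?_) (by positivity)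
      rw [mul_add, zero_add]
      exact Nat.le_add_left _ _
    · rw [norm_zero]
      positivity
  · refine tPart_of_cc fun i j hi => ?_
    rw [cc_mkcc, if_neg hi]
  · rw [row_eq_iff]
    refine ⟨fun n => by rw [hn, cc_mkcc, if_pos rfl], fun e he => ?_⟩
    by_contra hne
    have h1 := congrArg (fun x => x.coeff e) hχ
    simp only [coeff_twist] at h1
    have h2 : expChar e = 1 := mul_right_cancel₀ hne (by rw [one_mul]; convert h1 using 1)
    obtain ⟨z, rfl⟩ := expChar_eq_one h2
    have h3 : ∃ n : ℕ, (z : ℚ) = n * (1 / D) := by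
      by_contra h3
      push Not at h3
      exact hne (coeff_ev_of_ne (pos_one_div hD) γ h3)
    obtain ⟨n, h3⟩ := h3
    have h4 : (0 : ℤ) ≤ z := by
      have : (0 : ℚ) ≤ z := by rw [h3]; positivity
      exact_mod_cast this
    obtain ⟨m, rfl⟩ := Int.eq_ofNat_of_zero_le h4
    exact he m (by simp)

/-! ### Polynomials in `x` that are convergent power series -/

theorem IsGermOf.coeff_eq {P : K[X]} {F : Conv} (h : IsGermOf P F) (i : ℕ) :
    P.coeff i = row (mkcc fun k j => if k = 0 then cc F.1 i j else 0) := by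
  rw [h i, row]
  congr 1
  ext j
  simp only [PowerSeries.coeff_mk, cc_mkcc, if_pos]
  rfl

theorem IsGermOf.cc_eq_zero {P : K[X]} {F : Conv} (h : IsGermOf P F) {i : ℕ}
    (hi : P.natDegree < i) (j : ℕ) : cc F.1 i j = 0 := by
  have h1 := h.coeff_eq i
  rw [Polynomial.coeff_eq_zero_of_natDegree_lt hi] at h1
  have h2 := congrArg (fun x => x.coeff (j : ℚ)) h1
  simp only [coeff_row_nat, cc_mkcc, if_pos, HahnSeries.coeff_zero] at h2
  exact h2.symm

theorem IsGermOf.unique {P : K[X]} {F G : Conv} (hF : IsGermOf P F) (hG : IsGermOf P G) :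
    F = G := by
  refine Subtype.ext (ext_cc fun i j => ?_)
  have h := (hF i).symm.trans (hG i)
  have h1 := congrArg (PowerSeries.coeff j) (HahnSeries.ofPowerSeries_injective h)
  rwa [PowerSeries.coeff_mk, PowerSeries.coeff_mk] at h1

theorem cc_sum {ι : Type*} (s : Finset ι) (F : ι → FPS) (i j : ℕ) :
    cc (∑ k ∈ s, F k) i j = ∑ k ∈ s, cc (F k) i j := map_sum _ _ _

theorem cc_sum_X_pow_mul {w : ℕ → FPS} (hw : ∀ k, tPart (w k) = w k) (n i j : ℕ) :
    cc (∑ k ∈ Finset.range n, MvPowerSeries.X 0 ^ k * w k) i j =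
      if i < n then cc (w i) 0 j else 0 := by
  have h (k : ℕ) : cc (MvPowerSeries.X 0 ^ k * w k) i j = if k = i then cc (w k) 0 j else 0 := by
    rw [cc_X_zero_pow_mul]
    by_cases h1 : k = i
    · rw [if_pos h1.le, if_pos h1, h1, Nat.sub_self]
    · rw [if_neg h1]
      split_ifs with h2
      · exact cc_of_tPart (hw k) (by omega) j
      · rfl
  rw [cc_sum]
  simp only [h, Finset.sum_ite_eq', Finset.mem_range]

theorem tPart_mkcc (a : ℕ → ℂ) : tPart (mkcc fun k j => if k = 0 then a j else 0) =
    mkcc fun k j => if k = 0 then a j else 0 :=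
  tPart_of_cc fun i j hi => by rw [cc_mkcc, if_neg hi]

theorem IsGermOf.eq_sum {P : K[X]} {F : Conv} (h : IsGermOf P F) :
    F.1 = ∑ i ∈ Finset.range (P.natDegree + 1), MvPowerSeries.X 0 ^ i *
      mkcc fun k j => if k = 0 then cc F.1 i j else 0 := by
  refine ext_cc fun i j => ?_
  rw [cc_sum_X_pow_mul fun k => tPart_mkcc _, cc_mkcc, if_pos rfl]
  split_ifs with hi
  · rfl
  · exact h.cc_eq_zero (by omega) j

theorem IsGermOf.evalArc_eq {P : K[X]} {F : Conv} (h : IsGermOf P F) {ξ : K}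
    (hξ : 0 < ξ.orderTop) : evalArc F ξ = P.eval ξ := by
  have hy := pos_orderTop_single one_pos
  rw [evalArc_eq_ev, h.eq_sum, map_sum, Polynomial.eval_eq_sum_range]
  refine Finset.sum_congr rfl fun i _ => ?_
  rw [ev_mul hξ hy, ev_eq_row (tPart_mkcc _) hξ, ← h.coeff_eq, mul_comm]
  congr 1
  change evHom hξ hy _ = _
  rw [map_pow]
  exact congrArg (· ^ i) (ev_X_zero hξ hy)

theorem exists_isGermOf {P : K[X]}
    (h : ∀ i, ∃ w, IsConvergent w ∧ tPart w = w ∧ row w = P.coeff i) : ∃ F, IsGermOf P F := by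
  choose w h1 h2 h3 using h
  have hc : IsConvergent (∑ k ∈ Finset.range (P.natDegree + 1), MvPowerSeries.X 0 ^ k * w k) :=
    convergentSubring.sum_mem fun k _ => ((isConvergent_X 0).pow k).mul (h1 k)
  refine ⟨⟨_, hc⟩, fun i => ?_⟩
  rw [← h3, row]
  congr 2
  ext j
  change _ = cc _ i j
  rw [cc_sum_X_pow_mul h2]
  split_ifs with hi
  · rfl
  · have h4 := h3 i
    rw [Polynomial.coeff_eq_zero_of_natDegree_lt (by omega)] at h4
    have h5 := (row_eq_iff.1 h4).1 j
    rw [← h5, HahnSeries.coeff_zero]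

theorem cc_mul (F G : FPS) (i j : ℕ) :
    cc (F * G) i j = ∑ p ∈ Finset.HasAntidiagonal.antidiagonal i, ∑ q ∈ Finset.HasAntidiagonal.antidiagonal j,
      cc F p.1 q.1 * cc G p.2 q.2 := by
  rw [cc, MvPowerSeries.coeff_mul, ← Finset.sum_product']
  refine Finset.sum_nbij' (fun n => ((n.1 0, n.2 0), (n.1 1, n.2 1)))
    (fun p => (mon p.1.1 p.2.1, mon p.1.2 p.2.2)) ?_ ?_ ?_ ?_ ?_
  · rintro ⟨m, n⟩ h
    rw [Finset.HasAntidiagonal.mem_antidiagonal] at h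
    have h0 := DFunLike.congr_fun h 0
    have h1 := DFunLike.congr_fun h 1
    simp only [Finsupp.add_apply, mon_apply_zero, mon_apply_one] at h0 h1
    simp [h0, h1]
  · rintro ⟨⟨a, b⟩, ⟨c, d⟩⟩ h
    simp only [Finset.mem_product, Finset.HasAntidiagonal.mem_antidiagonal] at h ⊢
    rw [mon_add, h.1, h.2]
  · rintro ⟨m, n⟩ _
    simp only [← eq_mon]
  · rintro ⟨⟨a, b⟩, ⟨c, d⟩⟩ _
    simp only [mon_apply_zero, mon_apply_one]
  · rintro ⟨m, n⟩ _
    simp only [coeff_eq_cc]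

theorem IsGermOf.mul {P Q : K[X]} {F G : Conv} (hF : IsGermOf P F) (hG : IsGermOf Q G) :
    IsGermOf (P * Q) (F * G) := by
  intro i
  rw [Polynomial.coeff_mul]
  simp only [hF _, hG _, ← map_mul]
  rw [← map_sum]
  congr 1
  ext j
  rw [map_sum, PowerSeries.coeff_mk]
  simp only [PowerSeries.coeff_mul, PowerSeries.coeff_mk]
  exact (cc_mul F.1 G.1 i j).symm

theorem isGermOf_one : IsGermOf 1 1 := by
  intro i
  have h : row (mkcc fun k j => if k = 0 then cc 1 i j else 0) = (1 : K[X]).coeff i := by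
    rw [row_eq_iff]
    simp only [Polynomial.coeff_one, cc_mkcc, cc_one, if_pos]
    refine ⟨fun n => ?_, fun e he => ?_⟩
    · by_cases hi : i = 0
      · simp [hi, HahnSeries.coeff_one]
      · simp [hi]
    · by_cases hi : i = 0
      · have := he 0
        rw [Nat.cast_zero] at this
        simp [hi, HahnSeries.coeff_one, this]
      · simp [hi]
  rw [← h, row]
  congr 1
  ext j
  rw [PowerSeries.coeff_mk, PowerSeries.coeff_mk, cc_mkcc, if_pos rfl]
  rfl

/-- The polynomial with the given roots. -/
abbrev rootPoly (R : Multiset K) : K[X] :=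
  (R.map fun ξ => Polynomial.X - Polynomial.C ξ).prod

theorem coeff_rootPoly_mem {R : Multiset K} (h : ∀ ξ ∈ R, ConvArc ξ) (i : ℕ) :
    ConvArc ((rootPoly R).coeff i) := by
  suffices h : ∀ i, (rootPoly R).coeff i ∈ convArcs from h i
  induction R using Multiset.induction_on with
  | empty =>
    intro i
    rw [rootPoly, Multiset.map_zero, Multiset.prod_zero, Polynomial.coeff_one]
    split_ifs
    · exact convArcs.one_mem
    · exact convArcs.zero_mem
  | cons ξ R ih =>
    intro i
    have ih := ih fun η hη => h η (Multiset.mem_cons_of_mem hη)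
    rw [rootPoly, Multiset.map_cons, Multiset.prod_cons, Polynomial.coeff_mul]
    refine convArcs.sum_mem fun p _ => convArcs.mul_mem ?_ (ih _)
    rw [Polynomial.coeff_sub, Polynomial.coeff_X, Polynomial.coeff_C]
    refine convArcs.sub_mem ?_ ?_
    · split_ifs
      · exact convArcs.one_mem
      · exact convArcs.zero_mem
    · split_ifs
      · exact h ξ (Multiset.mem_cons_self ξ R)
      · exact convArcs.zero_mem

theorem rootPoly_map (R : Multiset K) (φ : K →+* K) :
    (rootPoly R).map φ = rootPoly (R.map φ) := by
  rw [rootPoly, Polynomial.map_multiset_prod, Multiset.map_map, rootPoly, Multiset.map_map]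
  simp

/-- The automorphism permutes the roots and so fixes the coefficients of their polynomial. A
convergent fractional series fixed by it is a convergent series in y. -/
theorem exists_isGermOf_rootPoly {R : Multiset K} (h : ∀ ξ ∈ R, ConvArc ξ)
    (ht : R.map (twist expChar) = R) : ∃ F, IsGermOf (rootPoly R) F := by
  refine exists_isGermOf fun i => (coeff_rootPoly_mem h i).exists_row ?_
  rw [← Polynomial.coeff_map, rootPoly_map, ht]

theorem pderiv_ram {D : ℕ} (hD : D ≠ 0) (F : FPS) (k : ℕ) :
    (MvPowerSeries.pderiv ℂ 0)^[k] (ram D F) = ram D ((MvPowerSeries.pderiv ℂ 0)^[k] F) := by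
  induction k with
  | zero => rfl
  | succ k ih =>
    rw [Function.iterate_succ_apply', ih, Function.iterate_succ_apply']
    refine ext_cc fun i j => ?_
    rw [cc_pderiv_zero, cc_ram hD, cc_ram hD, cc_pderiv_zero]
    split_ifs <;> simp

theorem dx_iterate_val (F : Conv) (k : ℕ) :
    (dx^[k] F).1 = (MvPowerSeries.pderiv ℂ 0)^[k] F.1 := by
  induction k with
  | zero => rfl
  | succ k ih =>
    rw [Function.iterate_succ_apply', Function.iterate_succ_apply', ← ih]
    rfl

/-- Multiplicities may be computed after ramification: ∂/∂x commutes with y ↦ t^D, and evaluating t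
at y^{1/D} restores y. -/
theorem rootMult_eq {F : Conv} {ξ : K} (hξ : 0 < ξ.orderTop) {D m : ℕ} (hD : D ≠ 0)
    (h : ExactOrder (evHom hξ (pos_yRoot hD)) m (ram D F.1)) : rootMult F ξ = m := by
  have key (k : ℕ) : evHom hξ (pos_yRoot hD) ((MvPowerSeries.pderiv ℂ 0)^[k] (ram D F.1)) =
      evalArc (dx^[k] F) ξ := by
    rw [pderiv_ram hD, evalArc_eq_ev, dx_iterate_val, ← yRoot_pow hD,
      ← ev_ram hD hξ (pos_yRoot hD)]
    rfl
  have hm : m ∈ {k | evalArc (dx^[k] F) ξ ≠ 0} := by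
    rw [Set.mem_ofPred_eq, ← key]
    exact h.2
  refine le_antisymm (Nat.sInf_le hm) ?_
  by_contra hlt
  have h1 : rootMult F ξ ∈ {k | evalArc (dx^[k] F) ξ ≠ 0} := Nat.sInf_mem ⟨m, hm⟩
  rw [Set.mem_ofPred_eq, ← key, h.1 _ (not_le.1 hlt)] at h1
  exact h1 rfl

theorem twist_evalArc {χ : AddChar ℚ ℂ} (hχ : χ 1 = 1) (F : Conv) {ξ : K} (hξ : 0 < ξ.orderTop) :
    evalArc F (twist χ ξ) = twist χ (evalArc F ξ) := by
  rw [evalArc_eq_ev, evalArc_eq_ev, twist_ev hξ (pos_orderTop_single one_pos), twist_single, hχ,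
    one_mul]

theorem twist_eq_zero {χ : AddChar ℚ ℂ} {x : K} : twist χ x = 0 ↔ x = 0 :=
  map_eq_zero_iff _ (twist_injective χ)

theorem rootMult_twist {χ : AddChar ℚ ℂ} (hχ : χ 1 = 1) (F : Conv) {ξ : K}
    (hξ : 0 < ξ.orderTop) : rootMult F (twist χ ξ) = rootMult F ξ := by
  unfold rootMult
  congr 1
  ext k
  rw [Set.mem_ofPred_eq, Set.mem_ofPred_eq, twist_evalArc hχ _ hξ, Ne, Ne, twist_eq_zero]

/-- A ramified unit factor descends. -/
theorem ram_descend {D : ℕ} (hD : D ≠ 0) {F W u : FPS} (hW : W ≠ 0) (h : ram D F = u * ram D W) :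
    ∃ v, u = ram D v ∧ F = v * W := by
  have hinj : ∀ A B : FPS, ram D A = ram D B → A = B := by
    intro A B hAB
    refine ext_cc fun i j => ?_
    have := congrArg (fun G => cc G i (D * j)) hAB
    simpa only [cc_ram hD, dvd_mul_right, if_pos, Nat.mul_div_cancel_left _
      (Nat.pos_of_ne_zero hD)] using this
  -- The series in x and t^D are those fixed by t ↦ ζt. The factor u is a quotient of two such
  -- series, hence fixed as well.
  obtain ⟨ζ, hζ⟩ : ∃ ζ : ℂ, IsPrimitiveRoot ζ D := ⟨_, Complex.isPrimitiveRoot_exp D hD⟩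
  have hcc (G : FPS) (i j : ℕ) : cc (MvPowerSeries.rescale ![1, ζ] G) i j = ζ ^ j * cc G i j := by
    rw [cc, MvPowerSeries.coeff_rescale, ← cc]
    congr 1
    rw [Finsupp.prod_fintype _ _ (fun _ => pow_zero _), Fin.prod_univ_two, mon_apply_zero,
      mon_apply_one]
    simp
  have hfix (G : FPS) : MvPowerSeries.rescale ![1, ζ] (ram D G) = ram D G := by
    refine ext_cc fun i j => ?_
    rw [hcc, cc_ram hD]
    split_ifs with hj
    · rw [(hζ.pow_eq_one_iff_dvd j).2 hj, one_mul]
    · rw [mul_zero]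
  have hW' : ram D W ≠ 0 := by
    intro h0
    refine hW (hinj _ _ (h0.trans ?_))
    exact (sub_zero' (zero_X 0) (zero_X_pow 1 hD)).symm
  have hu : MvPowerSeries.rescale ![1, ζ] u = u := by
    refine mul_right_cancel₀ hW' ?_
    rw [← h, ← hfix F, h, map_mul, hfix]
  have e : u = ram D (mkcc fun i j => cc u i (D * j)) := by
    refine ext_cc fun i j => ?_
    rw [cc_ram hD, cc_mkcc]
    split_ifs with hj
    · rw [Nat.mul_div_cancel' hj]
    · have := hcc u i j
      rw [hu] at this
      by_contra hne
      apply hj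
      rw [← hζ.pow_eq_one_iff_dvd]
      exact mul_right_cancel₀ hne (by rw [one_mul]; exact this.symm)
  refine ⟨_, e, hinj _ _ ?_⟩
  rw [h, ram, ram, sub_mul' (zero_X 0) (zero_X_pow 1 hD)]
  congr 1

theorem IsConvergent.of_ram {D : ℕ} (hD : D ≠ 0) {F : FPS} (h : IsConvergent (ram D F)) :
    IsConvergent F := by
  obtain ⟨M, R, hM, hR, h⟩ := h.exists_cc
  refine .of_cc ⟨M, R ^ D, fun i j => ?_⟩
  have h1 := h i (D * j)
  rw [cc_ram hD, if_pos (dvd_mul_right _ _), Nat.mul_div_cancel_left _ (Nat.pos_of_ne_zero hD)] at h1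
  refine h1.trans (mul_le_mul_of_nonneg_left ?_ (by positivity))
  rw [← pow_mul, mul_add]
  exact pow_le_pow_right₀ hR (Nat.add_le_add_right (Nat.le_mul_of_pos_left _
    (Nat.pos_of_ne_zero hD)) _)

theorem exists_X_one_pow_mul_reg {F : FPS} (hF : F ≠ 0) :
    ∃ E d G, F = MvPowerSeries.X 1 ^ E * G ∧ Reg d G := by
  classical
  have h1 : ∃ j i, cc F i j ≠ 0 := by
    by_contra h
    push Not at h
    exact hF (ext_cc fun i j => by rw [h j i, cc_zero])
  have hE := Nat.find_spec h1
  have hE' (j : ℕ) (hj : j < Nat.find h1) (i : ℕ) : cc F i j = 0 := by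
    by_contra h
    exact Nat.find_min h1 hj ⟨i, h⟩
  refine ⟨Nat.find h1, Nat.find hE, mkcc fun i j => cc F i (j + Nat.find h1), ?_, fun i hi => ?_, ?_⟩
  · refine ext_cc fun i j => ?_
    rw [cc_X_one_pow_mul, cc_mkcc]
    split_ifs with hj
    · rw [Nat.sub_add_cancel hj]
    · exact hE' j (not_le.1 hj) i
  · rw [cc_mkcc, zero_add]
    by_contra h
    exact Nat.find_min hE hi h
  · rw [cc_mkcc, zero_add]
    exact Nat.find_spec hE

/-! ### Factorisation of convergent power series by their Newton-Puiseux roots -/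

/-- The factorisation of a convergent power series into a unit, a power of `y` and the monic
polynomial in `x` whose roots are the Newton-Puiseux roots. -/
structure IsFactorization (F : Conv) (E : ℕ) (R : Multiset K) (W : Conv) (u : Convˣ) : Prop where
  eq : F = u * yVar ^ E * W
  germ : IsGermOf (rootPoly R) W
  convArc : ∀ ξ ∈ R, ConvArc ξ
  pos : ∀ ξ ∈ R, 0 < ξ.orderTop
  mult : multiplicity yVar F = E
  count [DecidableEq K] : ∀ ξ : K, 0 < ξ.orderTop → R.count ξ = rootMult F ξ

theorem exists_unit {v : FPS} (hv : IsConvergent v) (h : cc v 0 0 ≠ 0) :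
    ∃ u : Convˣ, (u : Conv).1 = v := by
  rw [cc_zero_zero] at h
  obtain ⟨w, hw, hvw⟩ := exists_convergent_inverse hv h
  exact ⟨⟨⟨v, hv⟩, ⟨w, hw⟩, Subtype.ext hvw, Subtype.ext ((mul_comm _ _).trans hvw)⟩, rfl⟩

theorem ev_zero_injective {D : ℕ} (hD : D ≠ 0) {γ δ : FPS} (hγ : tPart γ = γ) (hδ : tPart δ = δ)
    (h : ev 0 (yRoot D) γ = ev 0 (yRoot D) δ) : γ = δ := by
  refine ext_cc fun i j => ?_
  by_cases hi : i = 0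
  · rw [hi, ← coeff_ev_mul (pos_one_div hD) γ, ← coeff_ev_mul (pos_one_div hD) δ, h]
  · rw [cc_of_tPart hγ hi, cc_of_tPart hδ hi]

/-- The coefficients in x of the product do not involve x, and on such series the evaluation t =
y^{1/D} is injective. The identity is therefore checked coefficientwise in K. -/
theorem ram_eq_prod {D : ℕ} (hD : D ≠ 0) {L : Multiset FPS} (hL : ∀ γ ∈ L, tPart γ = γ) {W : Conv}
    (hW : IsGermOf (rootPoly (L.map (ev 0 (yRoot D)))) W) :
    ram D W.1 = (L.map fun γ => MvPowerSeries.X 0 - γ).prod := by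
  have hX0 := zero_X 0
  have hXD := zero_X_pow 1 hD
  let p : FPS[X] := (L.map fun γ => Polynomial.X - Polynomial.C γ).prod
  have hmap (φ : FPS →+* FPS) (h : ∀ γ ∈ L, φ γ = γ) : p.map φ = p := by
    rw [Polynomial.map_multiset_prod, Multiset.map_map]
    congr 1
    refine Multiset.map_congr rfl fun γ hγ => ?_
    simp [h γ hγ]
  have hp (i : ℕ) : tPart (p.coeff i) = p.coeff i := by
    have := hmap (subHom zero_zero (zero_X 1) : FPS →+* FPS) fun γ hγ =>
      (subHom_apply zero_zero (zero_X 1) γ).trans (hL γ hγ)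
    conv_rhs => rw [← this, Polynomial.coeff_map]
    exact (subHom_apply zero_zero (zero_X 1) _).symm
  have hpm : p.map (evHom pos_orderTop_zero (pos_yRoot hD)) =
      rootPoly (L.map (ev 0 (yRoot D))) := by
    rw [Polynomial.map_multiset_prod, rootPoly, Multiset.map_map, Multiset.map_map]
    congr 1
    refine Multiset.map_congr rfl fun γ hγ => ?_
    rw [Function.comp_apply, Polynomial.map_sub, Polynomial.map_X, Polynomial.map_C]
    rfl
  have hcoeff (i : ℕ) : p.coeff i = ram D (mkcc fun k j => if k = 0 then cc W.1 i j else 0) := by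
    refine ev_zero_injective hD (hp i) (tPart_sub (tPart_mkcc _) hD) ?_
    rw [ev_ram hD pos_orderTop_zero (pos_yRoot hD), yRoot_pow hD,
      ev_eq_row (tPart_mkcc _) pos_orderTop_zero, ← hW.coeff_eq, ← hpm, Polynomial.coeff_map]
    rfl
  have hdeg : (rootPoly (L.map (ev 0 (yRoot D)))).natDegree = p.natDegree := by
    have h1 : p.Monic := Polynomial.monic_multiset_prod_of_monic _ _
      fun γ _ => Polynomial.monic_X_sub_C γ
    rw [← hpm, h1.natDegree_map]
  have hev : (L.map fun γ => MvPowerSeries.X 0 - γ).prod = p.eval (MvPowerSeries.X 0) := by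
    rw [Polynomial.eval_multiset_prod, Multiset.map_map]
    congr 1
    refine Multiset.map_congr rfl fun γ _ => ?_
    simp
  rw [hev, Polynomial.eval_eq_sum_range, hW.eq_sum, ram, ← subHom_apply hX0 hXD, map_sum,
    hdeg]
  refine Finset.sum_congr rfl fun i _ => ?_
  rw [subHom_apply, sub_mul' hX0 hXD, sub_pow' hX0 hXD, sub_X_zero hX0 hXD, hcoeff, mul_comm]

/-- Remove the power of y, split after a ramification, and descend. The multiset of roots is stable
under conjugation because its counts are the multiplicities `rootMult`, which are invariant, so the
monic factor lies in ℂ{x,y}. The unit factor descends by `ram_descend`. -/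
theorem exists_factorization {F : Conv} (hF : F ≠ 0) :
    ∃ E R W u, IsFactorization F E R W u := by
  classical
  have hX0 := zero_X 0
  obtain ⟨E, d, G, hG, hreg⟩ := exists_X_one_pow_mul_reg (F := F.1) fun h => hF (Subtype.ext h)
  have hGc : IsConvergent G := IsConvergent.of_X_one_pow_mul (n := E) (by rw [← hG]; exact F.2)
  obtain ⟨D, hD, L, hL, u, hu, hu0, he⟩ := exists_split d G hGc hreg
  have hXD := zero_X_pow 1 hD
  obtain ⟨R, hR⟩ : ∃ R : Multiset K, R = L.map (ev 0 (yRoot D)) := ⟨_, rfl⟩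
  have hconv : ∀ ξ ∈ R, ConvArc ξ := by
    intro ξ hξ
    rw [hR, Multiset.mem_map] at hξ
    obtain ⟨γ, hγ, rfl⟩ := hξ
    exact ⟨D, hD, γ, (hL γ hγ).1, (hL γ hγ).2.2, rfl⟩
  have hpos : ∀ ξ ∈ R, 0 < ξ.orderTop := by
    intro ξ hξ
    rw [hR, Multiset.mem_map] at hξ
    obtain ⟨γ, hγ, rfl⟩ := hξ
    exact pos_orderTop_ev pos_orderTop_zero (pos_yRoot hD) (hL γ hγ).2.1
  have hFe : ram D F.1 = (MvPowerSeries.X 1 ^ (D * E) * u) *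
      (L.map fun γ => MvPowerSeries.X 0 - γ).prod := by
    rw [hG, ram, sub_mul' hX0 hXD, show sub (MvPowerSeries.X 0) (MvPowerSeries.X 1 ^ D) G = _ from he,
      sub_pow' hX0 hXD, sub_X_one hX0 hXD, ← pow_mul, mul_assoc]
  have hcount : ∀ ξ : K, 0 < ξ.orderTop → R.count ξ = rootMult F ξ := by
    intro ξ hξ
    have h0 : evHom hξ (pos_yRoot hD) (MvPowerSeries.X 1 ^ (D * E) * u) ≠ 0 := by
      rw [map_mul, map_pow]
      refine mul_ne_zero (pow_ne_zero _ ?_) ?_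
      · rw [show evHom hξ (pos_yRoot hD) (MvPowerSeries.X 1) = _ from ev_X_one hξ (pos_yRoot hD)]
        exact HahnSeries.single_ne_zero one_ne_zero
      · refine (hasLead_ev_zero hξ (pos_yRoot hD) u).ne_zero ?_
        rwa [← cc_zero_zero]
    have h1 := exactOrder_prod (ev_X_zero hξ (pos_yRoot hD)) h0 fun γ hγ => (hL γ hγ).2.2
    rw [← hFe] at h1
    have h2 : L.map (evHom hξ (pos_yRoot hD)) = R := by
      rw [hR]
      exact Multiset.map_congr rfl fun γ hγ => ev_of_tPart (hL γ hγ).2.2 hξ (pos_yRoot hD)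
    rw [rootMult_eq hξ hD h1, h2]
  have htwist : R.map (twist expChar) = R := by
    refine Multiset.ext.2 fun ξ => ?_
    rw [← twist_twist_inv expChar ξ, Multiset.count_map_eq_count' _ _ (twist_injective _)]
    by_cases hξ : 0 < ξ.orderTop
    · have hξ' : 0 < (twist expChar⁻¹ ξ).orderTop := by rwa [orderTop_twist]
      rw [hcount _ hξ', hcount _ (by rwa [orderTop_twist]), rootMult_twist expChar_one F hξ']
    · rw [Multiset.count_eq_zero_of_notMem, Multiset.count_eq_zero_of_notMem]
      · intro h
        have := hpos _ h
        rw [orderTop_twist, orderTop_twist] at this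
        exact hξ this
      · intro h
        have := hpos _ h
        rw [orderTop_twist] at this
        exact hξ this
  obtain ⟨W, hW⟩ := exists_isGermOf_rootPoly hconv htwist
  have hram := ram_eq_prod hD (fun γ hγ => (hL γ hγ).2.2) (hR ▸ hW)
  have hW0 : W.1 ≠ 0 := by
    intro h0
    rw [h0, ram, sub_zero' hX0 hXD] at hram
    rw [← hram, mul_zero] at he
    have h1 := cc_ram_zero hD G d
    rw [he, cc_zero] at h1
    exact hreg.2 h1.symm
  obtain ⟨v, hv, hGv⟩ := ram_descend hD hW0 (he.trans (by rw [hram]))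
  have hv0 : cc v 0 0 ≠ 0 := by
    rw [← cc_ram_zero hD, ← hv]
    exact hu0
  obtain ⟨w, hw⟩ := exists_unit (IsConvergent.of_ram hD (by rwa [← hv])) hv0
  refine ⟨E, R, W, w, ?_, hW, hconv, hpos, ?_, fun ξ hξ => ?_⟩
  · refine Subtype.ext ?_
    rw [hG, hGv]
    change _ = (w : Conv).1 * MvPowerSeries.X 1 ^ E * W.1
    rw [hw]
    ring
  · refine multiplicity_eq_of_dvd_of_not_dvd ⟨⟨G, hGc⟩, Subtype.ext hG⟩ ?_
    rintro ⟨H, hH⟩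
    have h1 : F.1 = MvPowerSeries.X 1 ^ (E + 1) * H.1 := congrArg Subtype.val hH
    have h2 := cc_X_one_pow_mul E G d E
    have h3 := cc_X_one_pow_mul (E + 1) H.1 d E
    rw [← hG, if_pos le_rfl, Nat.sub_self] at h2
    rw [← h1, if_neg (by omega), h2] at h3
    exact hreg.2 h3
  · rw [← hcount ξ hξ]
    congr!

theorem evalArc_mul {ξ : K} (hξ : 0 < ξ.orderTop) (F G : Conv) :
    evalArc (F * G) ξ = evalArc F ξ * evalArc G ξ :=
  ev_mul hξ (pos_orderTop_single one_pos) F.1 G.1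

theorem evalArc_zero (ξ : K) : evalArc 0 ξ = 0 := map_zero (ev ξ (HahnSeries.single 1 1))

theorem evalArc_yVar_pow {ξ : K} (hξ : 0 < ξ.orderTop) (n : ℕ) :
    evalArc (yVar ^ n) ξ = HahnSeries.single (n : ℚ) 1 := by
  have h : evalArc (yVar ^ n) ξ = evalArc yVar ξ ^ n :=
    map_pow (evHom hξ (pos_orderTop_single one_pos)) yVar.1 n
  rw [h, show evalArc yVar ξ = HahnSeries.single 1 1 from ev_X_one hξ (pos_orderTop_single one_pos),
    HahnSeries.single_pow, one_pow, nsmul_eq_mul, mul_one]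

theorem constantCoeff_unit_ne_zero (u : Convˣ) : MvPowerSeries.constantCoeff (u : Conv).1 ≠ 0 :=
  (u.isUnit.map ((MvPowerSeries.constantCoeff (σ := Fin 2) (R := ℂ)).comp
    convergentSubring.subtype)).ne_zero

theorem hasLead_evalArc_unit (u : Convˣ) {ξ : K} (hξ : 0 < ξ.orderTop) :
    HasLead (evalArc u ξ) 0 (MvPowerSeries.constantCoeff (u : Conv).1) :=
  hasLead_ev_zero hξ (pos_orderTop_single one_pos) _

theorem evalArc_unit_ne_zero (u : Convˣ) {ξ : K} (hξ : 0 < ξ.orderTop) : evalArc u ξ ≠ 0 :=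
  (hasLead_evalArc_unit u hξ).ne_zero (constantCoeff_unit_ne_zero u)

theorem eval_rootPoly (R : Multiset K) (ξ : K) :
    (rootPoly R).eval ξ = (R.map fun η => ξ - η).prod := by
  rw [rootPoly, Polynomial.eval_multiset_prod, Multiset.map_map]
  simp

theorem eval_rootPoly_eq_zero {R : Multiset K} {ξ : K} : (rootPoly R).eval ξ = 0 ↔ ξ ∈ R := by
  rw [eval_rootPoly, Multiset.prod_eq_zero_iff, Multiset.mem_map]
  constructor
  · rintro ⟨η, hη, h⟩
    rwa [sub_eq_zero.1 h]
  · exact fun h => ⟨ξ, h, sub_self ξ⟩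

theorem rootPoly_add (R S : Multiset K) : rootPoly (R + S) = rootPoly R * rootPoly S := by
  rw [rootPoly, Multiset.map_add, Multiset.prod_add]

namespace IsFactorization

variable {F W : Conv} {E : ℕ} {R : Multiset K} {u : Convˣ}

theorem evalArc_eq (h : IsFactorization F E R W u) {ξ : K} (hξ : 0 < ξ.orderTop) :
    evalArc F ξ = evalArc u ξ * HahnSeries.single (E : ℚ) 1 * (R.map fun η => ξ - η).prod := by
  conv_lhs => rw [h.eq]
  rw [evalArc_mul hξ, evalArc_mul hξ, evalArc_yVar_pow hξ, h.germ.evalArc_eq hξ, eval_rootPoly]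

theorem evalArc_eq_zero (h : IsFactorization F E R W u) {ξ : K} (hξ : 0 < ξ.orderTop) :
    evalArc F ξ = 0 ↔ ξ ∈ R := by
  rw [h.evalArc_eq hξ, ← eval_rootPoly, ← eval_rootPoly_eq_zero (R := R), mul_eq_zero,
    or_iff_right]
  exact mul_ne_zero (evalArc_unit_ne_zero u hξ) (HahnSeries.single_ne_zero one_ne_zero)

theorem isRoot_iff (h : IsFactorization F E R W u) {ξ : K} : IsRoot F ξ ↔ ξ ∈ R :=
  ⟨fun hξ => (h.evalArc_eq_zero hξ.2.1).1 hξ.2.2,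
    fun hξ => ⟨(h.convArc ξ hξ).isArc, h.pos ξ hξ, (h.evalArc_eq_zero (h.pos ξ hξ)).2 hξ⟩⟩

theorem map_twist (h : IsFactorization F E R W u) {χ : AddChar ℚ ℂ} (hχ : χ 1 = 1) :
    R.map (twist χ) = R := by
  classical
  refine Multiset.ext.2 fun ξ => ?_
  rw [← twist_twist_inv χ ξ, Multiset.count_map_eq_count' _ _ (twist_injective _)]
  by_cases hξ : 0 < ξ.orderTop
  · have hξ' : 0 < (twist χ⁻¹ ξ).orderTop := by rwa [orderTop_twist]
    rw [h.count _ hξ', h.count _ (by rwa [orderTop_twist]), rootMult_twist hχ F hξ']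
  · rw [Multiset.count_eq_zero_of_notMem, Multiset.count_eq_zero_of_notMem]
    · intro hm
      have := h.pos _ hm
      rw [orderTop_twist, orderTop_twist] at this
      exact hξ this
    · intro hm
      have := h.pos _ hm
      rw [orderTop_twist] at this
      exact hξ this

/-- A sub-multiset of roots that is stable under conjugation splits off as a factor. -/
theorem exists_split (h : IsFactorization F E R W u) {S T : Multiset K} (hR : R = S + T)
    (hS : S.map (twist expChar) = S) : ∃ W₁ W₂, IsGermOf (rootPoly S) W₁ ∧
      IsGermOf (rootPoly T) W₂ ∧ F = u * yVar ^ E * (W₁ * W₂) := by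
  have hT : T.map (twist expChar) = T := by
    have := h.map_twist expChar_one
    rw [hR, Multiset.map_add, hS] at this
    exact add_left_cancel this
  obtain ⟨W₁, h1⟩ := exists_isGermOf_rootPoly
    (fun ξ hξ => h.convArc ξ (by rw [hR]; exact Multiset.mem_add.2 (.inl hξ))) hS
  obtain ⟨W₂, h2⟩ := exists_isGermOf_rootPoly
    (fun ξ hξ => h.convArc ξ (by rw [hR]; exact Multiset.mem_add.2 (.inr hξ))) hT
  refine ⟨W₁, W₂, h1, h2, ?_⟩
  have h3 := h1.mul h2
  rw [← rootPoly_add, ← hR] at h3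
  rw [← h.germ.unique h3]
  exact h.eq

end IsFactorization

theorem finite_isRoot {F : Conv} (hF : F ≠ 0) : {ξ | IsRoot F ξ}.Finite := by
  classical
  obtain ⟨E, R, W, u, h⟩ := exists_factorization hF
  refine R.toFinset.finite_toSet.subset fun ξ hξ => ?_
  rw [Finset.mem_coe, Multiset.mem_toFinset]
  exact h.isRoot_iff.1 hξ

theorem IsRoot.twist {χ : AddChar ℚ ℂ} (hχ : χ 1 = 1) {F : Conv} {ξ : K} (h : IsRoot F ξ) :
    IsRoot F (twist χ ξ) :=
  ⟨isArc_twist.2 h.1, by rw [orderTop_twist]; exact h.2.1,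
    by rw [twist_evalArc hχ F h.2.1, h.2.2, map_zero]⟩

theorem inv_char_one {χ : AddChar ℚ ℂ} (hχ : χ 1 = 1) : χ⁻¹ 1 = 1 := by
  have h : χ⁻¹ 1 * χ 1 = 1 := by
    rw [← AddChar.mul_apply, inv_mul_cancel, AddChar.one_apply]
  rwa [hχ, mul_one] at h

theorem not_isUnit_of_isGermOf {S : Multiset K} {W : Conv} (h : IsGermOf (rootPoly S) W) {ξ : K}
    (hξ : ξ ∈ S) (hpos : 0 < ξ.orderTop) : ¬ IsUnit W := by
  rintro ⟨u, rfl⟩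
  refine evalArc_unit_ne_zero u hpos ?_
  rw [h.evalArc_eq hpos]
  exact eval_rootPoly_eq_zero.2 hξ

/-! ### Conjugate roots and irreducible power series -/

/-- The conjugates of an arc. -/
def orbit (ξ : K) : Set K := {η | ∃ χ : AddChar ℚ ℂ, χ 1 = 1 ∧ η = twist χ ξ}

theorem self_mem_orbit (ξ : K) : ξ ∈ orbit ξ := ⟨1, by simp, (twist_one ξ).symm⟩

theorem mul_char_one {χ ψ : AddChar ℚ ℂ} (hχ : χ 1 = 1) (hψ : ψ 1 = 1) : (χ * ψ) 1 = 1 := by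
  rw [AddChar.mul_apply, hχ, hψ, one_mul]

/-- The conjugates of a Newton-Puiseux root, as a multiset without repetitions. -/
theorem exists_orbit_multiset {F : Conv} (hF : F ≠ 0) {ξ : K} (h : IsRoot F ξ) :
    ∃ S : Multiset K, S.Nodup ∧ (∀ η, η ∈ S ↔ η ∈ orbit ξ) ∧ S.map (twist expChar) = S := by
  have hfin : (orbit ξ).Finite := (finite_isRoot hF).subset fun η hη => by
    obtain ⟨χ, hχ, rfl⟩ := hη
    exact h.twist hχ
  have hmem (η : K) : η ∈ hfin.toFinset.val ↔ η ∈ orbit ξ := by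
    rw [Finset.mem_val, Set.Finite.mem_toFinset]
  refine ⟨hfin.toFinset.val, hfin.toFinset.nodup, hmem, ?_⟩
  refine Multiset.Nodup.ext (hfin.toFinset.nodup.map (twist_injective _)) hfin.toFinset.nodup |>.2
    fun η => ?_
  rw [Multiset.mem_map, hmem]
  constructor
  · rintro ⟨ζ, hζ, rfl⟩
    obtain ⟨χ, hχ, rfl⟩ := (hmem ζ).1 hζ
    exact ⟨expChar * χ, mul_char_one expChar_one hχ, twist_twist _ _ _⟩
  · rintro ⟨χ, hχ, rfl⟩
    refine ⟨twist (expChar⁻¹ * χ) ξ, (hmem _).2 ⟨_, mul_char_one (inv_char_one expChar_one) hχ, rfl⟩,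
      ?_⟩
    rw [twist_twist, mul_inv_cancel_left]

theorem exists_orbit_factor {F : Conv} (hF : F ≠ 0) {ξ : K} {S : Multiset K} (hS : S.Nodup)
    (hmem : ∀ η, η ∈ S ↔ η ∈ orbit ξ) (ht : S.map (twist expChar) = S) (h : IsRoot F ξ) :
    ∃ W₁ W₂ G, IsGermOf (rootPoly S) W₁ ∧ F = W₁ * (G * W₂) ∧ ∃ T, IsGermOf (rootPoly T) W₂ ∧
      ∀ η, IsRoot F η → η ∈ S ∨ η ∈ T := by
  classical
  obtain ⟨E, R, W, u, hR⟩ := exists_factorization hF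
  have hle : S ≤ R := by
    rw [Multiset.le_iff_subset hS]
    intro η hη
    obtain ⟨χ, hχ, rfl⟩ := (hmem η).1 hη
    exact hR.isRoot_iff.1 (h.twist hχ)
  obtain ⟨T, hT⟩ := Multiset.le_iff_exists_add.1 hle
  obtain ⟨W₁, W₂, h1, h2, h3⟩ := hR.exists_split hT ht
  refine ⟨W₁, W₂, u * yVar ^ E, h1, by rw [h3]; ring, T, h2, fun η hη => ?_⟩
  rw [hR.isRoot_iff, hT, Multiset.mem_add] at hη
  exact hη

/-- The roots of an irreducible power series are conjugate. -/
theorem exists_twist_of_irreducible {p : Conv} (hp : Irreducible p) {ξ η : K} (hξ : IsRoot p ξ)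
    (hη : IsRoot p η) : η ∈ orbit ξ := by
  obtain ⟨S, hS, hmem, ht⟩ := exists_orbit_multiset hp.ne_zero hξ
  obtain ⟨W₁, W₂, G, h1, h2, T, h3, h4⟩ := exists_orbit_factor hp.ne_zero hS hmem ht hξ
  rcases h4 η hη with h5 | h5
  · exact (hmem η).1 h5
  · exfalso
    rcases hp.isUnit_or_isUnit h2 with h6 | h6
    · exact not_isUnit_of_isGermOf h1 ((hmem ξ).2 (self_mem_orbit ξ)) hξ.2.1 h6
    · exact not_isUnit_of_isGermOf h3 h5 hη.2.1 (isUnit_of_mul_isUnit_right h6)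

/-- Every Newton-Puiseux root is a root of an irreducible power series. -/
theorem exists_irreducible {F : Conv} (hF : F ≠ 0) {ξ : K} (h : IsRoot F ξ) :
    ∃ p : Conv, Irreducible p ∧ IsRoot p ξ := by
  obtain ⟨S, hS, hmem, ht⟩ := exists_orbit_multiset hF h
  obtain ⟨p, W₂, G, h1, h2, -⟩ := exists_orbit_factor hF hS hmem ht h
  have hξS := (hmem ξ).2 (self_mem_orbit ξ)
  have hpξ : evalArc p ξ = 0 := by
    rw [h1.evalArc_eq h.2.1]
    exact eval_rootPoly_eq_zero.2 hξS
  have hp0 : p ≠ 0 := by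
    rintro rfl
    rw [zero_mul] at h2
    exact hF h2
  -- The orbit polynomial p divides every nonzero series that vanishes at ξ. In p = ab the factor
  -- vanishing at ξ absorbs all of p, and the other factor is a unit.
  have key (a b : Conv) (hab : p = a * b) (ha : evalArc a ξ = 0) : IsUnit b := by
    have ha0 : a ≠ 0 := by
      rintro rfl
      rw [zero_mul] at hab
      exact hp0 hab
    obtain ⟨p', W₂', G', h1', h2', -⟩ := exists_orbit_factor ha0 hS hmem ht ⟨h.1, h.2.1, ha⟩
    rw [← h1.unique h1'] at h2'
    rw [h2', mul_assoc] at hab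
    have h3 : p * 1 = p * (G' * W₂' * b) := by rw [mul_one]; exact hab
    exact .of_mul_eq_one_right _ (mul_left_cancel₀ hp0 h3).symm
  refine ⟨p, ⟨not_isUnit_of_isGermOf h1 hξS h.2.1, fun a b hab => ?_⟩, h.1, h.2.1, hpξ⟩
  have h3 := hpξ
  rw [hab, evalArc_mul h.2.1, mul_eq_zero] at h3
  rcases h3 with h3 | h3
  · exact .inr (key a b hab h3)
  · exact .inl (key b a (hab.trans (mul_comm a b)) h3)

/-! ### Simple roots, logarithmic derivatives and the leading-term identity at a polar root -/

theorem pos_orderTop_evalArc {F : Conv} (hF : coeffXY F 0 0 = 0) {ξ : K} (hξ : 0 < ξ.orderTop) :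
    0 < (evalArc F ξ).orderTop :=
  pos_orderTop_ev hξ (pos_orderTop_single one_pos) ((cc_zero_zero F.1).symm.trans hF)

theorem dx_mul (f g : Conv) : dx (f * g) = dx f * g + f * dx g := by
  refine Subtype.ext ?_
  change MvPowerSeries.pderiv ℂ 0 (f.1 * g.1) = MvPowerSeries.pderiv ℂ 0 f.1 * g.1 +
    f.1 * MvPowerSeries.pderiv ℂ 0 g.1
  rw [Derivation.leibniz, smul_eq_mul, smul_eq_mul]
  ring

theorem evalArc_add (F G : Conv) (ξ : K) : evalArc (F + G) ξ = evalArc F ξ + evalArc G ξ :=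
  map_add (ev ξ (HahnSeries.single 1 1)) F.1 G.1

theorem evalArc_dx_ne_zero {F : Conv} {ξ : K} (h : rootMult F ξ = 1) : evalArc (dx F) ξ ≠ 0 := by
  have h1 : (1 : ℕ) ∈ {k | evalArc (dx^[k] F) ξ ≠ 0} := by
    rw [← h]
    refine Nat.sInf_mem (Nat.nonempty_of_pos_sInf ?_)
    change 0 < rootMult F ξ
    rw [h]
    exact one_pos
  exact h1

theorem rootMult_eq_one {F : Conv} {ξ : K} (h0 : evalArc F ξ = 0) (h1 : evalArc (dx F) ξ ≠ 0) :
    rootMult F ξ = 1 := by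
  have hmem : 1 ∈ {k | evalArc (dx^[k] F) ξ ≠ 0} := h1
  refine le_antisymm (Nat.sInf_le hmem) (Nat.one_le_iff_ne_zero.2 fun h => ?_)
  have h2 : rootMult F ξ ∈ {k | evalArc (dx^[k] F) ξ ≠ 0} := Nat.sInf_mem ⟨1, hmem⟩
  rw [h] at h2
  exact h2 h0

/-- The leading coefficient is multiplied by the leading exponent, which is positive. -/
theorem theta_ne_zero {x : K} (hx : x ≠ 0) (hpos : 0 < x.orderTop) : theta x ≠ 0 := by
  obtain ⟨q, c, hc, h⟩ := exists_hasLead hx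
  have hq : 0 < q := by
    rw [h.orderTop hc] at hpos
    exact WithTop.coe_lt_coe.1 hpos
  refine h.theta.ne_zero (mul_ne_zero ?_ hc)
  exact_mod_cast hq.ne'

theorem jac_comm (f g : Conv) : jac g f = -jac f g := by
  unfold jac
  ring

theorem evalArc_neg (F : Conv) (ξ : K) : evalArc (-F) ξ = -evalArc F ξ :=
  map_neg (ev ξ (HahnSeries.single 1 1)) F.1

/-- Along a simple root of `f * g` that is a root of `f`, everything is nondegenerate. -/
theorem simple_left {f g : Conv} (hg0 : coeffXY g 0 0 = 0) {ξ : K} (hξ : 0 < ξ.orderTop)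
    (hf : evalArc f ξ = 0) (h : rootMult (f * g) ξ = 1) :
    rootMult f ξ = 1 ∧ evalArc g ξ ≠ 0 ∧ evalArc (jac f g) ξ ≠ 0 := by
  have h1 := evalArc_dx_ne_zero h
  rw [dx_mul, evalArc_add, evalArc_mul hξ, evalArc_mul hξ, hf, zero_mul, add_zero] at h1
  have h2 := left_ne_zero_of_mul h1
  have h3 := right_ne_zero_of_mul h1
  refine ⟨rootMult_eq_one hf h2, h3, fun h4 => ?_⟩
  -- Since f vanishes along ξ, the right side reduces to −f_x·θ(g), a product of two nonzero series.
  have h5 := y_mul_jac hξ f g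
  rw [h4, hf, theta_zero, mul_zero, zero_mul, _root_.zero_sub, eq_comm, neg_eq_zero] at h5
  exact mul_ne_zero h2 (theta_ne_zero h3 (pos_orderTop_evalArc hg0 hξ)) h5

theorem IsGermOf.dx {P : K[X]} {W : Conv} (h : IsGermOf P W) :
    IsGermOf (Polynomial.derivative P) (PolarTree.dx W) := by
  intro i
  have e : ((i : K) + 1) = HahnSeries.ofPowerSeries ℚ ℂ (PowerSeries.C ((i : ℂ) + 1)) := by
    rw [map_add, map_add, map_natCast, map_natCast, map_one, map_one]
  rw [Polynomial.coeff_derivative, h (i + 1), e, ← map_mul]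
  congr 1
  ext j
  rw [PowerSeries.coeff_mul_C, PowerSeries.coeff_mk, PowerSeries.coeff_mk]
  exact (cc_pderiv_zero W.1 i j).symm

theorem dx_yVar_pow (n : ℕ) : dx (yVar ^ n) = 0 := by
  refine Subtype.ext (ext_cc fun i j => ?_)
  change cc (MvPowerSeries.pderiv ℂ 0 (MvPowerSeries.X 1 ^ n)) i j = cc 0 i j
  rw [cc_pderiv_zero, cc_X_one_pow, if_neg (by omega), zero_mul, cc_zero]

/-- `F` has the simple roots `S` and the order `E` in `y`. -/
structure Splitting (F : Conv) (E : ℕ) (S : Finset K) (u : Convˣ) : Prop where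
  mult : multiplicity yVar F = E
  isRoot_iff : ∀ {ξ : K}, IsRoot F ξ ↔ ξ ∈ S
  evalArc_eq : ∀ {ξ : K}, 0 < ξ.orderTop →
    evalArc F ξ = evalArc u ξ * HahnSeries.single (E : ℚ) 1 * ∏ η ∈ S, (ξ - η)
  logDeriv : ∀ {ξ : K}, 0 < ξ.orderTop → ξ ∉ S →
    evalArc (dx F) ξ / evalArc F ξ =
      evalArc (dx u) ξ / evalArc u ξ + ∑ η ∈ S, (ξ - η)⁻¹

theorem exists_splitting {F : Conv} (hF : F ≠ 0) (hs : ∀ ξ, IsRoot F ξ → rootMult F ξ = 1) :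
    ∃ E S u, Splitting F E S u := by
  classical
  obtain ⟨E, R, W, u, h⟩ := exists_factorization hF
  have hnd : R.Nodup := by
    rw [Multiset.nodup_iff_count_le_one]
    intro ξ
    by_cases hξ : ξ ∈ R
    · rw [h.count ξ (h.pos ξ hξ), hs ξ (h.isRoot_iff.2 hξ)]
    · rw [Multiset.count_eq_zero_of_notMem hξ]
      exact zero_le_one
  obtain ⟨S, rfl⟩ : ∃ S : Finset K, S.val = R := ⟨⟨R, hnd⟩, rfl⟩
  have hroot {ξ : K} : IsRoot F ξ ↔ ξ ∈ S := h.isRoot_iff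
  have hev {ξ : K} (hξ : 0 < ξ.orderTop) :
      evalArc F ξ = evalArc u ξ * HahnSeries.single (E : ℚ) 1 * ∏ η ∈ S, (ξ - η) :=
    h.evalArc_eq hξ
  refine ⟨E, S, u, h.mult, hroot, hev, fun {ξ} hξ hn => ?_⟩
  have hW : evalArc W ξ = ∏ η ∈ S, (ξ - η) := by
    rw [h.germ.evalArc_eq hξ, eval_rootPoly]
    rfl
  have hne (η : K) (hη : η ∈ S) : ξ - η ≠ 0 := by
    rw [sub_ne_zero]
    rintro rfl
    exact hn hη
  have hW0 : ∏ η ∈ S, (ξ - η) ≠ 0 := Finset.prod_ne_zero_iff.2 hne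
  have hdW : evalArc (dx W) ξ = (∏ η ∈ S, (ξ - η)) * ∑ η ∈ S, (ξ - η)⁻¹ := by
    rw [h.germ.dx.evalArc_eq hξ]
    have e : rootPoly S.val = ∏ η ∈ S, (Polynomial.X - Polynomial.C η) := rfl
    rw [e, Polynomial.derivative_prod_finset, Polynomial.eval_finsetSum, Finset.mul_sum]
    refine Finset.sum_congr rfl fun η hη => ?_
    rw [Polynomial.derivative_X_sub_C, mul_one, Polynomial.eval_prod, ← Finset.mul_prod_erase S _ hη]
    have := hne η hη
    simp only [Polynomial.eval_sub, Polynomial.eval_X, Polynomial.eval_C]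
    field_simp
  have hdF : evalArc (dx F) ξ = HahnSeries.single (E : ℚ) 1 *
      (evalArc (dx u) ξ * evalArc W ξ + evalArc u ξ * evalArc (dx W) ξ) := by
    conv_lhs => rw [h.eq]
    rw [dx_mul, dx_mul, dx_yVar_pow, mul_zero, add_zero, evalArc_add, evalArc_mul hξ,
      evalArc_mul hξ, evalArc_mul hξ, evalArc_mul hξ, evalArc_yVar_pow hξ]
    ring
  have hy : HahnSeries.single (E : ℚ) (1 : ℂ) ≠ 0 := HahnSeries.single_ne_zero one_ne_zero
  have hu := evalArc_unit_ne_zero u hξ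
  rw [hdF, hev hξ, hdW, hW]
  field_simp

theorem HasLead.prod {ι : Type*} {s : Finset ι} {x : ι → K} {d : ι → ℚ} {e : ι → ℂ}
    (h : ∀ i ∈ s, HasLead (x i) (d i) (e i)) :
    HasLead (∏ i ∈ s, x i) (∑ i ∈ s, d i) (∏ i ∈ s, e i) := by
  classical
  induction s using Finset.induction_on with
  | empty => exact ⟨vge_one, by simp⟩
  | insert i s hi ih =>
    rw [Finset.prod_insert hi, Finset.prod_insert hi, Finset.sum_insert hi]
    exact (h i (Finset.mem_insert_self _ _)).mul
      (ih fun j hj => h j (Finset.mem_insert_of_mem hj))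

theorem HasLead.theta_div {x : K} {q : ℚ} {c : ℂ} (h : HasLead x q c) (hc : c ≠ 0) :
    HasLead (PolarTree.theta x / x) 0 q := by
  have := h.theta.mul (h.inv hc)
  rwa [add_neg_cancel, mul_assoc, mul_inv_cancel₀ hc, mul_one, ← div_eq_mul_inv] at this

theorem Splitting.exists_hasLead {F : Conv} {E : ℕ} {S : Finset K} {u : Convˣ}
    (h : Splitting F E S u) {ξ : K} (hξ : 0 < ξ.orderTop) {d : K → ℚ} {e : K → ℂ}
    (hd : ∀ η ∈ S, HasLead (ξ - η) (d η) (e η)) (he : ∀ η ∈ S, e η ≠ 0) :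
    ∃ c, c ≠ 0 ∧ HasLead (evalArc F ξ) (E + ∑ η ∈ S, d η) c := by
  have h1 := ((hasLead_evalArc_unit u hξ).mul (hasLead_single (E : ℚ) 1)).mul (HasLead.prod hd)
  rw [← h.evalArc_eq hξ, _root_.zero_add] at h1
  refine ⟨_, ?_, h1⟩
  exact mul_ne_zero (mul_ne_zero (constantCoeff_unit_ne_zero u) one_ne_zero)
    (Finset.prod_ne_zero_iff.2 he)

-- In Σ 1/(ξ − η) the roots of largest contact D dominate, each contributing ε⁻¹y^{−D}. The term
-- u_x/u has order at least 0 > −D and does not interfere.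
open Classical in
theorem Splitting.hasLead_logDeriv {F : Conv} {E : ℕ} {S : Finset K} {u : Convˣ}
    (h : Splitting F E S u) {ξ : K} (hξ : 0 < ξ.orderTop) (hn : ξ ∉ S) {d : K → ℚ} {e : K → ℂ}
    (hd : ∀ η ∈ S, HasLead (ξ - η) (d η) (e η)) (he : ∀ η ∈ S, e η ≠ 0) {p : K → Prop} {D : ℚ}
    {ε : ℂ} (hD : 0 < D) (hp : ∀ η ∈ S, p η → d η = D ∧ e η = ε) (hnp : ∀ η ∈ S, ¬ p η → d η < D) :
    HasLead (evalArc (dx F) ξ / evalArc F ξ) (-D) ((S.filter p).card * ε⁻¹) := by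
  rw [h.logDeriv hξ hn]
  have h1 : HasLead (evalArc (dx u) ξ / evalArc u ξ) (-D) 0 := by
    refine Vgt.hasLead (Vge.vgt (q := 0) ?_ (by linarith))
    have h2 := (vge_ev_zero hξ (pos_orderTop_single one_pos) (dx u).1).mul
      ((hasLead_evalArc_unit u hξ).inv (constantCoeff_unit_ne_zero u)).1
    rwa [neg_zero, add_zero, ← evalArc_eq_ev, ← div_eq_mul_inv] at h2
  have h2 : HasLead (∑ η ∈ S, (ξ - η)⁻¹) (-D) (∑ η ∈ S, if p η then ε⁻¹ else 0) := by
    refine HasLead.sum fun η hη => ?_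
    have h3 := (hd η hη).inv (he η hη)
    split_ifs with hpη
    · rwa [(hp η hη hpη).1, (hp η hη hpη).2] at h3
    · exact (h3.1.vgt (neg_lt_neg (hnp η hη hpη))).hasLead
  have h3 := h1.add h2
  rwa [_root_.zero_add, ← Finset.sum_filter, Finset.sum_const, nsmul_eq_mul] at h3

open Classical in
/-- The relation between orders and numbers of roots imposed by a polar root. -/
theorem collinear_of_polar {f g : Conv} {a b : ℕ} {S T : Finset K} {u v : Convˣ}
    (hf : Splitting f a S u) (hg : Splitting g b T v) {γ : K} (hγ : 0 < γ.orderTop)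
    (hJ : evalArc (jac f g) γ = 0) (hS : γ ∉ S) (hT : γ ∉ T) {d : K → ℚ} {e : K → ℂ}
    (hd : ∀ η, η ∈ S ∨ η ∈ T → HasLead (γ - η) (d η) (e η)) (he : ∀ η, η ∈ S ∨ η ∈ T → e η ≠ 0)
    {p : K → Prop} {D : ℚ} {ε : ℂ} (hD : 0 < D) (hε : ε ≠ 0)
    (hp : ∀ η, η ∈ S ∨ η ∈ T → p η → d η = D ∧ e η = ε)
    (hnp : ∀ η, η ∈ S ∨ η ∈ T → ¬ p η → d η < D) :
    (a + ∑ η ∈ S, d η) * (T.filter p).card = (b + ∑ η ∈ T, d η) * (S.filter p).card := by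
  obtain ⟨c, hc, hcf⟩ := hf.exists_hasLead hγ (fun η h => hd η (.inl h)) fun η h => he η (.inl h)
  obtain ⟨c', hc', hcg⟩ := hg.exists_hasLead hγ (fun η h => hd η (.inr h)) fun η h => he η (.inr h)
  have h1 := hf.hasLead_logDeriv hγ hS (fun η h => hd η (.inl h)) (fun η h => he η (.inl h)) hD
    (fun η h => hp η (.inl h)) (fun η h => hnp η (.inl h))
  have h2 := hg.hasLead_logDeriv hγ hT (fun η h => hd η (.inr h)) (fun η h => he η (.inr h)) hD
    (fun η h => hp η (.inr h)) (fun η h => hnp η (.inr h))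
  have hf0 := hcf.ne_zero hc
  have hg0 := hcg.ne_zero hc'
  have h3 := y_mul_jac hγ f g
  rw [hJ, mul_zero] at h3
  -- The equation J = 0 along γ, divided by fg. Both sides have leading exponent −D, and their
  -- coefficients are the order of f times the number of close roots of g, respectively the order of
  -- g times that of f, up to the common factor ε⁻¹.
  have h4 : theta (evalArc f γ) / evalArc f γ * (evalArc (dx g) γ / evalArc g γ) =
      evalArc (dx f) γ / evalArc f γ * (theta (evalArc g γ) / evalArc g γ) := by
    field_simp
    exact (sub_eq_zero.1 h3.symm)
  have h5 := (hcf.theta_div hc).mul h2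
  have h6 := h1.mul (hcg.theta_div hc')
  rw [h4, _root_.zero_add] at h5
  rw [add_zero] at h6
  have h7 := h5.unique h6
  have h8 : ((((a : ℚ) + ∑ η ∈ S, d η) * (T.filter p).card : ℚ) : ℂ) =
      ((((b : ℚ) + ∑ η ∈ T, d η) * (S.filter p).card : ℚ) : ℂ) := by
    rw [Rat.cast_mul, Rat.cast_mul, Rat.cast_natCast, Rat.cast_natCast]
    refine mul_right_cancel₀ (inv_ne_zero hε) ?_
    rw [mul_assoc, h7]
    ring
  exact_mod_cast h8

/-- The data of a pair of power series whose product has simple roots. -/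
structure Setup (f g : Conv) (a b : ℕ) (S T : Finset K) (u v : Convˣ) : Prop where
  hf : Splitting f a S u
  hg : Splitting g b T v
  disj : Disjoint S T
  f_ne_zero : f ≠ 0
  g_ne_zero : g ≠ 0
  f0 : coeffXY f 0 0 = 0
  g0 : coeffXY g 0 0 = 0
  jac : ∀ ξ, ξ ∈ S ∨ ξ ∈ T → evalArc (PolarTree.jac f g) ξ ≠ 0

theorem isRoot_mul_iff {f g : Conv} {ξ : K} : IsRoot (f * g) ξ ↔ IsRoot f ξ ∨ IsRoot g ξ := by
  constructor
  · rintro ⟨h1, h2, h3⟩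
    rw [evalArc_mul h2, mul_eq_zero] at h3
    exact h3.imp (fun h => ⟨h1, h2, h⟩) fun h => ⟨h1, h2, h⟩
  · rintro (⟨h1, h2, h3⟩ | ⟨h1, h2, h3⟩)
    · exact ⟨h1, h2, by rw [evalArc_mul h2, h3, zero_mul]⟩
    · exact ⟨h1, h2, by rw [evalArc_mul h2, h3, mul_zero]⟩

theorem exists_setup {f g : Conv} (hf0 : coeffXY f 0 0 = 0) (hg0 : coeffXY g 0 0 = 0)
    (hf : f ≠ 0) (hg : g ≠ 0) (hs : ∀ ξ, IsRoot (f * g) ξ → rootMult (f * g) ξ = 1) :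
    ∃ a b S T u v, Setup f g a b S T u v := by
  have h1 (ξ : K) (hξ : IsRoot f ξ) := simple_left hg0 hξ.2.1 hξ.2.2
    (hs ξ (isRoot_mul_iff.2 (.inl hξ)))
  have h2 (ξ : K) (hξ : IsRoot g ξ) := simple_left (f := g) hf0 hξ.2.1 hξ.2.2
    (by rw [mul_comm]; exact hs ξ (isRoot_mul_iff.2 (.inr hξ)))
  obtain ⟨a, S, u, hS⟩ := exists_splitting hf fun ξ hξ => (h1 ξ hξ).1
  obtain ⟨b, T, v, hT⟩ := exists_splitting hg fun ξ hξ => (h2 ξ hξ).1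
  refine ⟨a, b, S, T, u, v, hS, hT, ?_, hf, hg, hf0, hg0, ?_⟩
  · rw [Finset.disjoint_left]
    intro ξ h3 h4
    exact (h1 ξ (hS.isRoot_iff.2 h3)).2.1 (hT.isRoot_iff.2 h4).2.2
  · rintro ξ (h3 | h3)
    · exact (h1 ξ (hS.isRoot_iff.2 h3)).2.2
    · have := (h2 ξ (hT.isRoot_iff.2 h3)).2.2
      rw [jac_comm, evalArc_neg, neg_ne_zero] at this
      exact this

/-! ### Bars -/

theorem climbsAt_iff {ξ : K} {B : Bar} {c : ℂ} :
    ClimbsAt ξ B c ↔ HasLead (ξ - B.arc) B.height c := hasLead_iff.symm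

theorem climbs_iff {ξ : K} {B : Bar} : Climbs ξ B ↔ Vge B.height (ξ - B.arc) :=
  ⟨fun ⟨_, h⟩ => (climbsAt_iff.1 h).1, fun h => ⟨_, climbsAt_iff.2 ⟨h, rfl⟩⟩⟩

theorem boundedBy_iff {ξ : K} {B : Bar} : BoundedBy ξ B ↔ ¬ Climbs ξ B := by
  rw [climbs_iff, ← le_orderTop_iff, not_le]
  rfl

theorem ClimbsAt.unique {ξ : K} {B : Bar} {c c' : ℂ} (h : ClimbsAt ξ B c) (h' : ClimbsAt ξ B c') :
    c = c' := (climbsAt_iff.1 h).unique (climbsAt_iff.1 h')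

theorem ClimbsAt.climbs {ξ : K} {B : Bar} {c : ℂ} (h : ClimbsAt ξ B c) : Climbs ξ B := ⟨c, h⟩

theorem ClimbsAt.vgt_sub {ξ η : K} {B : Bar} {c : ℂ} (h : ClimbsAt ξ B c) (h' : ClimbsAt η B c) :
    Vgt B.height (ξ - η) := by
  have := (climbsAt_iff.1 h).vgt.sub (climbsAt_iff.1 h').vgt
  rwa [sub_sub_sub_cancel_right, sub_sub_sub_cancel_right] at this

theorem Climbs.vge_sub {ξ η : K} {B : Bar} (h : Climbs ξ B) (h' : Climbs η B) :
    Vge B.height (ξ - η) := by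
  have := (climbs_iff.1 h).sub (climbs_iff.1 h')
  rwa [sub_sub_sub_cancel_right] at this

theorem Climbs.of_vge {ξ η : K} {B : Bar} (h : Climbs ξ B) (h' : Vge B.height (η - ξ)) :
    Climbs η B := by
  have := h'.add (climbs_iff.1 h)
  rw [sub_add_sub_cancel] at this
  exact climbs_iff.2 this

theorem ClimbsAt.of_vgt {ξ η : K} {B : Bar} {c : ℂ} (h : ClimbsAt ξ B c)
    (h' : Vgt B.height (η - ξ)) : ClimbsAt η B c := by
  have := h'.hasLead.add (climbsAt_iff.1 h)
  rw [sub_add_sub_cancel, _root_.zero_add] at this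
  exact climbsAt_iff.2 this

theorem coeff_truncLT_of_le {h e : ℚ} (he : h ≤ e) (x : K) :
    (HahnSeries.truncLT h x).coeff e = 0 := HahnSeries.coeff_truncLT_of_le he x

theorem vge_sub_truncLT (h : ℚ) (x : K) : Vge h (x - HahnSeries.truncLT h x) := by
  intro e he
  rw [HahnSeries.coeff_sub, HahnSeries.coeff_truncLT_of_lt he, sub_self]

theorem truncLT_eq_of_vge {h : ℚ} {x y : K} (hxy : Vge h (x - y)) :
    HahnSeries.truncLT h x = HahnSeries.truncLT h y := by
  ext e
  rcases lt_or_ge e h with he | he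
  · rw [HahnSeries.coeff_truncLT_of_lt he, HahnSeries.coeff_truncLT_of_lt he]
    have := hxy e he
    rwa [HahnSeries.coeff_sub, sub_eq_zero] at this
  · rw [coeff_truncLT_of_le he, coeff_truncLT_of_le he]

namespace IsPostbar

variable {f g : Conv} {B B' : Bar} {c : ℂ}

theorem exists_mem (h : IsPostbar f g B c B') : ∃ ξ, ξ ∈ rootsAt (f * g) B c :=
  ⟨_, h.1.choose_spec.1⟩

theorem height_lt (h : IsPostbar f g B c B') : B.height < B'.height := by
  obtain ⟨ξ, hξ, η, hη, e⟩ := h.1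
  have h1 := lt_orderTop_iff.2 (hξ.2.vgt_sub hη.2)
  rw [e] at h1
  exact WithTop.coe_lt_coe.1 h1

theorem climbs (h : IsPostbar f g B c B') {ξ : K} (hξ : ξ ∈ rootsAt (f * g) B c) :
    Climbs ξ B' := by
  rw [climbs_iff, h.2.2 ξ hξ]
  exact vge_sub_truncLT _ _

theorem climbsAt (h : IsPostbar f g B c B') {ζ : K} (hζ : Climbs ζ B') : ClimbsAt ζ B c := by
  obtain ⟨ξ, hξ⟩ := h.exists_mem
  exact hξ.2.of_vgt ((hζ.vge_sub (h.climbs hξ)).vgt h.height_lt)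

theorem eq {B'' : Bar} (h : IsPostbar f g B c B') (h' : IsPostbar f g B c B'') : B' = B'' := by
  have key {X Y : Bar} (hX : IsPostbar f g B c X) (hY : IsPostbar f g B c Y) :
      X.height ≤ Y.height := by
    obtain ⟨ξ, hξ, η, hη, e⟩ := hY.1
    have := hX.2.1 ξ hξ η hη
    rw [e] at this
    exact WithTop.coe_le_coe.1 this
  have e := le_antisymm (key h h') (key h' h)
  obtain ⟨ξ, hξ⟩ := h.exists_mem
  have e' : B'.arc = B''.arc := by rw [h.2.2 ξ hξ, h'.2.2 ξ hξ, e]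
  cases B'
  cases B''
  simp only at e e'
  rw [e, e']

end IsPostbar

theorem exists_postbar {f g : Conv} (hfg : f * g ≠ 0) {B : Bar} {c : ℂ} {ξ η : K}
    (hξ : ξ ∈ rootsAt (f * g) B c) (hη : η ∈ rootsAt (f * g) B c) (hne : ξ ≠ η) :
    ∃ B', IsPostbar f g B c B' := by
  classical
  have hfin : (rootsAt (f * g) B c).Finite := (finite_isRoot hfg).subset fun ξ hξ => hξ.1
  obtain ⟨p, hp, hmin⟩ := hfin.toFinset.offDiag.exists_min_image (fun p => (p.1 - p.2).orderTop)
    ⟨(ξ, η), by simp [hξ, hη, hne]⟩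
  simp only [Finset.mem_offDiag, Set.Finite.mem_toFinset] at hp hmin
  obtain ⟨h, hh⟩ := WithTop.ne_top_iff_exists.1
    (HahnSeries.orderTop_ne_top.2 (sub_ne_zero.2 hp.2.2))
  have hle : ∀ ξ ∈ rootsAt (f * g) B c, ∀ η ∈ rootsAt (f * g) B c,
      (h : WithTop ℚ) ≤ (ξ - η).orderTop := by
    intro ξ hξ η hη
    by_cases e : ξ = η
    · rw [e, sub_self, HahnSeries.orderTop_zero]
      exact le_top
    · rw [hh]
      exact hmin (ξ, η) ⟨hξ, hη, e⟩
  exact ⟨⟨HahnSeries.truncLT h p.1, h⟩, ⟨p.1, hp.1, p.2, hp.2.1, hh.symm⟩, hle,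
    fun ζ hζ => truncLT_eq_of_vge (le_orderTop_iff.1 (hle _ hp.1 _ hζ))⟩

/-- The formal properties of the bars of the tree. -/
structure GoodBar (B : Bar) : Prop where
  nonneg : 0 ≤ B.height
  pos : 0 < B.arc.orderTop
  coeff_eq_zero : ∀ e, B.height ≤ e → B.arc.coeff e = 0
  arc_eq_zero : B.height = 0 → B = groundBar

theorem IsBar.good {f g : Conv} {B : Bar} (h : IsBar f g B) : GoodBar B := by
  induction h with
  | ground => exact ⟨le_rfl, pos_orderTop_zero, fun _ _ => rfl, fun _ => rfl⟩
  | post B c B' hB hp ih =>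
    have h0 : 0 < B'.height := ih.nonneg.trans_lt hp.height_lt
    obtain ⟨ξ, hξ⟩ := hp.exists_mem
    have e := hp.2.2 ξ hξ
    refine ⟨h0.le, ?_, fun e' he' => ?_, fun h1 => absurd h1 h0.ne'⟩
    · rw [pos_orderTop_iff, e]
      intro e' he'
      rw [HahnSeries.coeff_truncLT_of_lt (he'.trans_lt h0)]
      exact pos_orderTop_iff.1 hξ.1.2.1 e' he'
    · rw [e, coeff_truncLT_of_le he']

theorem climbsAt_ground {ξ : K} (hξ : 0 < ξ.orderTop) : ClimbsAt ξ groundBar 0 := by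
  rw [climbsAt_iff]
  change HasLead (ξ - 0) 0 0
  rw [_root_.sub_zero]
  exact (pos_orderTop_iff.1 hξ).hasLead

open Classical in
/-- The contact of `η` with a generic arc that climbs over `B`. -/
def contact (B : Bar) (η : K) : ℚ := if Climbs η B then B.height else (η - B.arc).order

theorem contact_of_climbs {B : Bar} {η : K} (h : Climbs η B) : contact B η = B.height := if_pos h

theorem contact_eq_of_hasLead {B : Bar} {η : K} {q : ℚ} {e : ℂ} (h : HasLead (η - B.arc) q e)
    (he : e ≠ 0) (hq : q < B.height) : contact B η = q := by
  rw [contact, if_neg, ← WithTop.coe_eq_coe]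
  · exact (HahnSeries.order_eq_orderTop_of_ne_zero (h.ne_zero he)).trans (h.orderTop he)
  · rw [climbs_iff]
    intro h'
    exact he (h.2.symm.trans (h' q hq))

theorem exists_contact {B : Bar} {η : K} (h : ¬ Climbs η B) :
    contact B η < B.height ∧ ∃ e, e ≠ 0 ∧ HasLead (η - B.arc) (contact B η) e := by
  have h1 : η - B.arc ≠ 0 := by
    intro h0
    rw [climbs_iff, h0] at h
    exact h (vge_zero _)
  obtain ⟨q, e, he, hq⟩ := exists_hasLead h1
  have hlt : q < B.height := by
    by_contra h2
    exact h (climbs_iff.2 (hq.1.mono (not_lt.1 h2)))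
  rw [contact_eq_of_hasLead hq he hlt]
  exact ⟨hlt, e, he, hq⟩

theorem contact_le (B : Bar) (η : K) : contact B η ≤ B.height := by
  by_cases h : Climbs η B
  · rw [contact_of_climbs h]
  · exact (exists_contact h).1.le

/-- If η is bounded by B, the difference is governed by η − λ_B. If η climbs over B at another
point, the coefficients of y^{h(B)} differ. In both cases ζ behaves towards η like a generic arc
over B. -/
theorem ClimbsAt.exists_hasLead_sub {B : Bar} {ζ η : K} {z : ℂ} (hζ : ClimbsAt ζ B z)
    (hη : ¬ ClimbsAt η B z) : ∃ e, e ≠ 0 ∧ HasLead (ζ - η) (contact B η) e := by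
  have h1 := climbsAt_iff.1 hζ
  have hneg {x : K} {q : ℚ} {c : ℂ} (h : HasLead x q c) : HasLead (-x) q (-c) :=
    ⟨h.1.neg, by rw [HahnSeries.coeff_neg, h.2]⟩
  by_cases h : Climbs η B
  · obtain ⟨c, hc⟩ := h
    rw [contact_of_climbs ⟨c, hc⟩]
    have h2 := h1.add (hneg (climbsAt_iff.1 hc))
    rw [← sub_eq_add_neg, sub_sub_sub_cancel_right] at h2
    refine ⟨_, fun h0 => hη ?_, h2⟩
    rwa [add_neg_eq_zero.1 h0]
  · obtain ⟨hlt, e, he, h2⟩ := exists_contact h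
    have h3 := (h1.1.vgt hlt).hasLead.add (hneg h2)
    rw [← sub_eq_add_neg, sub_sub_sub_cancel_right, _root_.zero_add] at h3
    exact ⟨-e, neg_ne_zero.2 he, h3⟩

theorem Splitting.exists_hasLead_contact {F : Conv} {E : ℕ} {S : Finset K} {u : Convˣ}
    (h : Splitting F E S u) {B : Bar} {ζ : K} (hζ : 0 < ζ.orderTop) {z : ℂ} (hz : ClimbsAt ζ B z)
    (hS : ∀ η ∈ S, ¬ ClimbsAt η B z) :
    ∃ c, c ≠ 0 ∧ HasLead (evalArc F ζ) (E + ∑ η ∈ S, contact B η) c := by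
  have h1 (η : K) : ∃ e, η ∈ S → e ≠ 0 ∧ HasLead (ζ - η) (contact B η) e := by
    by_cases hη : η ∈ S
    · obtain ⟨e, he⟩ := hz.exists_hasLead_sub (hS η hη)
      exact ⟨e, fun _ => he⟩
    · exact ⟨0, fun h => absurd h hη⟩
  choose e he using h1
  exact h.exists_hasLead hζ (fun η hη => (he η hη).2) fun η hη => (he η hη).1

theorem pos_generic {B : Bar} (hB : GoodBar B) (h : 0 < B.height) (z : ℂ) :
    0 < (B.arc + HahnSeries.single B.height z).orderTop ∧
      ClimbsAt (B.arc + HahnSeries.single B.height z) B z := by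
  constructor
  · rw [pos_orderTop_iff]
    exact (pos_orderTop_iff.1 hB.pos).add (vgt_single z h)
  · rw [climbsAt_iff, add_sub_cancel_left]
    exact hasLead_single _ _

theorem finite_climbsAt (S : Finset K) (B : Bar) : {z : ℂ | ∃ η ∈ S, ClimbsAt η B z}.Finite := by
  refine (S.finite_toSet.image fun η => (η - B.arc).coeff B.height).subset ?_
  rintro z ⟨η, hη, hz⟩
  exact ⟨η, hη, (climbsAt_iff.1 hz).2⟩

/-- All but finitely many z avoid the points of roots, and there each root contributes its contact.
At height 0 the definition takes the exponent of y instead, and all contacts are 0. -/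
theorem Splitting.nu_eq {F : Conv} {E : ℕ} {S : Finset K} {u : Convˣ}
    (h : Splitting F E S u) {B : Bar} (hB : GoodBar B) :
    nu F B = E + ∑ η ∈ S, contact B η := by
  by_cases h0 : B.height = 0
  · rw [nu, if_pos h0, h.mult, Finset.sum_eq_zero, add_zero]
    intro η hη
    rw [contact_of_climbs, h0]
    rw [hB.arc_eq_zero h0]
    exact ⟨0, climbsAt_ground (h.isRoot_iff.2 hη).2.1⟩
  · have hpos : 0 < B.height := lt_of_le_of_ne hB.nonneg (Ne.symm h0)
    have key : ∀ᶠ z : ℂ in Filter.cofinite,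
        (evalArc F (B.arc + HahnSeries.single B.height z)).orderTop =
          ((E + ∑ η ∈ S, contact B η : ℚ) : WithTop ℚ) := by
      refine Filter.mem_of_superset (finite_climbsAt S B).compl_mem_cofinite fun z hz => ?_
      obtain ⟨h1, h2⟩ := pos_generic hB hpos z
      obtain ⟨c, hc, h3⟩ := h.exists_hasLead_contact h1 h2 fun η hη h4 => hz ⟨η, hη, h4⟩
      exact h3.orderTop hc
    have hex : ∃ e : ℚ, ∀ᶠ z : ℂ in Filter.cofinite,
        (evalArc F (B.arc + HahnSeries.single B.height z)).orderTop = (e : WithTop ℚ) := ⟨_, key⟩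
    rw [nu, if_neg h0, dif_pos hex]
    obtain ⟨z, h1, h2⟩ := (hex.choose_spec.and key).exists
    exact WithTop.coe_eq_coe.1 (h1.symm.trans h2)

/-- A generic arc over a bar of positive height has positive order, and F vanishes at the origin. -/
theorem Splitting.nu_pos {F : Conv} {E : ℕ} {S : Finset K} {u : Convˣ}
    (h : Splitting F E S u) (hF : coeffXY F 0 0 = 0) {B : Bar} (hB : GoodBar B)
    (hpos : 0 < B.height) : 0 < nu F B := by
  obtain ⟨z, hz⟩ := (finite_climbsAt S B).infinite_compl.nonempty
  obtain ⟨h1, h2⟩ := pos_generic hB hpos z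
  obtain ⟨c, hc, h3⟩ := h.exists_hasLead_contact h1 h2 fun η hη h4 => hz ⟨η, hη, h4⟩
  have h4 := pos_orderTop_evalArc hF h1
  rw [h3.orderTop hc, ← h.nu_eq hB] at h4
  exact WithTop.coe_lt_coe.1 h4

open Classical in
theorem Splitting.ncard_rootsAt {F : Conv} {E : ℕ} {S : Finset K} {u : Convˣ}
    (h : Splitting F E S u) (B : Bar) (c : ℂ) :
    (rootsAt F B c).ncard = (S.filter fun η => ClimbsAt η B c).card := by
  rw [← Set.ncard_coe_finset]
  congr 1
  ext η
  simp [rootsAt, h.isRoot_iff]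

namespace Setup

variable {f g : Conv} {a b : ℕ} {S T : Finset K} {u v : Convˣ}

theorem mem_roots (h : Setup f g a b S T u v) {ξ : K} : IsRoot (f * g) ξ ↔ ξ ∈ S ∨ ξ ∈ T := by
  rw [isRoot_mul_iff, h.hf.isRoot_iff, h.hg.isRoot_iff]

theorem mul_ne_zero (h : Setup f g a b S T u v) : f * g ≠ 0 :=
  _root_.mul_ne_zero h.f_ne_zero h.g_ne_zero

/-- Since J vanishes on no root of fg, the condition fg ≠ 0 is automatic along a root of J. -/
theorem mem_polarRoots (h : Setup f g a b S T u v) {γ : K} :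
    γ ∈ polarRoots f g ↔ IsRoot (PolarTree.jac f g) γ := by
  refine ⟨fun hγ => hγ.1, fun hγ => ⟨hγ, ?_⟩⟩
  rw [← evalArc_mul hγ.2.1]
  intro h0
  exact h.jac γ (h.mem_roots.1 ⟨hγ.1, hγ.2.1, h0⟩) hγ.2.2

theorem notMem_of_polar (h : Setup f g a b S T u v) {γ : K} (hγ : γ ∈ polarRoots f g) :
    γ ∉ S ∧ γ ∉ T :=
  ⟨fun h' => h.jac γ (.inl h') hγ.1.2.2, fun h' => h.jac γ (.inr h') hγ.1.2.2⟩

open Classical in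
theorem delta_eq (h : Setup f g a b S T u v) {B : Bar} (hB : GoodBar B) (c : ℂ) :
    Delta f g B c =
      (a + ∑ η ∈ S, contact B η) * (T.filter fun η => ClimbsAt η B c).card -
      (b + ∑ η ∈ T, contact B η) * (S.filter fun η => ClimbsAt η B c).card := by
  rw [Delta, h.hf.nu_eq hB, h.hg.nu_eq hB, h.hf.ncard_rootsAt, h.hg.ncard_rootsAt]

theorem mem_rootsAt (h : Setup f g a b S T u v) {B : Bar} {c : ℂ} {ξ : K} :
    ξ ∈ rootsAt (f * g) B c ↔ (ξ ∈ S ∨ ξ ∈ T) ∧ ClimbsAt ξ B c := by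
  rw [← h.mem_roots]
  rfl

theorem delta_eq_zero_of_notMem (h : Setup f g a b S T u v) {B : Bar} {c : ℂ}
    (hc : c ∉ trunkPoints f g B) : Delta f g B c = 0 := by
  classical
  rw [Delta, h.hf.ncard_rootsAt, h.hg.ncard_rootsAt, Finset.filter_eq_empty_iff.2,
    Finset.filter_eq_empty_iff.2]
  · simp
  · exact fun η hη h' => hc ⟨η, h.mem_rootsAt.2 ⟨.inl hη, h'⟩⟩
  · exact fun η hη h' => hc ⟨η, h.mem_rootsAt.2 ⟨.inr hη, h'⟩⟩

/-- A polar root that climbs over `B` at a non-collinear point follows the trunk. -/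
theorem delta_eq_zero_of_polar (h : Setup f g a b S T u v) {B : Bar} (hB : GoodBar B) {c : ℂ}
    {γ : K} (hγ : γ ∈ polarRoots f g) (hc : ClimbsAt γ B c)
    (hpost : ∀ B', IsPostbar f g B c B' → ¬ Climbs γ B') : Delta f g B c = 0 := by
  classical
  by_cases hct : c ∈ trunkPoints f g B
  swap
  · exact h.delta_eq_zero_of_notMem hct
  obtain ⟨ξ, hξ⟩ := hct
  have hγn := h.notMem_of_polar hγ
  have hne {η : K} (hη : η ∈ S ∨ η ∈ T) : γ - η ≠ 0 := by
    rw [sub_ne_zero]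
    rintro rfl
    exact hη.elim hγn.1 hγn.2
  obtain ⟨D, ε, hε, hD⟩ := exists_hasLead (hne (h.mem_rootsAt.1 hξ).1)
  have hlt : B.height < D := by
    by_contra hle
    exact hε (hD.2.symm.trans (hc.vgt_sub hξ.2 D (not_lt.1 hle)))
  -- The contact D of γ with one trunk root stays below the height of the postbar, if there is one,
  -- and the trunk roots agree with each other up to that height. So all of them have the same
  -- leading difference with γ.
  have hlead {η : K} (hη : η ∈ S ∨ η ∈ T) (hηc : ClimbsAt η B c) : HasLead (γ - η) D ε := by
    by_cases e : ξ = η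
    · rwa [← e]
    · have hη' := h.mem_rootsAt.2 ⟨hη, hηc⟩
      obtain ⟨B', hB'⟩ := exists_postbar h.mul_ne_zero hξ hη' e
      have h1 : D < B'.height := by
        by_contra hle
        exact hpost B' hB' ((hB'.climbs hξ).of_vge (hD.1.mono (not_lt.1 hle)))
      have h2 := hD.add (((hB'.climbs hξ).vge_sub (hB'.climbs hη')).vgt h1).hasLead
      rwa [sub_add_sub_cancel, add_zero] at h2
  have hex (η : K) : ∃ e, (η ∈ S ∨ η ∈ T) → e ≠ 0 ∧
      HasLead (γ - η) (if ClimbsAt η B c then D else contact B η) e ∧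
      (ClimbsAt η B c → e = ε) := by
    by_cases hη : η ∈ S ∨ η ∈ T
    · by_cases hηc : ClimbsAt η B c
      · exact ⟨ε, fun _ => ⟨hε, by rw [if_pos hηc]; exact hlead hη hηc, fun _ => rfl⟩⟩
      · obtain ⟨e, he, h1⟩ := hc.exists_hasLead_sub hηc
        exact ⟨e, fun _ => ⟨he, by rwa [if_neg hηc], fun h => absurd h hηc⟩⟩
    · exact ⟨0, fun h => absurd h hη⟩
  choose e he using hex
  have key := collinear_of_polar h.hf h.hg hγ.1.2.1 hγ.1.2.2 hγn.1 hγn.2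
    (d := fun η => if ClimbsAt η B c then D else contact B η) (e := e)
    (p := fun η => ClimbsAt η B c) (D := D) (ε := ε)
    (fun η hη => (he η hη).2.1) (fun η hη => (he η hη).1) (hB.nonneg.trans_lt hlt) hε
    (fun η hη hp => ⟨if_pos hp, (he η hη).2.2 hp⟩)
    (fun η _ hp => by rw [if_neg hp]; exact (contact_le B η).trans_lt hlt)
  -- Trunk roots have contact D with γ instead of the generic h(B). With s and t trunk roots of f
  -- and g, the orders along γ are ν_f + s(D − h) and ν_g + t(D − h); in the cross products the
  -- terms st(D − h) cancel, leaving Δ.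
  have hsum (U : Finset K) : ∑ η ∈ U, (if ClimbsAt η B c then D else contact B η) =
      ∑ η ∈ U, contact B η + (U.filter fun η => ClimbsAt η B c).card * (D - B.height) := by
    rw [← nsmul_eq_mul, ← Finset.sum_const, Finset.sum_filter, ← Finset.sum_add_distrib]
    refine Finset.sum_congr rfl fun η _ => ?_
    split_ifs with hp
    · rw [contact_of_climbs hp.climbs]
      ring
    · rw [add_zero]
  rw [hsum, hsum] at key
  rw [h.delta_eq hB]
  linear_combination key

-- From B to the postbar, ν_f and ν_g grow by s(h' − h) and t(h' − h), where s and t count the trunk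
-- roots of f and g; the terms st(h' − h) cancel in Δ. The trunk at c is distributed over the points
-- of the postbar. The index set may also contain coefficients of roots that do not climb over it;
-- at a value that is no trunk point nothing is counted.
open Classical in
theorem sum_delta (h : Setup f g a b S T u v) {B B' : Bar} (hB : GoodBar B) (hB' : GoodBar B')
    {c : ℂ} (hp : IsPostbar f g B c B') : Delta f g B c =
      ∑ z ∈ (S ∪ T).image fun η => (η - B'.arc).coeff B'.height, Delta f g B' z := by
  have hiff (η : K) (hη : η ∈ S ∨ η ∈ T) : Climbs η B' ↔ ClimbsAt η B c :=
    ⟨fun h' => hp.climbsAt h', fun h' => hp.climbs (h.mem_rootsAt.2 ⟨hη, h'⟩)⟩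
  have hcount (U : Finset K) (hU : U ⊆ S ∪ T) :
      ∑ z ∈ (S ∪ T).image fun η => (η - B'.arc).coeff B'.height,
        ((U.filter fun η => ClimbsAt η B' z).card : ℚ) =
      (U.filter fun η => ClimbsAt η B c).card := by
    rw [← Nat.cast_sum]
    congr 1
    rw [Finset.card_eq_sum_card_fiberwise (t := (S ∪ T).image fun η => (η - B'.arc).coeff B'.height)
      (f := fun η => (η - B'.arc).coeff B'.height)]
    · refine Finset.sum_congr rfl fun z _ => ?_
      congr 1
      ext η
      simp only [Finset.mem_filter]
      constructor
      · rintro ⟨h1, h2⟩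
        exact ⟨⟨h1, hp.climbsAt h2.climbs⟩, (climbsAt_iff.1 h2).2⟩
      · rintro ⟨⟨h1, h2⟩, h3⟩
        refine ⟨h1, climbsAt_iff.2 ⟨?_, h3⟩⟩
        exact climbs_iff.1 ((hiff η (Finset.mem_union.1 (hU h1))).2 h2)
    · intro η hη
      exact Finset.mem_coe.2 (Finset.mem_image_of_mem _ (hU (Finset.mem_filter.1 hη).1))
  have hcontact (U : Finset K) (hU : U ⊆ S ∪ T) : ∑ η ∈ U, contact B' η =
      ∑ η ∈ U, contact B η +
        (U.filter fun η => ClimbsAt η B c).card * (B'.height - B.height) := by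
    rw [← nsmul_eq_mul, ← Finset.sum_const, Finset.sum_filter, ← Finset.sum_add_distrib]
    refine Finset.sum_congr rfl fun η hη => ?_
    split_ifs with h1
    · rw [contact_of_climbs h1.climbs,
        contact_of_climbs ((hiff η (Finset.mem_union.1 (hU hη))).2 h1)]
      ring
    · rw [add_zero]
      obtain ⟨ξ, hξ⟩ := hp.exists_mem
      obtain ⟨e, he, h2⟩ := hξ.2.exists_hasLead_sub h1
      have hlt : contact B η < B'.height := (contact_le B η).trans_lt hp.height_lt
      have h3 := ((climbs_iff.1 (hp.climbs hξ)).vgt hlt).hasLead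
      refine contact_eq_of_hasLead (e := -e) ?_ (neg_ne_zero.2 he) hlt
      refine ⟨?_, ?_⟩
      · have := h3.1.sub h2.1
        rwa [sub_sub_sub_cancel_left] at this
      · have h4 : η - B'.arc = (ξ - B'.arc) - (ξ - η) := by ring
        rw [h4, HahnSeries.coeff_sub, h3.2, h2.2, _root_.zero_sub]
  simp only [h.delta_eq hB, h.delta_eq hB']
  rw [Finset.sum_sub_distrib, ← Finset.mul_sum, ← Finset.mul_sum,
    hcount _ Finset.subset_union_left, hcount _ Finset.subset_union_right,
    hcontact _ Finset.subset_union_left, hcontact _ Finset.subset_union_right]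
  ring

/-- A nonzero sum has a nonzero summand, so non-collinearity of a point is passed on to its postbar
by `sum_delta`. -/
theorem not_isCollinear_postbar (h : Setup f g a b S T u v) {B B' : Bar} (hB : IsBar f g B)
    {c : ℂ} (hp : IsPostbar f g B c B') (hc : Delta f g B c ≠ 0) : ¬ IsCollinear f g B' := by
  classical
  intro h1
  refine hc ?_
  rw [h.sum_delta hB.good (IsBar.post B c B' hB hp).good hp]
  refine Finset.sum_eq_zero fun z _ => ?_
  by_cases hz : z ∈ trunkPoints f g B'
  · exact h1 z hz
  · exact h.delta_eq_zero_of_notMem hz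

/-- A point that supports a single root is non-collinear. -/
theorem delta_ne_zero_of_single (h : Setup f g a b S T u v) {B : Bar} (hB : GoodBar B)
    (hpos : 0 < B.height) {c : ℂ} (hc : c ∈ trunkPoints f g B)
    (hpost : ∀ B', ¬ IsPostbar f g B c B') : Delta f g B c ≠ 0 := by
  classical
  obtain ⟨ξ, hξ⟩ := hc
  have huniq (η : K) (hη : η ∈ rootsAt (f * g) B c) : η = ξ := by
    by_contra hne
    obtain ⟨B', hB'⟩ := exists_postbar h.mul_ne_zero hη hξ hne
    exact hpost B' hB'
  -- With a single root, Δ is ±ν of the other series. Positive height makes this nonzero, whereas on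
  -- the ground bar ν may be 0.
  have hf := h.hf.nu_pos h.f0 hB hpos
  have hg := h.hg.nu_pos h.g0 hB hpos
  rw [Delta]
  rcases (h.mem_rootsAt.1 hξ).1 with hS | hT
  · have h1 : rootsAt f B c = {ξ} := by
      ext η
      refine ⟨fun hη => huniq η ⟨isRoot_mul_iff.2 (.inl hη.1), hη.2⟩, ?_⟩
      rintro rfl
      exact ⟨h.hf.isRoot_iff.2 hS, hξ.2⟩
    have h2 : rootsAt g B c = ∅ := by
      refine Set.eq_empty_of_forall_notMem fun η hη => ?_
      have := huniq η ⟨isRoot_mul_iff.2 (.inr hη.1), hη.2⟩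
      rw [this] at hη
      exact Finset.disjoint_left.1 h.disj hS (h.hg.isRoot_iff.1 hη.1)
    rw [h1, h2, Set.ncard_singleton, Set.ncard_empty]
    simp [hg.ne']
  · have h1 : rootsAt g B c = {ξ} := by
      ext η
      refine ⟨fun hη => huniq η ⟨isRoot_mul_iff.2 (.inr hη.1), hη.2⟩, ?_⟩
      rintro rfl
      exact ⟨h.hg.isRoot_iff.2 hT, hξ.2⟩
    have h2 : rootsAt f B c = ∅ := by
      refine Set.eq_empty_of_forall_notMem fun η hη => ?_
      have := huniq η ⟨isRoot_mul_iff.2 (.inl hη.1), hη.2⟩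
      rw [this] at hη
      exact Finset.disjoint_left.1 h.disj (h.hf.isRoot_iff.1 hη.1) hT
    rw [h1, h2, Set.ncard_singleton, Set.ncard_empty]
    simp [hf.ne']

end Setup

/-! ### Paths in the tree along an arc -/

/-- One step up in the tree, along the arc `ξ`. -/
def Step (f g : Conv) (ξ : K) (X Y : Bar) : Prop := ∃ c, IsPostbar f g X c Y ∧ Climbs ξ Y

/-- One step up in the tree from a collinear bar, along the arc `ξ`. -/
def CStep (f g : Conv) (ξ : K) (X Y : Bar) : Prop := IsCollinear f g X ∧ Step f g ξ X Y

section Step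

variable {f g : Conv} {ξ : K}

theorem Step.climbs {X Y : Bar} (h : Step f g ξ X Y) : Climbs ξ X ∧ X.height < Y.height := by
  obtain ⟨c, hp, hξ⟩ := h
  exact ⟨(hp.climbsAt hξ).climbs, hp.height_lt⟩

/-- An arc climbs over a bar at one point only, and a point supports at most one postbar. The steps
along an arc are therefore deterministic, and the bars over which it climbs form a chain. -/
theorem Step.eq {X Y Y' : Bar} (h : Step f g ξ X Y) (h' : Step f g ξ X Y') : Y = Y' := by
  obtain ⟨c, hp, hξ⟩ := h
  obtain ⟨c', hp', hξ'⟩ := h'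
  obtain rfl := (hp.climbsAt hξ).unique (hp'.climbsAt hξ')
  exact hp.eq hp'

theorem eq_or_lt_of_path {X Y : Bar} (h : Relation.ReflTransGen (Step f g ξ) X Y) :
    X = Y ∨ X.height < Y.height := by
  induction h with
  | refl => exact .inl rfl
  | tail _ h ih =>
    rcases ih with rfl | ih
    · exact .inr h.climbs.2
    · exact .inr (ih.trans h.climbs.2)

theorem path_of_climbs {Y : Bar} (hY : IsBar f g Y) (hξ : Climbs ξ Y) :
    Relation.ReflTransGen (Step f g ξ) groundBar Y := by
  induction hY with
  | ground => exact .refl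
  | post B c B' _ hp ih => exact (ih (hp.climbsAt hξ).climbs).tail ⟨c, hp, hξ⟩

theorem path_of_le {X Y : Bar} (hX : IsBar f g X) (hY : IsBar f g Y) (hξX : Climbs ξ X)
    (hξY : Climbs ξ Y) (hle : X.height ≤ Y.height) :
    Relation.ReflTransGen (Step f g ξ) X Y := by
  rcases Relation.ReflTransGen.total_of_right_unique (fun _ _ _ h h' => h.eq h')
    (path_of_climbs hX hξX) (path_of_climbs hY hξY) with h | h
  · exact h
  · rcases eq_or_lt_of_path h with rfl | h
    · exact .refl
    · exact absurd hle (not_le.2 h)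

theorem bar_eq_of_height_eq {X Y : Bar} (hX : IsBar f g X) (hY : IsBar f g Y) (hξX : Climbs ξ X)
    (hξY : Climbs ξ Y) (hh : X.height = Y.height) : X = Y :=
  (eq_or_lt_of_path (path_of_le hX hY hξX hξY hh.le)).resolve_right (by rw [hh]; exact lt_irrefl _)

theorem CStep.eq {X Y Y' : Bar} (h : CStep f g ξ X Y) (h' : CStep f g ξ X Y') : Y = Y' :=
  h.2.eq h'.2

/-- A path of collinear steps that ends in a bar over which `ξ` climbs follows `ξ`. -/
theorem cpath_of_climbs {X Y : Bar} (h : Relation.ReflTransGen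
    (fun X Y => IsCollinear f g X ∧ ∃ a : ℂ, IsPostbar f g X a Y) X Y) (hξ : Climbs ξ Y) :
    Relation.ReflTransGen (CStep f g ξ) X Y := by
  induction h with
  | refl => exact .refl
  | tail _ h ih =>
    obtain ⟨h1, c, hp⟩ := h
    exact (ih (hp.climbsAt hξ).climbs).tail ⟨h1, c, hp, hξ⟩

theorem path_of_cpath {X Y : Bar} (h : Relation.ReflTransGen (CStep f g ξ) X Y) :
    Relation.ReflTransGen (fun X Y => IsCollinear f g X ∧ ∃ a : ℂ, IsPostbar f g X a Y) X Y :=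
  Relation.ReflTransGen.mono (r := CStep f g ξ)
    (fun _ _ h => ⟨h.1, h.2.imp fun _ h => h.1⟩) X Y h

/-- The bars on a collinear path are collinear, except possibly the last one. -/
theorem isCollinear_of_cpath {X Y Z : Bar} (h : Relation.ReflTransGen (CStep f g ξ) X Y)
    (hZ : Relation.ReflTransGen (Step f g ξ) X Z) (hlt : Z.height < Y.height) :
    IsCollinear f g Z := by
  induction h using Relation.ReflTransGen.head_induction_on with
  | refl =>
    rcases eq_or_lt_of_path hZ with rfl | h
    · exact absurd hlt (lt_irrefl _)
    · exact absurd hlt h.not_gt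
  | head h _ ih =>
    rcases hZ.cases_head with rfl | ⟨W, hW, hZ⟩
    · exact h.1
    · rw [hW.eq h.2] at hZ
      exact ih hZ

theorem LiesAbove.climbs {B B' : Bar} (h : LiesAbove f g B B') :
    B'.height < B.height ∧ ∀ ξ, Climbs ξ B → Climbs ξ B' := by
  unfold LiesAbove at h
  induction h with
  | single h =>
    obtain ⟨c, hp⟩ := h
    exact ⟨hp.height_lt, fun ξ hξ => (hp.climbsAt hξ).climbs⟩
  | tail _ h ih =>
    obtain ⟨c, hp⟩ := h
    exact ⟨ih.1.trans hp.height_lt, fun ξ hξ => ih.2 ξ (hp.climbsAt hξ).climbs⟩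

end Step

/-! ### The highest non-collinear bar under a polar root -/

/-- The arc `γ` climbs over the non-collinear bar `B` of positive height. -/
structure ClimbsNC (f g : Conv) (γ : K) (B : Bar) : Prop where
  isBar : IsBar f g B
  not_collinear : ¬ IsCollinear f g B
  pos : 0 < B.height
  climbs : Climbs γ B

/-- `B` is the highest non-collinear bar of positive height over which `γ` climbs. -/
structure IsTop (f g : Conv) (γ : K) (B : Bar) : Prop extends ClimbsNC f g γ B where
  max : ∀ B', ClimbsNC f g γ B' → B'.height ≤ B.height

theorem IsTop.eq {f g : Conv} {γ : K} {B B' : Bar} (h : IsTop f g γ B) (h' : IsTop f g γ B') :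
    B = B' :=
  bar_eq_of_height_eq h.isBar h'.isBar h.climbs h'.climbs
    (le_antisymm (h'.max B h.toClimbsNC) (h.max B' h'.toClimbsNC))

namespace Setup

variable {f g : Conv} {a b : ℕ} {S T : Finset K} {u v : Convˣ}

/-- A bar other than the ground bar is determined by two of the finitely many roots: its height is
their contact order and its series a truncation of one of them. -/
theorem finite_isBar (h : Setup f g a b S T u v) : {B | IsBar f g B}.Finite := by
  classical
  have hfin := finite_isRoot h.mul_ne_zero
  refine ((Set.finite_singleton groundBar).union (Set.Finite.image2
    (fun ξ η : K => (⟨HahnSeries.truncLT (ξ - η).order ξ, (ξ - η).order⟩ : Bar)) hfin hfin)).subset ?_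
  intro B' hB'
  rcases hB' with _ | ⟨B, c, _, hB, hp⟩
  · exact .inl rfl
  · right
    obtain ⟨ξ, hξ, η, hη, e⟩ := hp.1
    refine ⟨ξ, hξ.1, η, hη.1, ?_⟩
    have hne : ξ - η ≠ 0 := by
      intro h0
      rw [h0, HahnSeries.orderTop_zero] at e
      exact WithTop.top_ne_coe e
    have e' : (ξ - η).order = B'.height :=
      WithTop.coe_eq_coe.1 ((HahnSeries.order_eq_orderTop_of_ne_zero hne).trans e)
    have e2 := hp.2.2 ξ hξ
    cases B'
    simp only at e' e2
    simp only [e', e2]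

theorem exists_max_bar (h : Setup f g a b S T u v) {p : Bar → Prop}
    (hp : ∀ B, p B → IsBar f g B) (hex : ∃ B, p B) :
    ∃ B, p B ∧ ∀ B', p B' → B'.height ≤ B.height := by
  obtain ⟨B, hB, hmax⟩ := Set.exists_max_image {B | p B} Bar.height
    (h.finite_isBar.subset fun B hB => hp B hB) hex
  exact ⟨B, hB, hmax⟩

theorem exists_min_bar (h : Setup f g a b S T u v) {p : Bar → Prop}
    (hp : ∀ B, p B → IsBar f g B) (hex : ∃ B, p B) :
    ∃ B, p B ∧ ∀ B', p B' → B.height ≤ B'.height := by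
  obtain ⟨B, hB, hmin⟩ := Set.exists_min_image {B | p B} Bar.height
    (h.finite_isBar.subset fun B hB => hp B hB) hex
  exact ⟨B, hB, hmin⟩

theorem exists_isTop (h : Setup f g a b S T u v) {γ : K} (hex : ∃ B, ClimbsNC f g γ B) :
    ∃ B, IsTop f g γ B := by
  obtain ⟨B, hB, hmax⟩ := h.exists_max_bar (fun _ hB => hB.isBar) hex
  exact ⟨B, hB, hmax⟩

/-- A polar root cannot stop where Δ ≠ 0, and the postbar it must climb over inherits
non-collinearity. On its highest non-collinear bar a polar root thus sits at a point with Δ = 0. -/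
theorem exists_postbar_of_polar (h : Setup f g a b S T u v) {B : Bar} (hB : IsBar f g B) {c : ℂ}
    {γ : K} (hγ : γ ∈ polarRoots f g) (hc : ClimbsAt γ B c) (hd : Delta f g B c ≠ 0) :
    ∃ B', ClimbsNC f g γ B' ∧ B.height < B'.height := by
  by_contra hn
  refine hd (h.delta_eq_zero_of_polar hB.good hγ hc fun B' hp hγ' => hn ⟨B', ?_, hp.height_lt⟩)
  exact ⟨.post B c B' hB hp, h.not_isCollinear_postbar hB hp hd,
    hB.good.nonneg.trans_lt hp.height_lt, hγ'⟩

/-- A lowest non-collinear bar under γ is minimal in the tree, since everything below it also lies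
under γ. The ground bar needs care: every arc of positive order climbs over it, at 0. If it is
non-collinear, then Δ ≠ 0 at 0, every polar root climbs over a non-collinear bar of positive height,
and both sides are empty. -/
theorem mem_groundRoots (h : Setup f g a b S T u v) {γ : K} :
    γ ∈ groundRoots f g ↔ γ ∈ polarRoots f g ∧ ∀ B, ¬ ClimbsNC f g γ B := by
  refine and_congr_right fun hγ => ⟨fun hb B hB => ?_, fun hn B hB => ?_⟩
  · obtain ⟨B₀, ⟨h1, h2, h3⟩, hmin⟩ := h.exists_min_bar
      (p := fun B => IsBar f g B ∧ ¬ IsCollinear f g B ∧ Climbs γ B) (fun _ hB => hB.1)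
      ⟨B, hB.isBar, hB.not_collinear, hB.climbs⟩
    refine boundedBy_iff.1 (hb B₀ ⟨h1, h2, fun B' hB' hl => ?_⟩) h3
    by_contra hn
    exact absurd (hmin B' ⟨hB', hn, hl.climbs.2 γ h3⟩) (not_le.2 hl.climbs.1)
  · rw [boundedBy_iff]
    intro hc
    rcases hB.1.good.nonneg.lt_or_eq with h0 | h0
    · exact hn B ⟨hB.1, hB.2.1, h0, hc⟩
    · obtain rfl := hB.1.good.arc_eq_zero h0.symm
      have h1 := hB.2.1
      unfold IsCollinear at h1
      push Not at h1
      obtain ⟨c, ⟨ξ, hξ⟩, hd⟩ := h1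
      obtain rfl := hξ.2.unique (climbsAt_ground hξ.1.2.1)
      obtain ⟨B', hB', -⟩ := h.exists_postbar_of_polar hB.1 hγ (climbsAt_ground hγ.1.2.1) hd
      exact hn B' hB'

/-- A higher bar under γ would be reached through a postbar supported at c, which requires a trunk
at c. -/
theorem _root_.PolarTree.ClimbsNC.isTop_of_leaves {γ : K} {B : Bar}
    (hB : ClimbsNC f g γ B) {c : ℂ} (hc : ClimbsAt γ B c) (hct : c ∉ trunkPoints f g B) : IsTop f g γ B := by
  refine ⟨hB, fun B' hB' => ?_⟩
  by_contra hlt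
  rw [not_le] at hlt
  rcases (path_of_le hB.isBar hB'.isBar hB.climbs hB'.climbs hlt.le).cases_head with rfl |
    ⟨W, ⟨c', hp, hW⟩, -⟩
  · exact lt_irrefl _ hlt
  · obtain rfl := hc.unique (hp.climbsAt hW)
    exact hct hp.exists_mem

/-- Follow ξ upwards through collinear bars. The path can always be continued, because at positive
height a point that supports no postbar carries a single root and is non-collinear; as there are
finitely many bars, it ends at a non-collinear one. -/
theorem exists_cpath (h : Setup f g a b S T u v) {X : Bar} (hX : IsBar f g X) (hpos : 0 < X.height)
    {ξ : K} (hξ : IsRoot (f * g) ξ) (hc : Climbs ξ X) :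
    ∃ Y, IsBar f g Y ∧ ¬ IsCollinear f g Y ∧ Climbs ξ Y ∧
      Relation.ReflTransGen (CStep f g ξ) X Y := by
  obtain ⟨Y, ⟨h1, h2, h3, h4⟩, hmax⟩ := h.exists_max_bar
    (p := fun Y => IsBar f g Y ∧ Climbs ξ Y ∧ X.height ≤ Y.height ∧
      Relation.ReflTransGen (CStep f g ξ) X Y) (fun _ hY => hY.1) ⟨X, hX, hc, le_rfl, .refl⟩
  refine ⟨Y, h1, fun hcol => ?_, h2, h4⟩
  obtain ⟨c, hcY⟩ := h2
  have hmem : ξ ∈ rootsAt (f * g) Y c := ⟨hξ, hcY⟩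
  have hex : ∃ Y', IsPostbar f g Y c Y' := by
    by_contra hn
    push Not at hn
    exact h.delta_ne_zero_of_single h1.good (hpos.trans_le h3) ⟨ξ, hmem⟩ hn (hcol c ⟨ξ, hmem⟩)
  obtain ⟨Y', hY'⟩ := hex
  have := hmax Y' ⟨.post Y c Y' h1 hY', hY'.climbs hmem, h3.trans hY'.height_lt.le,
    h4.tail ⟨hcol, c, hY', hY'.climbs hmem⟩⟩
  exact absurd this (not_le.2 hY'.height_lt)

/-- Every collinear point of a bar of positive height has a cover, whose bars lie above it. -/
theorem exists_isCover (h : Setup f g a b S T u v) {B : Bar} (hB : IsBar f g B)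
    (hpos : 0 < B.height) {c : ℂ} (hc : c ∈ collinearPoints f g B) :
    ∃ S, IsCover f g B c S ∧ ∀ B' ∈ S, IsBar f g B' ∧ ¬ IsCollinear f g B' ∧
      B.height < B'.height := by
  have hex : ∃ B₁, IsPostbar f g B c B₁ := by
    by_contra hn
    push Not at hn
    exact h.delta_ne_zero_of_single hB.good hpos hc.1 hn hc.2
  obtain ⟨B₁, hB₁⟩ := hex
  have hbar {X Y : Bar} (hp : Relation.ReflTransGen (fun X Y => IsCollinear f g X ∧
      ∃ a : ℂ, IsPostbar f g X a Y) X Y) (hX : IsBar f g X) :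
      IsBar f g Y ∧ X.height ≤ Y.height := by
    induction hp with
    | refl => exact ⟨hX, le_rfl⟩
    | tail _ h ih =>
      obtain ⟨-, a, hp⟩ := h
      exact ⟨.post _ a _ ih.1 hp, ih.2.trans hp.height_lt.le⟩
  have hb1 : IsBar f g B₁ := .post B c B₁ hB hB₁
  refine ⟨{B' | ¬ IsCollinear f g B' ∧ Relation.ReflTransGen (fun X Y => IsCollinear f g X ∧
      ∃ a : ℂ, IsPostbar f g X a Y) B₁ B'}, ⟨fun B' h' => h'.1, fun B' h' => ⟨B₁, hB₁, h'.2⟩, ?_⟩,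
    fun B' h' => ⟨(hbar h'.2 hb1).1, h'.1, hB₁.height_lt.trans_le (hbar h'.2 hb1).2⟩⟩
  intro ξ hξ
  obtain ⟨Y, -, h2, h3, h4⟩ := h.exists_cpath hb1 (hpos.trans hB₁.height_lt) hξ.1 (hB₁.climbs hξ)
  refine ⟨Y, ⟨⟨h2, path_of_cpath h4⟩, h3⟩, ?_⟩
  rintro Y' ⟨⟨h5, h6⟩, h7⟩
  -- Both bars lie on the path along ξ and are comparable. No collinear step starts at a
  -- non-collinear bar, so the lower one is the end of the path and the two coincide.
  rcases Relation.ReflTransGen.total_of_right_unique (fun _ _ _ h h' => h.eq h') h4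
    (cpath_of_climbs h6 h7) with h8 | h8
  · rcases h8.cases_head with rfl | ⟨W, hW, -⟩
    · rfl
    · exact absurd hW.1 h2
  · rcases h8.cases_head with rfl | ⟨W, hW, -⟩
    · rfl
    · exact absurd hW.1 h5

/-- Suppose γ climbs over a higher non-collinear bar B₂. Choose a root ξ over B₂ and the cover bar
B' under ξ. If B' is not higher than B₂, then γ climbs over B' along with ξ, contrary to being
bounded. If it is higher, B₂ lies on the path to B' before its end and would be collinear. -/
theorem _root_.PolarTree.ClimbsNC.isTop_of_cover {γ : K} {B : Bar}
    (hB : ClimbsNC f g γ B) {c : ℂ} (hc : ClimbsAt γ B c) {U : Set Bar} (hU : IsCover f g B c U)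
    (hb : ∀ B' ∈ U, BoundedBy γ B') : IsTop f g γ B := by
  refine ⟨hB, fun B₂ hB₂ => ?_⟩
  by_contra hlt
  rw [not_le] at hlt
  have h1 := hB₂.not_collinear
  unfold IsCollinear at h1
  push Not at h1
  obtain ⟨c₂, ⟨ξ, hξ⟩, -⟩ := h1
  have hξB : ClimbsAt ξ B c := hc.of_vgt ((hξ.2.climbs.vge_sub hB₂.climbs).vgt hlt)
  obtain ⟨B', ⟨hB', hξB'⟩, -⟩ := hU.covers ξ ⟨hξ.1, hξB⟩
  rcases le_or_gt B'.height B₂.height with hle | hgt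
  · exact boundedBy_iff.1 (hb B' hB')
      (hξB'.of_vge ((hB₂.climbs.vge_sub hξ.2.climbs).mono hle))
  · obtain ⟨B₁, hB₁, hp⟩ := hU.minimal B' hB'
    have h2 := cpath_of_climbs hp hξB'
    refine hB₂.not_collinear (isCollinear_of_cpath h2 ?_ hgt)
    rcases (path_of_le hB.isBar hB₂.isBar hξB.climbs hξ.2.climbs hlt.le).cases_head with rfl |
      ⟨W, ⟨c', hW, hξW⟩, h3⟩
    · exact absurd hlt (lt_irrefl _)
    · obtain rfl := hξB.unique (hW.climbsAt hξW)
      rwa [hW.eq hB₁] at h3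

theorem _root_.PolarTree.mem_pRoots {𝔹 : Set Bar}
    (h𝔹 : ∀ B ∈ 𝔹, IsBar f g B ∧ ¬ IsCollinear f g B ∧ 0 < B.height) {γ : K} :
    γ ∈ pRoots f g 𝔹 ↔ γ ∈ polarRoots f g ∧ ∃ B ∈ 𝔹, IsTop f g γ B ∧
      ∃ c, ClimbsAt γ B c ∧ c ∉ trunkPoints f g B := by
  refine and_congr_right fun hγ => ⟨?_, ?_⟩
  · rintro ⟨B, hB, c, hc, hct⟩
    obtain ⟨h1, h2, h3⟩ := h𝔹 B hB
    exact ⟨B, hB, ClimbsNC.isTop_of_leaves ⟨h1, h2, h3, hc.climbs⟩ hc hct, c, hc, hct⟩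
  · rintro ⟨B, hB, -, c, hc, hct⟩
    exact ⟨B, hB, c, hc, hct⟩

/-- On its highest non-collinear bar a polar root sits at a point with Δ = 0, so a trunk point there
is collinear and has a cover. The bars of that cover are non-collinear and higher, so γ climbs over
none of them. -/
theorem mem_qRoots (h : Setup f g a b S T u v) {𝔹 : Set Bar}
    (h𝔹 : ∀ B ∈ 𝔹, IsBar f g B ∧ ¬ IsCollinear f g B ∧ 0 < B.height) {γ : K} :
    γ ∈ qRoots f g 𝔹 ↔ γ ∈ polarRoots f g ∧ ∃ B ∈ 𝔹, IsTop f g γ B ∧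
      ∃ c, ClimbsAt γ B c ∧ c ∈ trunkPoints f g B := by
  refine and_congr_right fun hγ => ⟨?_, ?_⟩
  · rintro ⟨B, hB, c, hcB, hc, U, hU, hb⟩
    obtain ⟨h1, h2, h3⟩ := h𝔹 B hB
    exact ⟨B, hB, ClimbsNC.isTop_of_cover ⟨h1, h2, h3, hc.climbs⟩ hc hU hb, c, hc, hcB.1⟩
  · rintro ⟨B, hB, htop, c, hc, hct⟩
    have hd : Delta f g B c = 0 := by
      by_contra hd
      obtain ⟨B', hB', hlt⟩ := h.exists_postbar_of_polar htop.isBar hγ hc hd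
      exact absurd (htop.max B' hB') (not_le.2 hlt)
    obtain ⟨U, hU, hU'⟩ := h.exists_isCover htop.isBar htop.pos ⟨hct, hd⟩
    refine ⟨B, hB, c, ⟨hct, hd⟩, hc, U, hU, fun B' hB' => ?_⟩
    obtain ⟨h1, h2, h3⟩ := hU' B' hB'
    rw [boundedBy_iff]
    intro h4
    exact absurd (htop.max B' ⟨h1, h2, htop.pos.trans h3, h4⟩) (not_le.2 h3)

end Setup

/-! ### Conjugation of bars and stability of the pieces -/

/-- The conjugate of a bar. -/
def twistBar (χ : AddChar ℚ ℂ) (B : Bar) : Bar := ⟨twist χ B.arc, B.height⟩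

theorem twistBar_twistBar (χ ψ : AddChar ℚ ℂ) (B : Bar) :
    twistBar χ (twistBar ψ B) = twistBar (χ * ψ) B := by
  simp only [twistBar, twist_twist]

theorem twistBar_one (B : Bar) : twistBar 1 B = B := by
  simp only [twistBar, twist_one]

theorem twistBar_inv (χ : AddChar ℚ ℂ) (B : Bar) : twistBar χ⁻¹ (twistBar χ B) = B := by
  rw [twistBar_twistBar, inv_mul_cancel, twistBar_one]

theorem inv_char_mul (χ : AddChar ℚ ℂ) (e : ℚ) (c : ℂ) : χ⁻¹ e * (χ e * c) = c := by
  rw [← mul_assoc, ← AddChar.mul_apply, inv_mul_cancel, AddChar.one_apply, one_mul]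

theorem ClimbsAt.twist {ξ : K} {B : Bar} {c : ℂ} (h : ClimbsAt ξ B c) (χ : AddChar ℚ ℂ) :
    ClimbsAt (twist χ ξ) (twistBar χ B) (χ B.height * c) := by
  unfold ClimbsAt
  change _ < (PolarTree.twist χ ξ - PolarTree.twist χ B.arc -
    HahnSeries.single B.height (χ B.height * c)).orderTop
  rw [← twist_single, ← map_sub, ← map_sub, orderTop_twist]
  exact h

theorem Climbs.twist {ξ : K} {B : Bar} (h : Climbs ξ B) (χ : AddChar ℚ ℂ) :
    Climbs (twist χ ξ) (twistBar χ B) := by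
  obtain ⟨c, hc⟩ := h
  exact ⟨_, hc.twist χ⟩

theorem HasLead.twist {x : K} {q : ℚ} {c : ℂ} (h : HasLead x q c) (χ : AddChar ℚ ℂ) :
    HasLead (PolarTree.twist χ x) q (χ q * c) :=
  ⟨vge_twist.2 h.1, by rw [coeff_twist, h.2]⟩

theorem contact_twist (χ : AddChar ℚ ℂ) (B : Bar) (η : K) :
    contact (twistBar χ B) (twist χ η) = contact B η := by
  by_cases h : Climbs η B
  · rw [contact_of_climbs h, contact_of_climbs (h.twist χ)]
    rfl
  · obtain ⟨h1, e, he, h2⟩ := exists_contact h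
    have h3 := h2.twist χ
    rw [map_sub] at h3
    exact contact_eq_of_hasLead (B := twistBar χ B) h3 (mul_ne_zero (twist_ne χ _) he) h1

theorem GoodBar.eq_truncLT {B : Bar} (hB : GoodBar B) {ξ : K} (h : Climbs ξ B) :
    B.arc = HahnSeries.truncLT B.height ξ := by
  ext e
  rcases lt_or_ge e B.height with he | he
  · have := climbs_iff.1 h e he
    rw [HahnSeries.coeff_sub, sub_eq_zero] at this
    rw [HahnSeries.coeff_truncLT_of_lt he, this]
  · rw [coeff_truncLT_of_le he, hB.coeff_eq_zero e he]

theorem mem_rootsAt_twist {χ : AddChar ℚ ℂ} (hχ : χ 1 = 1) {F : Conv} {B : Bar} {c : ℂ} {ξ : K}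
    (h : ξ ∈ rootsAt F B c) : twist χ ξ ∈ rootsAt F (twistBar χ B) (χ B.height * c) :=
  ⟨h.1.twist hχ, h.2.twist χ⟩

theorem rootsAt_twist {χ : AddChar ℚ ℂ} (hχ : χ 1 = 1) (F : Conv) (B : Bar) (c : ℂ) :
    rootsAt F (twistBar χ B) (χ B.height * c) = twist χ '' rootsAt F B c := by
  ext ξ
  constructor
  · intro h
    have h1 := mem_rootsAt_twist (inv_char_one hχ) h
    rw [twistBar_inv] at h1
    change twist χ⁻¹ ξ ∈ rootsAt F B (χ⁻¹ B.height * (χ B.height * c)) at h1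
    rw [inv_char_mul] at h1
    exact ⟨_, h1, twist_twist_inv χ ξ⟩
  · rintro ⟨η, hη, rfl⟩
    exact mem_rootsAt_twist hχ hη

theorem mem_trunkPoints_twist {χ : AddChar ℚ ℂ} (hχ : χ 1 = 1) {f g : Conv} {B : Bar} {c : ℂ} :
    χ B.height * c ∈ trunkPoints f g (twistBar χ B) ↔ c ∈ trunkPoints f g B := by
  change (rootsAt _ _ _).Nonempty ↔ (rootsAt _ _ _).Nonempty
  rw [rootsAt_twist hχ, Set.image_nonempty]

theorem IsPostbar.twist {χ : AddChar ℚ ℂ} (hχ : χ 1 = 1) {f g : Conv} {B B' : Bar} {c : ℂ}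
    (h : IsPostbar f g B c B') :
    IsPostbar f g (twistBar χ B) (χ B.height * c) (twistBar χ B') := by
  rw [IsPostbar, rootsAt_twist hχ]
  obtain ⟨⟨ξ, hξ, η, hη, e⟩, h2, h3⟩ := h
  refine ⟨⟨_, ⟨ξ, hξ, rfl⟩, _, ⟨η, hη, rfl⟩, ?_⟩, ?_, ?_⟩
  · rw [← map_sub, orderTop_twist]
    exact e
  · rintro _ ⟨ξ, hξ, rfl⟩ _ ⟨η, hη, rfl⟩
    rw [← map_sub, orderTop_twist]
    exact h2 ξ hξ η hη
  · rintro _ ⟨ξ, hξ, rfl⟩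
    change PolarTree.twist χ B'.arc = _
    rw [h3 ξ hξ, ← truncLT_twist]
    rfl

theorem IsBar.twist {χ : AddChar ℚ ℂ} (hχ : χ 1 = 1) {f g : Conv} {B : Bar} (h : IsBar f g B) :
    IsBar f g (twistBar χ B) := by
  induction h with
  | ground =>
    have : twistBar χ groundBar = groundBar := by simp only [twistBar, groundBar, map_zero]
    rw [this]
    exact .ground
  | post B c B' _ hp ih => exact .post _ _ _ ih (hp.twist hχ)

/-- Conjugation permutes the roots and carries contacts with B to contacts with the conjugate bar,
so the two sums agree term by term. -/
theorem Splitting.nu_twist {F : Conv} {E : ℕ} {S : Finset K} {u : Convˣ} (h : Splitting F E S u)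
    {χ : AddChar ℚ ℂ} (hχ : χ 1 = 1) {B : Bar} (hB : GoodBar B) (hB' : GoodBar (twistBar χ B)) :
    nu F (twistBar χ B) = nu F B := by
  rw [h.nu_eq hB, h.nu_eq hB']
  congr 1
  symm
  refine Finset.sum_nbij' (twist χ) (twist χ⁻¹) ?_ ?_ ?_ ?_ ?_
  · intro η hη
    exact h.isRoot_iff.1 ((h.isRoot_iff.2 hη).twist hχ)
  · intro η hη
    exact h.isRoot_iff.1 ((h.isRoot_iff.2 hη).twist (inv_char_one hχ))
  · exact fun η _ => twist_inv_twist χ η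
  · exact fun η _ => twist_twist_inv χ η
  · exact fun η _ => (contact_twist χ B η).symm

theorem polarRoots_twist {χ : AddChar ℚ ℂ} (hχ : χ 1 = 1) {f g : Conv} {γ : K}
    (h : γ ∈ polarRoots f g) : twist χ γ ∈ polarRoots f g := by
  refine ⟨h.1.twist hχ, ?_⟩
  rw [twist_evalArc hχ f h.1.2.1, twist_evalArc hχ g h.1.2.1, ← map_mul, Ne, twist_eq_zero]
  exact h.2

namespace Setup

variable {f g : Conv} {a b : ℕ} {S T : Finset K} {u v : Convˣ} {χ : AddChar ℚ ℂ}

theorem delta_twist (h : Setup f g a b S T u v) (hχ : χ 1 = 1) {B : Bar} (hB : IsBar f g B)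
    (c : ℂ) : Delta f g (twistBar χ B) (χ B.height * c) = Delta f g B c := by
  rw [Delta, Delta, h.hf.nu_twist hχ hB.good (hB.twist hχ).good,
    h.hg.nu_twist hχ hB.good (hB.twist hχ).good, rootsAt_twist hχ, rootsAt_twist hχ,
    Set.ncard_image_of_injective _ (twist_injective χ),
    Set.ncard_image_of_injective _ (twist_injective χ)]

theorem not_isCollinear_twist (h : Setup f g a b S T u v) (hχ : χ 1 = 1) {B : Bar}
    (hB : IsBar f g B) (hn : ¬ IsCollinear f g B) : ¬ IsCollinear f g (twistBar χ B) := by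
  intro h1
  refine hn fun c hc => ?_
  rw [← h.delta_twist hχ hB]
  exact h1 _ ((mem_trunkPoints_twist hχ).2 hc)

theorem climbsNC_twist (h : Setup f g a b S T u v) (hχ : χ 1 = 1) {B : Bar} {γ : K}
    (hB : ClimbsNC f g γ B) : ClimbsNC f g (twist χ γ) (twistBar χ B) :=
  ⟨hB.isBar.twist hχ, h.not_isCollinear_twist hχ hB.isBar hB.not_collinear, hB.pos,
    hB.climbs.twist χ⟩

theorem isTop_twist (h : Setup f g a b S T u v) (hχ : χ 1 = 1) {B : Bar} {γ : K}
    (hB : IsTop f g γ B) : IsTop f g (twist χ γ) (twistBar χ B) := by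
  refine ⟨h.climbsNC_twist hχ hB.toClimbsNC, fun B' hB' => ?_⟩
  have h1 := h.climbsNC_twist (inv_char_one hχ) hB'
  rw [twist_inv_twist] at h1
  have h2 := hB.max (twistBar χ⁻¹ B') h1
  exact h2

theorem _root_.PolarTree.IsBar.exists_root_climbs {B : Bar} (hB : IsBar f g B)
    (hpos : 0 < B.height) : ∃ ξ, IsRoot (f * g) ξ ∧ Climbs ξ B := by
  rcases hB with _ | ⟨B₀, c, _, hB₀, hp⟩
  · exact absurd hpos (lt_irrefl _)
  · obtain ⟨ξ, hξ⟩ := hp.exists_mem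
    exact ⟨ξ, hξ.1, hp.climbs hξ⟩

/-- Roots of an irreducible series differ by a character trivial on 1, and a bar is recovered from
its height and any arc over it by truncation. Conversely, some root of fg climbs over B, and it is a
root of an irreducible series together with all its conjugates. -/
theorem conjugate_iff (h : Setup f g a b S T u v) {B B' : Bar} (hB : IsBar f g B)
    (hpos : 0 < B.height) (hB' : IsBar f g B') :
    Conjugate B B' ↔ ∃ χ : AddChar ℚ ℂ, χ 1 = 1 ∧ B' = twistBar χ B := by
  constructor
  · rintro ⟨hh, p, hp, ⟨ξ, hξ, hξB⟩, ξ', hξ', hξB'⟩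
    obtain ⟨χ, hχ, rfl⟩ := exists_twist_of_irreducible hp hξ hξ'
    refine ⟨χ, hχ, ?_⟩
    have e := hB'.good.eq_truncLT hξB'
    rw [← hh, truncLT_twist, ← hB.good.eq_truncLT hξB] at e
    cases B'
    simp only at e hh
    rw [e, ← hh]
    rfl
  · rintro ⟨χ, hχ, rfl⟩
    obtain ⟨ξ, hξ, hξB⟩ := hB.exists_root_climbs hpos
    obtain ⟨p, hp, hpξ⟩ := exists_irreducible h.mul_ne_zero hξ
    exact ⟨rfl, p, hp, ⟨ξ, hpξ, hξB⟩, _, hpξ.twist hχ, hξB.twist χ⟩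

theorem mem_conjClass (h : Setup f g a b S T u v) {B B' : Bar} (hB : IsBar f g B)
    (hpos : 0 < B.height) :
    B' ∈ conjClass f g B ↔ ∃ χ : AddChar ℚ ℂ, χ 1 = 1 ∧ B' = twistBar χ B := by
  constructor
  · rintro ⟨h1, h2⟩
    exact (h.conjugate_iff hB hpos h1).1 h2
  · intro h1
    have hB' : IsBar f g B' := by
      obtain ⟨χ, hχ, rfl⟩ := h1
      exact hB.twist hχ
    exact ⟨hB', (h.conjugate_iff hB hpos hB').2 h1⟩

theorem classes_isBar (h : Setup f g a b S T u v) {𝔹 : Set Bar}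
    (h𝔹 : 𝔹 ∈ nonCollinearClasses f g) {B : Bar} (hB : B ∈ 𝔹) :
    IsBar f g B ∧ ¬ IsCollinear f g B ∧ 0 < B.height := by
  obtain ⟨B₀, h1, h2, h3, rfl⟩ := h𝔹
  obtain ⟨χ, hχ, rfl⟩ := (h.mem_conjClass h1 h3).1 hB
  exact ⟨h1.twist hχ, h.not_isCollinear_twist hχ h1 h2, h3⟩

theorem classes_twist (h : Setup f g a b S T u v) {𝔹 : Set Bar}
    (h𝔹 : 𝔹 ∈ nonCollinearClasses f g) (hχ : χ 1 = 1) {B : Bar} (hB : B ∈ 𝔹) :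
    twistBar χ B ∈ 𝔹 := by
  obtain ⟨B₀, h1, h2, h3, rfl⟩ := h𝔹
  obtain ⟨ψ, hψ, rfl⟩ := (h.mem_conjClass h1 h3).1 hB
  exact (h.mem_conjClass h1 h3).2 ⟨χ * ψ, mul_char_one hχ hψ, twistBar_twistBar χ ψ B₀⟩

theorem mem_own_class (h : Setup f g a b S T u v) {B : Bar} (hB : IsBar f g B)
    (hpos : 0 < B.height) : B ∈ conjClass f g B :=
  (h.mem_conjClass hB hpos).2 ⟨1, by simp, (twistBar_one B).symm⟩

theorem class_eq (h : Setup f g a b S T u v) {𝔹 : Set Bar} (h𝔹 : 𝔹 ∈ nonCollinearClasses f g)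
    {B : Bar} (hB : B ∈ 𝔹) : 𝔹 = conjClass f g B := by
  have h4 := h.classes_isBar h𝔹 hB
  ext B'
  rw [h.mem_conjClass h4.1 h4.2.2]
  constructor
  · intro hB'
    obtain ⟨B₀, h1, h2, h3, rfl⟩ := h𝔹
    obtain ⟨χ, hχ, rfl⟩ := (h.mem_conjClass h1 h3).1 hB
    obtain ⟨ψ, hψ, rfl⟩ := (h.mem_conjClass h1 h3).1 hB'
    refine ⟨ψ * χ⁻¹, mul_char_one hψ (inv_char_one hχ), ?_⟩
    rw [twistBar_twistBar, inv_mul_cancel_right]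
  · rintro ⟨χ, hχ, rfl⟩
    exact h.classes_twist h𝔹 hχ hB

theorem finite_classes (h : Setup f g a b S T u v) : (nonCollinearClasses f g).Finite := by
  refine (h.finite_isBar.image (conjClass f g)).subset ?_
  rintro 𝔹 ⟨B, hB, -, -, rfl⟩
  exact ⟨B, hB, rfl⟩

theorem groundRoots_twist (h : Setup f g a b S T u v) (hχ : χ 1 = 1) {γ : K}
    (hγ : γ ∈ groundRoots f g) : twist χ γ ∈ groundRoots f g := by
  rw [h.mem_groundRoots] at hγ ⊢
  refine ⟨polarRoots_twist hχ hγ.1, fun B hB => ?_⟩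
  have := h.climbsNC_twist (inv_char_one hχ) hB
  rw [twist_inv_twist] at this
  exact hγ.2 _ this

theorem pRoots_twist (h : Setup f g a b S T u v) {𝔹 : Set Bar}
    (h𝔹 : 𝔹 ∈ nonCollinearClasses f g) (hχ : χ 1 = 1) {γ : K} (hγ : γ ∈ pRoots f g 𝔹) :
    twist χ γ ∈ pRoots f g 𝔹 := by
  obtain ⟨h1, B, hB, c, hc, hct⟩ := hγ
  exact ⟨polarRoots_twist hχ h1, _, h.classes_twist h𝔹 hχ hB, _, hc.twist χ,
    fun h2 => hct ((mem_trunkPoints_twist hχ).1 h2)⟩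

theorem qRoots_twist (h : Setup f g a b S T u v) {𝔹 : Set Bar}
    (h𝔹 : 𝔹 ∈ nonCollinearClasses f g) (hχ : χ 1 = 1) {γ : K} (hγ : γ ∈ qRoots f g 𝔹) :
    twist χ γ ∈ qRoots f g 𝔹 := by
  rw [h.mem_qRoots fun B hB => h.classes_isBar h𝔹 hB] at hγ ⊢
  obtain ⟨h1, B, hB, htop, c, hc, hct⟩ := hγ
  exact ⟨polarRoots_twist hχ h1, _, h.classes_twist h𝔹 hχ hB, h.isTop_twist hχ htop, _,
    hc.twist χ, (mem_trunkPoints_twist hχ).2 hct⟩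

/-- The polar roots that belong to a conjugacy class. -/
theorem mem_pRoots_union_qRoots (h : Setup f g a b S T u v) {𝔹 : Set Bar}
    (h𝔹 : 𝔹 ∈ nonCollinearClasses f g) {γ : K} :
    γ ∈ pRoots f g 𝔹 ∪ qRoots f g 𝔹 ↔ γ ∈ polarRoots f g ∧ ∃ B ∈ 𝔹, IsTop f g γ B := by
  have h1 : ∀ B ∈ 𝔹, _ := fun B hB => h.classes_isBar h𝔹 hB
  rw [Set.mem_union, PolarTree.mem_pRoots h1, h.mem_qRoots h1]
  constructor
  · rintro (⟨h2, B, hB, h3, -⟩ | ⟨h2, B, hB, h3, -⟩)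
    · exact ⟨h2, B, hB, h3⟩
    · exact ⟨h2, B, hB, h3⟩
  · rintro ⟨h2, B, hB, h3⟩
    obtain ⟨c, hc⟩ := h3.climbs
    by_cases hct : c ∈ trunkPoints f g B
    · exact .inr ⟨h2, B, hB, h3, c, hc, hct⟩
    · exact .inl ⟨h2, B, hB, h3, c, hc, hct⟩

theorem disjoint_pRoots_qRoots (h : Setup f g a b S T u v) {𝔹 : Set Bar}
    (h𝔹 : 𝔹 ∈ nonCollinearClasses f g) : Disjoint (pRoots f g 𝔹) (qRoots f g 𝔹) := by
  have h1 : ∀ B ∈ 𝔹, _ := fun B hB => h.classes_isBar h𝔹 hB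
  rw [Set.disjoint_left]
  intro γ hP hQ
  rw [PolarTree.mem_pRoots h1] at hP
  rw [h.mem_qRoots h1] at hQ
  obtain ⟨-, B, hB, h2, c, hc, hct⟩ := hP
  obtain ⟨-, B', hB', h2', c', hc', hct'⟩ := hQ
  obtain rfl := h2.eq h2'
  obtain rfl := hc.unique hc'
  exact hct hct'

theorem disjoint_classes (h : Setup f g a b S T u v) :
    (nonCollinearClasses f g).PairwiseDisjoint fun 𝔹 => pRoots f g 𝔹 ∪ qRoots f g 𝔹 := by
  intro 𝔹 h𝔹 𝔹' h𝔹' hne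
  rw [Function.onFun, Set.disjoint_left]
  intro γ h1 h2
  rw [h.mem_pRoots_union_qRoots h𝔹] at h1
  rw [h.mem_pRoots_union_qRoots h𝔹'] at h2
  obtain ⟨-, B, hB, h3⟩ := h1
  obtain ⟨-, B', hB', h4⟩ := h2
  obtain rfl := h3.eq h4
  exact hne ((h.class_eq h𝔹 hB).trans (h.class_eq h𝔹' hB').symm)

/-- Polar roots are sorted by the class of their highest non-collinear bar of positive height, or go
to the ground when there is none. -/
theorem polarRoots_eq (h : Setup f g a b S T u v) : polarRoots f g =
    groundRoots f g ∪ ⋃ 𝔹 ∈ nonCollinearClasses f g, (pRoots f g 𝔹 ∪ qRoots f g 𝔹) := by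
  ext γ
  constructor
  · intro hγ
    by_cases hex : ∃ B, ClimbsNC f g γ B
    · obtain ⟨B, hB⟩ := h.exists_isTop hex
      have h𝔹 : conjClass f g B ∈ nonCollinearClasses f g :=
        ⟨B, hB.isBar, hB.not_collinear, hB.pos, rfl⟩
      refine .inr (Set.mem_biUnion h𝔹 ?_)
      exact (h.mem_pRoots_union_qRoots h𝔹).2 ⟨hγ, B, h.mem_own_class hB.isBar hB.pos, hB⟩
    · push Not at hex
      exact .inl (h.mem_groundRoots.2 ⟨hγ, hex⟩)
  · rintro (hγ | hγ)
    · exact hγ.1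
    · obtain ⟨𝔹, -, hγ⟩ := Set.mem_iUnion₂.1 hγ
      exact hγ.elim (fun h => h.1) fun h => h.1

theorem disjoint_groundRoots (h : Setup f g a b S T u v) : Disjoint (groundRoots f g)
    (⋃ 𝔹 ∈ nonCollinearClasses f g, (pRoots f g 𝔹 ∪ qRoots f g 𝔹)) := by
  rw [Set.disjoint_left]
  intro γ h1 h2
  obtain ⟨𝔹, h𝔹, hγ⟩ := Set.mem_iUnion₂.1 h2
  obtain ⟨-, B, -, hB⟩ := (h.mem_pRoots_union_qRoots h𝔹).1 hγ
  exact (h.mem_groundRoots.1 h1).2 B hB.toClimbsNC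

end Setup

/-! ### The factors of the Jacobian -/

namespace IsFactorization

variable {J W : Conv} {E : ℕ} {R : Multiset K} {w : Convˣ}

-- The counts in R are the multiplicities as roots of J, so grouping equal linear factors turns one
-- product into the other.
open Classical in
theorem finprod_eq (h : IsFactorization J E R W w) {U : Set K} (hU : ∀ γ ∈ U, IsRoot J γ) :
    ∏ᶠ γ ∈ U, (Polynomial.X - Polynomial.C γ) ^ rootMult J γ = rootPoly (R.filter (· ∈ U)) := by
  rw [rootPoly, Finset.prod_multiset_map_count]
  refine (finprod_mem_eq_prod_of_inter_mulSupport_eq _ ?_).trans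
    (Finset.prod_congr rfl fun γ hγ => ?_)
  · congr 1
    ext γ
    rw [Finset.mem_coe, Multiset.mem_toFinset, Multiset.mem_filter]
    exact ⟨fun hγ => ⟨h.isRoot_iff.1 (hU γ hγ), hγ⟩, fun hγ => hγ.2⟩
  · rw [Multiset.mem_toFinset, Multiset.mem_filter] at hγ
    rw [Multiset.count_filter_of_pos hγ.2, h.count γ (h.pos γ hγ.1)]

/-- Stability of U under `expChar` and its inverse makes membership in U invariant, so the
sub-multiset of roots in U is permuted by conjugation and its polynomial descends. -/
theorem exists_germ (h : IsFactorization J E R W w) {U : Set K} (hU : ∀ γ ∈ U, IsRoot J γ)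
    (ht : ∀ χ : AddChar ℚ ℂ, χ 1 = 1 → ∀ γ ∈ U, twist χ γ ∈ U) :
    ∃ F, IsGermOf (∏ᶠ γ ∈ U, (Polynomial.X - Polynomial.C γ) ^ rootMult J γ) F := by
  classical
  rw [h.finprod_eq hU]
  refine exists_isGermOf_rootPoly (fun ξ hξ => h.convArc ξ (Multiset.mem_filter.1 hξ).1) ?_
  conv_rhs => rw [← h.map_twist expChar_one, Multiset.filter_map]
  congr 1
  refine Multiset.filter_congr fun γ _ => ⟨ht _ expChar_one γ, fun hγ => ?_⟩
  have := ht _ (inv_char_one expChar_one) _ hγ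
  rwa [twist_inv_twist] at this

end IsFactorization

theorem isGermOf_finprod_mem {ι : Type*} {I : Set ι} (hI : I.Finite) {P : ι → K[X]} {F : ι → Conv}
    (h : ∀ i ∈ I, IsGermOf (P i) (F i)) : IsGermOf (∏ᶠ i ∈ I, P i) (∏ᶠ i ∈ I, F i) := by
  classical
  rw [finprod_mem_eq_finite_toFinset_prod _ hI, finprod_mem_eq_finite_toFinset_prod _ hI]
  have key (s : Finset ι) (hs : ∀ i ∈ s, i ∈ I) : IsGermOf (∏ i ∈ s, P i) (∏ i ∈ s, F i) := by
    induction s using Finset.induction_on with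
    | empty => simpa using isGermOf_one
    | insert i s hi ih =>
      rw [Finset.prod_insert hi, Finset.prod_insert hi]
      exact (h i (hs i (Finset.mem_insert_self _ _))).mul
        (ih fun j hj => hs j (Finset.mem_insert_of_mem hj))
  exact key _ fun i hi => hI.mem_toFinset.1 hi

namespace Setup

variable {f g : Conv} {a b : ℕ} {S T : Finset K} {u v : Convˣ}

theorem rootProd_polarRoots (h : Setup f g a b S T u v) (hfin : (polarRoots f g).Finite) :
    rootProd f g (polarRoots f g) = rootProd f g (groundRoots f g) *
      ∏ᶠ 𝔹 ∈ nonCollinearClasses f g, rootProd f g (pRoots f g 𝔹) * rootProd f g (qRoots f g 𝔹) := by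
  have hsub {U : Set K} (hU : U ⊆ polarRoots f g) : U.Finite := hfin.subset hU
  have hP (𝔹 : Set Bar) : (pRoots f g 𝔹).Finite := hsub fun γ hγ => hγ.1
  have hQ (𝔹 : Set Bar) : (qRoots f g 𝔹).Finite := hsub fun γ hγ => hγ.1
  have hN := h.finite_classes
  unfold rootProd
  conv_lhs => rw [h.polarRoots_eq]
  rw [finprod_mem_union h.disjoint_groundRoots (hsub fun γ hγ => hγ.1)
    (hN.biUnion fun 𝔹 _ => (hP 𝔹).union (hQ 𝔹)),
    finprod_mem_biUnion h.disjoint_classes hN fun 𝔹 _ => (hP 𝔹).union (hQ 𝔹)]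
  congr 1
  refine finprod_mem_congr rfl fun 𝔹 h𝔹 => ?_
  exact finprod_mem_union (h.disjoint_pRoots_qRoots h𝔹) (hP 𝔹) (hQ 𝔹)

/-- A root of fg is a witness, since J does not vanish along it; the assumption on J is needed only
when there are no roots. -/
theorem jac_ne_zero (h : Setup f g a b S T u v)
    (hJ : (∀ ξ, ¬ IsRoot (f * g) ξ) → PolarTree.jac f g ≠ 0) : PolarTree.jac f g ≠ 0 := by
  by_cases hex : ∃ ξ, IsRoot (f * g) ξ
  · obtain ⟨ξ, hξ⟩ := hex
    intro h0
    have := h.jac ξ (h.mem_roots.1 hξ)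
    rw [h0, evalArc_zero] at this
    exact this rfl
  · push Not at hex
    exact hJ hex

end Setup

end PolarTree

end

theorem theoremF (f g : PolarTree.Conv)
    (hf0 : PolarTree.coeffXY f 0 0 = 0) (hg0 : PolarTree.coeffXY g 0 0 = 0)
    (hf : f ≠ 0) (hg : g ≠ 0)
    (hsimple : ∀ ξ : PolarTree.K, PolarTree.IsRoot (f * g) ξ →
      PolarTree.rootMult (f * g) ξ = 1)
    (hJ : (∀ ξ : PolarTree.K, ¬ PolarTree.IsRoot (f * g) ξ) → PolarTree.jac f g ≠ 0) :
    (PolarTree.polarRoots f g).Finite ∧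
    (PolarTree.nonCollinearClasses f g).Finite ∧
    ∃ (Qground : PolarTree.Conv) (P Q : Set PolarTree.Bar → PolarTree.Conv),
      PolarTree.IsGermOf
        (PolarTree.rootProd f g (PolarTree.groundRoots f g)) Qground ∧
      (∀ 𝔹 ∈ PolarTree.nonCollinearClasses f g,
        PolarTree.IsGermOf (PolarTree.rootProd f g (PolarTree.pRoots f g 𝔹)) (P 𝔹) ∧
        PolarTree.IsGermOf (PolarTree.rootProd f g (PolarTree.qRoots f g 𝔹)) (Q 𝔹)) ∧
      ∃ (u : PolarTree.Convˣ) (E : ℕ),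
        PolarTree.jac f g = (u : PolarTree.Conv) * PolarTree.yVar ^ E * Qground *
          ∏ᶠ 𝔹 ∈ PolarTree.nonCollinearClasses f g, (P 𝔹 * Q 𝔹) := by
  classical
  obtain ⟨a, b, S, T, u, v, h⟩ := PolarTree.exists_setup hf0 hg0 hf hg hsimple
  have hJ0 := h.jac_ne_zero hJ
  have hfin : (PolarTree.polarRoots f g).Finite :=
    (PolarTree.finite_isRoot hJ0).subset fun γ hγ => hγ.1
  obtain ⟨E, R, W, w, hR⟩ := PolarTree.exists_factorization hJ0
  obtain ⟨Qg, hQg⟩ := hR.exists_germ (U := PolarTree.groundRoots f g) (fun γ hγ => hγ.1.1)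
    fun χ hχ γ hγ => h.groundRoots_twist hχ hγ
  have hP (𝔹 : Set PolarTree.Bar) : ∃ F, 𝔹 ∈ PolarTree.nonCollinearClasses f g →
      PolarTree.IsGermOf (PolarTree.rootProd f g (PolarTree.pRoots f g 𝔹)) F := by
    by_cases h𝔹 : 𝔹 ∈ PolarTree.nonCollinearClasses f g
    · obtain ⟨F, hF⟩ := hR.exists_germ (U := PolarTree.pRoots f g 𝔹) (fun γ hγ => hγ.1.1)
        fun χ hχ γ hγ => h.pRoots_twist h𝔹 hχ hγ
      exact ⟨F, fun _ => hF⟩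
    -- A default value off the set of classes, which the product never uses.
    · exact ⟨0, fun h' => absurd h' h𝔹⟩
  have hQ (𝔹 : Set PolarTree.Bar) : ∃ F, 𝔹 ∈ PolarTree.nonCollinearClasses f g →
      PolarTree.IsGermOf (PolarTree.rootProd f g (PolarTree.qRoots f g 𝔹)) F := by
    by_cases h𝔹 : 𝔹 ∈ PolarTree.nonCollinearClasses f g
    · obtain ⟨F, hF⟩ := hR.exists_germ (U := PolarTree.qRoots f g 𝔹) (fun γ hγ => hγ.1.1)
        fun χ hχ γ hγ => h.qRoots_twist h𝔹 hχ hγ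
      exact ⟨F, fun _ => hF⟩
    · exact ⟨0, fun h' => absurd h' h𝔹⟩
  choose P hP using hP
  choose Q hQ using hQ
  refine ⟨hfin, h.finite_classes, Qg, P, Q, hQg, fun 𝔹 h𝔹 => ⟨hP 𝔹 h𝔹, hQ 𝔹 h𝔹⟩, w, E, ?_⟩
  -- The product of the factors and the monic factor W of J are germs of the same polynomial,
  -- because every root of J is polar. They coincide by uniqueness of germs.
  have hall : PolarTree.IsGermOf (PolarTree.rootProd f g (PolarTree.polarRoots f g))
      (Qg * ∏ᶠ 𝔹 ∈ PolarTree.nonCollinearClasses f g, (P 𝔹 * Q 𝔹)) := by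
    rw [h.rootProd_polarRoots hfin]
    exact hQg.mul (PolarTree.isGermOf_finprod_mem h.finite_classes
      fun 𝔹 h𝔹 => (hP 𝔹 h𝔹).mul (hQ 𝔹 h𝔹))
  have hW : PolarTree.IsGermOf (PolarTree.rootProd f g (PolarTree.polarRoots f g)) W := by
    rw [PolarTree.rootProd, hR.finprod_eq fun γ hγ => hγ.1, Multiset.filter_eq_self.2]
    · exact hR.germ
    · exact fun γ hγ => h.mem_polarRoots.2 (hR.isRoot_iff.2 hγ)
  rw [mul_assoc, ← hW.unique hall]
  exact hR.eq
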